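/- Fix $L>0$. Let $K=SU(2)$ with Lie algebra $\mathfrak k=\mathfrak{su}(2)$, let $[A,B]=BA-AB$ and $\langle A,B\rangle=-2\operatorname{Tr}(AB)$ for $A,B\in\mathfrak k$, and let $A_1=\tfrac12\,\mathrm{diag}(i,-i)$. All curves are $C^\infty$ on $[0,L]$. An \emph{anchored spherical Darboux curve} is a pair $(X,R)$ of curves $[0,L]\to K$ with $X(0)=R(0)=I$ and $$X'(s)=X(s)\Lambda(s),\qquad \Lambda(s)=R(s)A_1R(s)^*\qquad (0\le s\le L);$$ it is \emph{frame-periodic} if $R$ is a smoothly closed curve, that is, the restriction to $[0,L]$ of a smooth $L$-periodic curve. Let $\mathrm{Horiz}(\mathcal D_s)(L)$ (respectively $\mathrm{Horiz}(\mathcal{PD}_s)(L)$) be the set of all curves $X$ for which some $(X,R)$ is an anchored (respectively anchored frame-periodic) Darboux curve. Give both sets the topology of the Fréchet space $F=C^\infty([0,L],M_2(\mathbb C))$ (uniform convergence of all derivatives). Smoothness of maps between open subsets of Fréchet spaces is meant in the usual sense: all iterated directional derivatives exist and are jointly continuous. A tangent vector $v$ to one of these sets at $X$ is the velocity $\dot\sigma(0)\in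 F$ of a smooth curve $\sigma:\mathbb R\to F$ that takes values in the set, with $\sigma(0)=X$. Write $v=XV$ with $V=X^*v$, and for tangent vectors $v_i=XV_i$ at $X$ put $$\omega_\Lambda(V_1,V_2)=-\int_0^L\langle\Lambda(s),[U_1(s),U_2(s)]\rangle\,ds,\qquad U_i=V_i'-[\Lambda,V_i],\quad \Lambda=X^*X'.$$ \textbf{Theorem.} Each of $M=\mathrm{Horiz}(\mathcal D_s)(L)$ and $M=\mathrm{Horiz}(\mathcal{PD}_s)(L)$ is a symplectic Fréchet manifold relative to $\omega$. That is: (1) $M$ is a Fréchet manifold, with the smooth structure induced from $F$: $M$ is Hausdorff and has an atlas of charts onto open subsets of a Fréchet space whose coordinate changes are smooth, the inclusion $M\to F$ is smooth, and every map from an open subset of a Fréchet space into the domain of a chart that is smooth as a map into $F$ is smooth as a map into $M$; (2) the tangent vectors to $M$ at each point form a vector space, and $\omega$ is a smooth differential $2$-form on $M$: it is bilinear and skew-symmetric on each tangent space and smooth in every chart of the atlas; (3) $\omega$ is non-degenerate: if $v_1$ is tangent to $M$ at $X$ and $\omega_\Lambda(V_1,V)=0$ for every tangent vector $v=XV$ at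 $X$, then $v_1=0$; (4) $\omega$ is closed: $d\omega(\xi_1,\xi_2,\xi_3)=0$ for all smooth vector fields $\xi_1,\xi_2,\xi_3$ on open subsets of chart domains, where $$d\omega(\xi_1,\xi_2,\xi_3)=\sum_{i}(-1)^{i+1}\xi_i\bigl(\omega(\xi_j,\xi_k)\bigr)+\sum_{i<j}(-1)^{i+j}\omega([\xi_i,\xi_j],\xi_k),$$ with $\{i,j,k\}=\{1,2,3\}$, $j<k$ in the first sum, and $[\xi,\eta]$ the Lie bracket of vector fields, $D\eta(\xi)-D\xi(\eta)$ in a chart. -/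

import Mathlib

open Set Filter Topology
open scoped ContDiff Matrix

attribute [local instance] Matrix.linftyOpNormedRing Matrix.linftyOpNormedAlgebra

noncomputable section

/-! ### Fréchet spaces and smooth maps between them -/

/-- A Fréchet space: a Hausdorff topological vector space whose topology is induced by a countable
family of seminorms and which is complete with respect to these seminorms. -/
class IsFrechetSpace (V : Type) [AddCommGroup V] [Module ℝ V] [TopologicalSpace V] : Prop where
  t2 : T2Space V
  seminorms : ∃ p : SeminormFamily ℝ V ℕ, WithSeminorms p ∧
    ∀ u : ℕ → V, (∀ n, ∀ ε > 0, ∃ N, ∀ i ≥ N, ∀ j ≥ N, p n (u i - u j) < ε) →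
      ∃ a, Tendsto u atTop (𝓝 a)

section Calculus

variable {E G : Type} [AddCommGroup E] [Module ℝ E] [TopologicalSpace E]
  [AddCommGroup G] [Module ℝ G] [TopologicalSpace G]

/-- `f` has directional derivative `f'` at `x` in the direction `h`. -/
def HasDirDerivAt (f : E → G) (f' : G) (x h : E) : Prop :=
  Tendsto (fun t : ℝ => t⁻¹ • (f (x + t • h) - f x)) (𝓝[≠] 0) (𝓝 f')

/-- The directional derivative `Df(x)h` (meaningful where it exists and `G` is Hausdorff). -/
def dirDeriv (f : E → G) (x h : E) : G :=
  haveI : Nonempty G := ⟨0⟩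
  limUnder (𝓝[≠] (0 : ℝ)) fun t : ℝ => t⁻¹ • (f (x + t • h) - f x)

end Calculus

/-- `f` is of class `C^n` on the open set `U` of a topological vector space: it is continuous and,
if `n ≥ 1`, the directional derivatives `Df(x)h` exist for all `x ∈ U` and all `h`, and the
map `(x, h) ↦ Df(x)h` is of class `C^(n-1)` on `U × E`. -/
def FrechetContDiffOn : (n : ℕ) → {E G : Type} → [AddCommGroup E] → [Module ℝ E] →
    [TopologicalSpace E] → [AddCommGroup G] → [Module ℝ G] → [TopologicalSpace G] →
    (f : E → G) → (U : Set E) → Prop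
  | 0, _, _, _, _, _, _, _, _, f, U => ContinuousOn f U
  | n + 1, E, G, _, _, _, _, _, _, f, U => ContinuousOn f U ∧
      ∃ f' : E × E → G, (∀ x ∈ U, ∀ h, HasDirDerivAt f (f' (x, h)) x h) ∧
        FrechetContDiffOn n f' (U ×ˢ univ)

/-- `f` is smooth on the open set `U`. -/
def FrechetSmoothOn {E G : Type} [AddCommGroup E] [Module ℝ E] [TopologicalSpace E]
    [AddCommGroup G] [Module ℝ G] [TopologicalSpace G] (f : E → G) (U : Set E) : Prop :=
  ∀ n, FrechetContDiffOn n f U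

/-! ### Fréchet manifolds and symplectic forms -/

/-- A Fréchet manifold modelled on the Fréchet space `V`: a Hausdorff space with an atlas of charts
onto open subsets of `V` all of whose coordinate changes are smooth. -/
structure IsFrechetManifold (V : Type) [AddCommGroup V] [Module ℝ V] [TopologicalSpace V]
    (M : Type) [TopologicalSpace M] [ChartedSpace V M] : Prop where
  model : IsFrechetSpace V
  t2 : T2Space M
  smooth_change : ∀ e ∈ atlas V M, ∀ e' ∈ atlas V M,
    FrechetSmoothOn (fun x => e' (e.symm x)) (e.symm.trans e').source

section Submanifold

variable {F : Type} [AddCommGroup F] [Module ℝ F] [TopologicalSpace F]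

/-- A subset `S` of a topological vector space `F`, with the subspace topology, is a Fréchet
manifold whose smooth structure is the one induced from `F`: the inclusion into `F` is smooth, and a
map from an open subset of a Fréchet space into the domain of a chart is smooth as soon as it is
smooth as a map into `F`. The last two conditions determine the smooth structure. -/
structure IsFrechetSubmanifold (V : Type) [AddCommGroup V] [Module ℝ V] [TopologicalSpace V]
    (S : Set F) [ChartedSpace V S] : Prop extends IsFrechetManifold V S where
  smooth_inclusion : ∀ e ∈ atlas V S, FrechetSmoothOn (fun x => (e.symm x : F)) e.target
  smooth_lift : ∀ e ∈ atlas V S, ∀ (G : Type) [AddCommGroup G] [Module ℝ G] [TopologicalSpace G]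
    [IsFrechetSpace G] (W : Set G) (g : G → S), IsOpen W → MapsTo g W e.source →
    FrechetSmoothOn (fun y => (g y : F)) W → FrechetSmoothOn (fun y => e (g y)) W

/-- The tangent vectors to `S` at `x`: velocities at time `0` of smooth curves in `S`
that start at `x`. -/
def tangentVectors (S : Set F) (x : F) : Set F :=
  {v | ∃ σ : ℝ → F, FrechetSmoothOn σ univ ∧ (∀ t, σ t ∈ S) ∧ σ 0 = x ∧ HasDirDerivAt σ v 0 1}

/-- The expression of `Ω` in the chart `e`: the pullback of `Ω` by the inverse of the chart. -/
def chartForm {V : Type} [AddCommGroup V] [Module ℝ V] [TopologicalSpace V] {S : Set F}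
    (Ω : F → F → F → ℝ) (e : OpenPartialHomeomorph S V) (x h k : V) : ℝ :=
  Ω (e.symm x) (dirDeriv (fun y => (e.symm y : F)) x h) (dirDeriv (fun y => (e.symm y : F)) x k)

end Submanifold

section Forms

variable {V : Type} [AddCommGroup V] [Module ℝ V] [TopologicalSpace V]

/-- The Lie bracket `[ξ, η] = Dη(ξ) - Dξ(η)` of vector fields on an open subset of `V`. -/
def frechetLieBracket (ξ η : V → V) (x : V) : V :=
  dirDeriv η x (ξ x) - dirDeriv ξ x (η x)

/-- The exterior derivative of a two-form `η`, evaluated on three vector fields: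
`dη(ξ₁, ξ₂, ξ₃) = ∑ (-1)^(i+1) ξᵢ(η(.., ξ̂ᵢ, ..)) + ∑_{i<j} (-1)^(i+j) η([ξᵢ, ξⱼ], ..)`. -/
def extDerivTwoForm (η : V → V → V → ℝ) (ξ₁ ξ₂ ξ₃ : V → V) (x : V) : ℝ :=
  dirDeriv (fun y => η y (ξ₂ y) (ξ₃ y)) x (ξ₁ x)
    - dirDeriv (fun y => η y (ξ₁ y) (ξ₃ y)) x (ξ₂ x)
    + dirDeriv (fun y => η y (ξ₁ y) (ξ₂ y)) x (ξ₃ x)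
    - η x (frechetLieBracket ξ₁ ξ₂ x) (ξ₃ x)
    + η x (frechetLieBracket ξ₁ ξ₃ x) (ξ₂ x)
    - η x (frechetLieBracket ξ₂ ξ₃ x) (ξ₁ x)

end Forms

/-- `Ω` is a symplectic form on the manifold `S`: the tangent vectors at each point form a vector
space, on which `Ω` is bilinear and skew-symmetric; `Ω` is smooth, non-degenerate, and closed.
Only the values of `Ω` at points of `S` and on tangent vectors to `S` matter.
Closedness is required for all smooth vector fields on all open subsets of chart domains. -/
structure IsSymplecticForm {F : Type} [AddCommGroup F] [Module ℝ F] [TopologicalSpace F]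
    (V : Type) [AddCommGroup V] [Module ℝ V] [TopologicalSpace V]
    (S : Set F) [ChartedSpace V S] (Ω : F → F → F → ℝ) : Prop where
  tangent_submodule : ∀ x ∈ S, ∃ T : Submodule ℝ F, (T : Set F) = tangentVectors S x
  add_left : ∀ x ∈ S, ∀ u ∈ tangentVectors S x, ∀ v ∈ tangentVectors S x,
    ∀ w ∈ tangentVectors S x, Ω x (u + v) w = Ω x u w + Ω x v w
  smul_left : ∀ x ∈ S, ∀ c : ℝ, ∀ u ∈ tangentVectors S x, ∀ w ∈ tangentVectors S x,
    Ω x (c • u) w = c * Ω x u w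
  skew : ∀ x ∈ S, ∀ u ∈ tangentVectors S x, ∀ w ∈ tangentVectors S x, Ω x u w = -Ω x w u
  smooth : ∀ e ∈ atlas V S,
    FrechetSmoothOn (fun p : V × V × V => chartForm Ω e p.1 p.2.1 p.2.2) (e.target ×ˢ univ)
  nondegenerate : ∀ x ∈ S, ∀ u ∈ tangentVectors S x,
    (∀ w ∈ tangentVectors S x, Ω x u w = 0) → u = 0
  closed : ∀ e ∈ atlas V S, ∀ W ⊆ e.target, IsOpen W → ∀ ξ₁ ξ₂ ξ₃ : V → V,
    FrechetSmoothOn ξ₁ W → FrechetSmoothOn ξ₂ W → FrechetSmoothOn ξ₃ W →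
    ∀ x ∈ W, extDerivTwoForm (chartForm Ω e) ξ₁ ξ₂ ξ₃ x = 0

/-- `S ⊆ F` is, with the smooth structure induced from `F`, a Fréchet manifold, and `Ω` is a
symplectic form on it. -/
def IsSymplecticFrechetManifold {F : Type} [AddCommGroup F] [Module ℝ F] [TopologicalSpace F]
    (S : Set F) (Ω : F → F → F → ℝ) : Prop :=
  ∃ (V : Type) (_ : AddCommGroup V) (_ : Module ℝ V) (_ : TopologicalSpace V)
    (_ : ChartedSpace V S), IsFrechetSubmanifold V S ∧ IsSymplecticForm V S Ω

/-! ### The space of smooth curves on `[0, L]` -/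

/-- Smooth maps `[0, L] → E` (one-sided derivatives at the ends), extended by zero to `ℝ`. -/
def smoothCurveSubmodule (L : ℝ) (E : Type) [NormedAddCommGroup E] [NormedSpace ℝ E] :
    Submodule ℝ (ℝ → E) where
  carrier := {f | ContDiffOn ℝ ∞ f (Icc 0 L) ∧ ∀ s ∉ Icc 0 L, f s = 0}
  add_mem' := fun hf hg => ⟨hf.1.add hg.1, fun s hs => by simp [hf.2 s hs, hg.2 s hs]⟩
  zero_mem' := ⟨contDiffOn_const, fun _ _ => rfl⟩
  smul_mem' := fun c _ hf => ⟨contDiffOn_const.smul hf.1, fun s hs => by simp [hf.2 s hs]⟩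

/-- The vector space `C^∞([0, L], E)`. -/
def SmoothCurve (L : ℝ) (E : Type) [NormedAddCommGroup E] [NormedSpace ℝ E] : Type :=
  smoothCurveSubmodule L E

namespace SmoothCurve

variable {L : ℝ} {E : Type} [NormedAddCommGroup E] [NormedSpace ℝ E]

instance : AddCommGroup (SmoothCurve L E) :=
  inferInstanceAs (AddCommGroup (smoothCurveSubmodule L E))

instance : Module ℝ (SmoothCurve L E) := inferInstanceAs (Module ℝ (smoothCurveSubmodule L E))

instance : CoeFun (SmoothCurve L E) fun _ => ℝ → E := ⟨fun f => f.1⟩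

/-- The seminorm `p_k(f) = sup_{s ∈ [0, L]} ‖f^(k)(s)‖`. -/
def seminorm [hL : Fact (0 < L)] (k : ℕ) : Seminorm ℝ (SmoothCurve L E) :=
  Seminorm.of (fun f => ⨆ s : Icc (0 : ℝ) L, ‖iteratedDerivWithin k f (Icc 0 L) s‖)
    (by
      intro f g
      have hu := uniqueDiffOn_Icc hL.out
      have hb : ∀ f : SmoothCurve L E, BddAbove
          (range fun s : Icc (0 : ℝ) L => ‖iteratedDerivWithin k f (Icc 0 L) s‖) := by
        intro f
        have hc : ContinuousOn (iteratedDerivWithin k f (Icc 0 L)) (Icc 0 L) :=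
          f.2.1.continuousOn_iteratedDerivWithin (by exact_mod_cast le_top) hu
        obtain ⟨C, hC⟩ := isCompact_Icc.exists_bound_of_continuousOn hc
        exact ⟨C, by rintro _ ⟨s, rfl⟩; exact hC s s.2⟩
      have : Nonempty (Icc (0 : ℝ) L) := ⟨⟨0, le_refl _, hL.out.le⟩⟩
      refine ciSup_le fun s => ?_
      have hk : ((k : ℕ∞ω)) ≤ ((⊤ : ℕ∞) : ℕ∞ω) := by exact_mod_cast le_top
      have h := iteratedDerivWithin_add (n := k) s.2 hu
        ((f.2.1 s s.2).of_le hk) ((g.2.1 s s.2).of_le hk)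
      change ‖iteratedDerivWithin k (f.1 + g.1) (Icc 0 L) s‖ ≤ _
      rw [h]
      exact (norm_add_le _ _).trans (add_le_add (le_ciSup (hb f) s) (le_ciSup (hb g) s)))
    (by
      intro c f
      have hu := uniqueDiffOn_Icc hL.out
      have hk : ((k : ℕ∞ω)) ≤ ((⊤ : ℕ∞) : ℕ∞ω) := by exact_mod_cast le_top
      rw [Real.mul_iSup_of_nonneg (norm_nonneg c)]
      refine iSup_congr fun s => ?_
      have h := iteratedDerivWithin_const_smul (n := k) s.2 hu c ((f.2.1 s s.2).of_le hk)
      change ‖iteratedDerivWithin k (c • f.1) (Icc 0 L) s‖ = _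
      rw [h, norm_smul])

/-- The `C^∞` topology: uniform convergence on `[0, L]` of all derivatives. -/
instance [Fact (0 < L)] : TopologicalSpace (SmoothCurve L E) :=
  (SeminormFamily.moduleFilterBasis (𝕜 := ℝ)
    (fun k : ℕ => (seminorm k : Seminorm ℝ (SmoothCurve L E)))).topology

theorem withSeminorms [Fact (0 < L)] :
    WithSeminorms (fun k : ℕ => (seminorm k : Seminorm ℝ (SmoothCurve L E))) := ⟨rfl⟩

end SmoothCurve

/-! ### Horizontal Darboux curves on the three-sphere `SU(2)` -/

/-- Complex `2 × 2` matrices. -/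
abbrev Mat2 : Type := Matrix (Fin 2) (Fin 2) ℂ

/-- The matrix `A₁ = (1/2) diag(i, -i)`. -/
def pauliA1 : Mat2 := (1 / 2 : ℂ) • !![Complex.I, 0; 0, -Complex.I]

/-- The Lie bracket, with the convention `[A, B] = BA - AB`. -/
def su2Bracket (A B : Mat2) : Mat2 := B * A - A * B

/-- The trace form `⟨A, B⟩ = -2 Tr(AB)`, which is real for `A`, `B` in the Lie algebra of
`SU(2)`. -/
def traceForm (A B : Mat2) : ℝ := (-2 * (A * B).trace).re

section Darboux

variable {L : ℝ}

/-- `(X, R)` is an anchored Darboux curve: `X` and `R` are smooth curves in `SU(2)`,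
`X(0) = R(0) = I`, and `X'(s) = X(s)Λ(s)` with `Λ(s) = R(s) A₁ R(s)*`. -/
structure IsAnchoredDarboux (X R : SmoothCurve L Mat2) : Prop where
  X_mem : ∀ s ∈ Icc 0 L, X s ∈ Matrix.specialUnitaryGroup (Fin 2) ℂ
  R_mem : ∀ s ∈ Icc 0 L, R s ∈ Matrix.specialUnitaryGroup (Fin 2) ℂ
  X_zero : X 0 = 1
  R_zero : R 0 = 1
  deriv_X : ∀ s ∈ Icc 0 L, derivWithin X (Icc 0 L) s = X s * (R s * pauliA1 * (R s)ᴴ)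

/-- `R` is a smoothly closed curve: it is the restriction to `[0, L]` of a smooth
`L`-periodic curve. -/
def IsSmoothlyClosed (R : SmoothCurve L Mat2) : Prop :=
  ∃ Q : ℝ → Mat2, ContDiff ℝ ∞ Q ∧ Function.Periodic Q L ∧ ∀ s ∈ Icc 0 L, Q s = R s

variable (L) in
/-- `Horiz(D_s)(L)`: the projections `X` of the anchored Darboux curves `(X, R)`. -/
def horizDarboux : Set (SmoothCurve L Mat2) :=
  {X | ∃ R, IsAnchoredDarboux X R}

variable (L) in
/-- `Horiz(PD_s)(L)`: the projections `X` of the anchored Darboux curves `(X, R)` that are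
frame-periodic. -/
def horizPeriodicDarboux : Set (SmoothCurve L Mat2) :=
  {X | ∃ R, IsAnchoredDarboux X R ∧ IsSmoothlyClosed R}

/-- `Λ = X* X'`. -/
def darbouxLambda (X : SmoothCurve L Mat2) (s : ℝ) : Mat2 :=
  (X s)ᴴ * derivWithin X (Icc 0 L) s

/-- `V = X* v`, so that `v = X V`. -/
def leftTranslate (X v : SmoothCurve L Mat2) (s : ℝ) : Mat2 := (X s)ᴴ * v s

/-- `U = V' - [Λ, V]`. -/
def darbouxU (X v : SmoothCurve L Mat2) (s : ℝ) : Mat2 :=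
  derivWithin (leftTranslate X v) (Icc 0 L) s
    - su2Bracket (darbouxLambda X s) (leftTranslate X v s)

/-- The form `ω_Λ(V₁, V₂) = -∫_0^L ⟨Λ, [U₁, U₂]⟩ ds`, for tangent vectors `vᵢ = X Vᵢ`. -/
def darbouxForm (X v₁ v₂ : SmoothCurve L Mat2) : ℝ :=
  -∫ s in (0 : ℝ)..L,
    traceForm (darbouxLambda X s) (su2Bracket (darbouxU X v₁ s) (darbouxU X v₂ s))

end Darboux

end

set_option linter.unusedSectionVars false

noncomputable section

/-! ### Directional derivatives -/

section DirDeriv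

variable {E F G H : Type} [AddCommGroup E] [Module ℝ E] [TopologicalSpace E]
  [AddCommGroup F] [Module ℝ F] [TopologicalSpace F]
  [AddCommGroup G] [Module ℝ G] [TopologicalSpace G]
  [AddCommGroup H] [Module ℝ H] [TopologicalSpace H]

/-! A horizontal curve $X$ is determined by its logarithmic derivative $\Lambda=X^*X'$, a curve on
the sphere of conjugates of $A_1$ that starts at $A_1$. The problem therefore becomes one about
curves on a round 2-sphere, and $\omega$ becomes, up to sign and normalization, the area form of
that sphere integrated along the curve.

Charts. Fix a frame $R$ in $SU(2)$ with $R(0)=I$, smoothly closed in the periodic case. Rotate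
$\Lambda$ to $R^*\Lambda R$ and project it stereographically from $-A_1$. The coordinate is a curve
$f$ in $\mathbb C$ with $f(0)=0$, closed in the periodic case; such curves form a closed subspace of
$C^\infty([0,L],\mathbb C)$, hence a Fréchet space. Every $f$ in it occurs, because inverse
stereographic projection lifts smoothly to $SU(2)$ with $0\mapsto I$, so that $f$ supplies a new
frame (`IsFrame.mul_frameCurve`). Every $X$ lies in the chart of its own frame, at the origin
(`mem_coordDomain_self`). The coordinate is an explicit smooth map on an open subset of the ambient
space $F$. Its inverse `ofCoord` passes from $f$ to $\Lambda$ and then solves $X'=X\Lambda$; the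
analytic core is `frechetSmoothOn_sol`, the smooth dependence of the solution on $\Lambda$ in the
$C^\infty$ topology. Coordinate changes and the lifting property then follow from the chain rule.

The form. The variation of $X$ caused by a variation $\delta\Lambda$ has $U=\delta\Lambda$
(`darbouxU_eq`). Conjugation by $R$ drops out, and `traceForm_stereoPoint` gives in every chart
$$\omega_f(h,k)=-4\int_0^L \frac{\operatorname{Im}(\bar h k)}{(1+|f|^2)^2}\,ds .$$ Bilinearity,
skew-symmetry and smoothness can be read off. Taking $k=ih$, which stays in the model space, gives
non-degeneracy. Closedness holds pointwise in $s$, since a 3-form on the plane vanishes.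

Both spaces are treated at once: a proposition $c$ switches the closedness condition on or off. -/

theorem HasDirDerivAt.dirDeriv_eq [T2Space G] {f : E → G} {f' : G} {x h : E}
    (hf : HasDirDerivAt f f' x h) : dirDeriv f x h = f' :=
  Tendsto.limUnder_eq hf

theorem HasDirDerivAt.unique [T2Space G] {f : E → G} {a b : G} {x h : E}
    (ha : HasDirDerivAt f a x h) (hb : HasDirDerivAt f b x h) : a = b :=
  tendsto_nhds_unique ha hb

theorem tendsto_line [ContinuousAdd E] [ContinuousSMul ℝ E] (x h : E) :
    Tendsto (fun t : ℝ => x + t • h) (𝓝 0) (𝓝 x) := by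
  have : Continuous fun t : ℝ => x + t • h := by fun_prop
  simpa using this.tendsto 0

theorem HasDirDerivAt.congr [ContinuousAdd E] [ContinuousSMul ℝ E] {f g : E → G} {f' : G}
    {x h : E} {U : Set E} (hf : HasDirDerivAt f f' x h) (hU : IsOpen U) (hx : x ∈ U)
    (hfg : EqOn f g U) : HasDirDerivAt g f' x h := by
  refine Tendsto.congr' ?_ hf
  have := (tendsto_line x h).eventually (hU.mem_nhds hx)
  filter_upwards [nhdsWithin_le_nhds this] with t ht
  rw [hfg ht, hfg hx]

theorem HasDirDerivAt.tendsto [IsTopologicalAddGroup G] [ContinuousSMul ℝ G] {f : E → G} {f' : G}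
    {x h : E} (hf : HasDirDerivAt f f' x h) :
    Tendsto (fun t : ℝ => f (x + t • h)) (𝓝[≠] 0) (𝓝 (f x)) := by
  have h0 : Tendsto (fun t : ℝ => t) (𝓝[≠] 0) (𝓝 0) := nhdsWithin_le_nhds
  have h1 := (h0.smul hf).add_const (f x)
  rw [zero_smul, zero_add] at h1
  refine h1.congr' ?_
  filter_upwards [self_mem_nhdsWithin] with t ht
  rw [smul_inv_smul₀ ht, sub_add_cancel]

theorem HasDirDerivAt.smul_dir [ContinuousConstSMul ℝ G] {f : E → G} {f' : G} {x h : E}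
    (hf : HasDirDerivAt f f' x h) (c : ℝ) : HasDirDerivAt f (c • f') x (c • h) := by
  rcases eq_or_ne c 0 with rfl | hc
  · simp [HasDirDerivAt, tendsto_const_nhds]
  · have h0 : Tendsto (fun t : ℝ => t * c) (𝓝[≠] 0) (𝓝[≠] 0) := by
      refine tendsto_nhdsWithin_iff.2 ⟨?_, ?_⟩
      · have : Continuous fun t : ℝ => t * c := by fun_prop
        exact (by simpa using this.tendsto 0 : Tendsto (fun t : ℝ => t * c) (𝓝 0) (𝓝 0)).mono_left
          nhdsWithin_le_nhds
      · filter_upwards [self_mem_nhdsWithin] with t ht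
        exact mul_ne_zero ht hc
    refine ((hf.comp h0).const_smul c).congr' ?_
    filter_upwards [self_mem_nhdsWithin] with t ht
    simp only [Function.comp_apply, smul_smul, mul_inv]
    congr 1
    field_simp

theorem hasDirDerivAt_const (c : G) (x h : E) : HasDirDerivAt (fun _ => c) 0 x h := by
  simp [HasDirDerivAt, tendsto_const_nhds]

theorem hasDirDerivAt_id (x h : E) : HasDirDerivAt (fun y => y) h x h := by
  refine tendsto_const_nhds.congr' ?_
  filter_upwards [self_mem_nhdsWithin] with t ht
  rw [add_sub_cancel_left, inv_smul_smul₀ ht]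

theorem HasDirDerivAt.add [ContinuousAdd G] {f g : E → G} {f' g' : G} {x h : E}
    (hf : HasDirDerivAt f f' x h) (hg : HasDirDerivAt g g' x h) :
    HasDirDerivAt (fun y => f y + g y) (f' + g') x h := by
  refine (Tendsto.add hf hg).congr fun t => ?_
  rw [← smul_add, add_sub_add_comm]

theorem HasDirDerivAt.prodMk {f : E → F} {g : E → G} {f' : F} {g' : G} {x h : E}
    (hf : HasDirDerivAt f f' x h) (hg : HasDirDerivAt g g' x h) :
    HasDirDerivAt (fun y => (f y, g y)) (f', g') x h :=
  Tendsto.prodMk_nhds hf hg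

theorem HasDirDerivAt.clm_comp {f : E → F} {f' : F} {x h : E} (ℓ : F →L[ℝ] G)
    (hf : HasDirDerivAt f f' x h) : HasDirDerivAt (fun y => ℓ (f y)) (ℓ f') x h := by
  refine ((ℓ.continuous.tendsto _).comp hf).congr fun t => ?_
  simp

theorem HasDirDerivAt.comp_clm {f : F → G} {f' : G} {x h : E} (ℓ : E →L[ℝ] F)
    (hf : HasDirDerivAt f f' (ℓ x) (ℓ h)) : HasDirDerivAt (fun y => f (ℓ y)) f' x h := by
  refine Tendsto.congr (fun t => ?_) hf
  simp

end DirDeriv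

/-! ### Product rule and derivative of the inverse in a topological algebra. -/

section DirDerivAlgebra

variable {E A : Type} [AddCommGroup E] [Module ℝ E] [TopologicalSpace E]
  [Ring A] [Algebra ℝ A] [TopologicalSpace A] [IsTopologicalRing A] [ContinuousSMul ℝ A]

theorem HasDirDerivAt.mul {f g : E → A} {f' g' : A} {x h : E}
    (hf : HasDirDerivAt f f' x h) (hg : HasDirDerivAt g g' x h) :
    HasDirDerivAt (fun y => f y * g y) (f' * g x + f x * g') x h := by
  refine ((Tendsto.mul hf hg.tendsto).add (hg.const_mul (f x))).congr fun t => ?_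
  rw [smul_mul_assoc, mul_smul_comm, ← smul_add]
  congr 1
  noncomm_ring

/-- The identity $a^{-1}-b^{-1}=-a^{-1}(a-b)b^{-1}$ reduces the claim to continuity of inversion.
Openness of the units and this continuity are not automatic in a Fréchet algebra and enter as
hypotheses. -/
theorem HasDirDerivAt.ringInverse {f : E → A} {f' : A} {x h : E} (hf : HasDirDerivAt f f' x h)
    (hx : IsUnit (f x)) (hU : IsOpen {a : A | IsUnit a})
    (hi : ContinuousAt Ring.inverse (f x)) :
    HasDirDerivAt (fun y => Ring.inverse (f y)) (-(Ring.inverse (f x) * f' * Ring.inverse (f x)))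
      x h := by
  have h1 : Tendsto (fun t : ℝ => Ring.inverse (f (x + t • h))) (𝓝[≠] 0)
    (𝓝 (Ring.inverse (f x))) := hi.tendsto.comp hf.tendsto
  refine ((h1.mul hf).mul_const (Ring.inverse (f x))).neg.congr' ?_
  filter_upwards [hf.tendsto.eventually (hU.mem_nhds hx)] with t ht
  rw [mul_smul_comm, smul_mul_assoc, ← smul_neg, mul_sub, sub_mul,
    Ring.inverse_mul_cancel _ ht, mul_assoc, Ring.mul_inverse_cancel _ hx]
  congr 1
  noncomm_ring

end DirDerivAlgebra

/-! ### The mean value inequality and its consequences -/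

section MeanValue

variable {E G : Type} [AddCommGroup E] [Module ℝ E] [TopologicalSpace E]
  [AddCommGroup G] [Module ℝ G] [TopologicalSpace G]

/-- By the triangle inequality the right slopes of $\tau\mapsto p(c(\tau)-c(0))$ are bounded by $p$
of the difference quotients of $c$, so the comparison principle for real functions applies. Neither
integrals nor completeness of $G$ are needed. -/
theorem Seminorm.mean_value_le (p : Seminorm ℝ G) (hp : Continuous p)
    [IsTopologicalAddGroup G] [ContinuousSMul ℝ G] {c c' : ℝ → G} {C : ℝ}
    (hc : ∀ τ ∈ Icc (0 : ℝ) 1, HasDirDerivAt c (c' τ) τ 1) (hC : ∀ τ ∈ Icc (0 : ℝ) 1, p (c' τ) ≤ C) :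
    p (c 1 - c 0) ≤ C := by
  have hcont : ∀ τ ∈ Icc (0 : ℝ) 1, ContinuousAt c τ := by
    intro τ hτ
    have h1 := (hc τ hτ).tendsto
    have h2 : Tendsto (fun t : ℝ => c (τ + t • (1 : ℝ))) (𝓝 0) (𝓝 (c τ)) := by
      rw [← nhdsNE_sup_pure]
      refine h1.sup ?_
      simpa using tendsto_pure_nhds (fun t : ℝ => c (τ + t)) 0
    have h3 : Tendsto (fun s : ℝ => s - τ) (𝓝 τ) (𝓝 0) := by
      have : Continuous fun s : ℝ => s - τ := by fun_prop
      simpa using this.tendsto τ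
    refine (h2.comp h3).congr fun s => ?_
    simp
  have key := image_le_of_liminf_slope_right_le_deriv_boundary (f := fun τ => p (c τ - c 0))
    (a := 0) (b := 1) (B := fun τ => C * τ) (B' := fun _ => C) ?_ (by simp) (by fun_prop) ?_ ?_
    (right_mem_Icc.2 zero_le_one)
  · simpa using key
  · intro τ hτ
    exact (hp.continuousAt.comp ((hcont τ hτ).sub continuousAt_const)).continuousWithinAt
  · intro x _
    simpa using ((hasDerivAt_id x).const_mul C).hasDerivWithinAt
  · intro x hx r hr
    have hx' : x ∈ Icc (0 : ℝ) 1 := Ico_subset_Icc_self hx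
    have h1 := (hp.tendsto _).comp (hc x hx')
    have h2 : ∀ᶠ t in 𝓝[≠] (0 : ℝ), p (t⁻¹ • (c (x + t • (1 : ℝ)) - c x)) < r :=
      h1.eventually (gt_mem_nhds ((hC x hx').trans_lt hr))
    have h3 : Tendsto (fun z => z - x) (𝓝[>] x) (𝓝[≠] 0) := by
      refine tendsto_nhdsWithin_iff.2 ⟨?_, ?_⟩
      · have : Continuous fun s : ℝ => s - x := by fun_prop
        exact (by simpa using this.tendsto x :
          Tendsto (fun s => s - x) (𝓝 x) (𝓝 0)).mono_left nhdsWithin_le_nhds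
      · filter_upwards [self_mem_nhdsWithin] with z hz
        exact sub_ne_zero.2 (ne_of_gt hz)
    refine Eventually.frequently ?_
    filter_upwards [h3.eventually h2, self_mem_nhdsWithin] with z hz hzx
    have hpos : 0 < z - x := sub_pos.2 hzx
    refine lt_of_le_of_lt ?_ hz
    rw [map_smul_eq_mul, slope_def_field, Real.norm_eq_abs, abs_of_pos (inv_pos.2 hpos),
      div_eq_inv_mul]
    refine mul_le_mul_of_nonneg_left ?_ (inv_pos.2 hpos).le
    have := map_sub_le_add p (c z - c 0) (c x - c 0)
    have h4 : p (c z - c 0) ≤ p (c z - c x) + p (c x - c 0) := by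
      have := map_add_le_add p (c z - c x) (c x - c 0)
      rwa [sub_add_sub_cancel] at this
    simp only [smul_eq_mul, mul_one, add_sub_cancel]
    linarith

variable [IsTopologicalAddGroup E] [ContinuousSMul ℝ E]
  [IsTopologicalAddGroup G] [ContinuousSMul ℝ G] [LocallyConvexSpace ℝ G]

/-- The directional derivative of a `C¹` map is strict. -/
theorem tendsto_slope_of_continuousOn {f : E → G} {f' : E × E → G} {U : Set E} (hU : IsOpen U)
    (hd : ∀ x ∈ U, ∀ h, HasDirDerivAt f (f' (x, h)) x h) (hc : ContinuousOn f' (U ×ˢ univ))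
    {ι : Type*} {l : Filter ι} {y k : ι → E} {t : ι → ℝ} {x h : E} (hx : x ∈ U)
    (hy : Tendsto y l (𝓝 x)) (hk : Tendsto k l (𝓝 h)) (ht : Tendsto t l (𝓝 0))
    (ht0 : ∀ᶠ i in l, t i ≠ 0) :
    Tendsto (fun i => (t i)⁻¹ • (f (y i + t i • k i) - f (y i))) l (𝓝 (f' (x, h))) := by
  have hp := with_gaugeSeminormFamily (𝕜 := ℝ) (E := G)
  refine (hp.tendsto_nhds _ _).2 fun i ε hε => ?_
  set p := gaugeSeminormFamily ℝ G i
  have hpc : Continuous p := hp.continuous_seminorm i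
  have hUo : IsOpen (U ×ˢ (univ : Set E)) := hU.prod isOpen_univ
  have h1 : ∀ᶠ z in 𝓝 (x, h), z ∈ U ×ˢ (univ : Set E) ∧ p (f' z - f' (x, h)) < ε / 2 := by
    have hca : ContinuousAt f' (x, h) := hc.continuousAt (hUo.mem_nhds ⟨hx, trivial⟩)
    have h2 : ContinuousAt (fun z => p (f' z - f' (x, h))) (x, h) :=
      hpc.continuousAt.comp (hca.sub continuousAt_const)
    refine (hUo.eventually_mem ⟨hx, trivial⟩).and ?_
    exact h2.eventually (gt_mem_nhds (by simpa using half_pos hε))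
  have hΨ : Continuous fun z : (E × E) × ℝ => (z.1.1 + z.2 • z.1.2, z.1.2) := by fun_prop
  have h2 : ∀ᶠ z in 𝓝 ((x, h), (0 : ℝ)), (z.1.1 + z.2 • z.1.2, z.1.2) ∈ U ×ˢ (univ : Set E) ∧
      p (f' (z.1.1 + z.2 • z.1.2, z.1.2) - f' (x, h)) < ε / 2 := by
    have := hΨ.tendsto ((x, h), (0 : ℝ))
    simp only [zero_smul, add_zero] at this
    exact this.eventually h1
  rw [nhds_prod_eq] at h2
  obtain ⟨P, hP, Q, hQ, hPQ⟩ := Filter.eventually_prod_iff.1 h2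
  obtain ⟨δ, hδ, hδQ⟩ := Metric.eventually_nhds_iff.1 hQ
  filter_upwards [(hy.prodMk_nhds hk).eventually hP, ht.eventually (Metric.ball_mem_nhds 0 hδ),
    ht0] with i hPi hti hti0
  have hseg : ∀ τ ∈ Icc (0 : ℝ) 1, y i + (τ * t i) • k i ∈ U ∧
      p (f' (y i + (τ * t i) • k i, k i) - f' (x, h)) < ε / 2 := by
    intro τ hτ
    have : dist (τ * t i) 0 < δ := by
      rw [dist_zero_right, norm_mul, Real.norm_eq_abs τ, abs_of_nonneg hτ.1]
      have hti : dist (t i) 0 < δ := hti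
      rw [dist_zero_right, Real.norm_eq_abs] at hti
      rw [Real.norm_eq_abs]
      exact (mul_le_of_le_one_left (abs_nonneg _) hτ.2).trans_lt hti
    have := hPQ hPi (hδQ this)
    exact ⟨this.1.1, this.2⟩
  have hmv := p.mean_value_le hpc
    -- Subtracting the linear part $\tau t f'(x,h)$ leaves a curve whose derivative is
    -- $t\,(f'(y+\tau t k,k)-f'(x,h))$. By joint continuity of $f'$ at $(x,h)$ this is small along
    -- the whole segment.
    (c := fun τ => f (y i + (τ * t i) • k i) + (-(τ * t i)) • f' (x, h))
    (c' := fun τ => t i • (f' (y i + (τ * t i) • k i, k i) - f' (x, h))) (C := |t i| * (ε / 2))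
    (fun τ hτ => by
      rw [smul_sub, sub_eq_add_neg]
      refine HasDirDerivAt.add ?_ ?_
      · refine Tendsto.congr (fun s => ?_) ((hd _ (hseg τ hτ).1 (k i)).smul_dir (t i))
        congr 3
        simp only [smul_eq_mul, mul_one, add_mul, add_smul, smul_smul, add_assoc]
      · refine tendsto_const_nhds.congr' ?_
        filter_upwards [self_mem_nhdsWithin] with s hs
        rw [← sub_smul, smul_smul, ← neg_smul]
        congr 1
        have : s ≠ 0 := hs
        simp only [smul_eq_mul, mul_one]
        field_simp
        ring)
    (fun τ hτ => by
      rw [map_smul_eq_mul, Real.norm_eq_abs]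
      exact mul_le_mul_of_nonneg_left (hseg τ hτ).2.le (abs_nonneg _))
  simp only [one_mul, zero_mul, zero_smul, add_zero, neg_zero] at hmv
  have habs : 0 < |t i| := abs_pos.2 hti0
  have heq : (t i)⁻¹ • (f (y i + t i • k i) - f (y i)) - f' (x, h) =
      (t i)⁻¹ • (f (y i + t i • k i) + (-t i) • f' (x, h) - f (y i)) := by
    rw [add_sub_right_comm, smul_add, smul_smul, mul_neg, inv_mul_cancel₀ hti0, neg_one_smul,
      sub_eq_add_neg]
  rw [heq, map_smul_eq_mul, norm_inv, Real.norm_eq_abs]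
  calc |t i|⁻¹ * _ ≤ |t i|⁻¹ * (|t i| * (ε / 2)) :=
        mul_le_mul_of_nonneg_left hmv (inv_pos.2 habs).le
    _ = ε / 2 := by field_simp
    _ < ε := half_lt_self hε

/-- The increment along $t(h+k)$ splits at $x+th$. The second piece starts at a moving base point,
so strictness of the derivative is what gives its limit. -/
theorem HasDirDerivAt.add_dir [T2Space G] {f : E → G} {f' : E × E → G} {U : Set E} (hU : IsOpen U)
    (hd : ∀ x ∈ U, ∀ h, HasDirDerivAt f (f' (x, h)) x h) (hc : ContinuousOn f' (U ×ˢ univ))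
    {x : E} (hx : x ∈ U) (h k : E) : f' (x, h + k) = f' (x, h) + f' (x, k) := by
  have h0 : Tendsto (fun t : ℝ => t) (𝓝[≠] 0) (𝓝 0) := nhdsWithin_le_nhds
  have h1 := tendsto_slope_of_continuousOn hU hd hc (k := fun _ => k) hx
    ((tendsto_line x h).mono_left nhdsWithin_le_nhds) tendsto_const_nhds h0 self_mem_nhdsWithin
  refine (hd x hx (h + k)).unique (Tendsto.congr (fun t => ?_) (Tendsto.add (hd x hx h) h1))
  rw [← smul_add]
  congr 1
  rw [smul_add, add_assoc, add_comm, sub_add_sub_cancel]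

end MeanValue

end

noncomputable section

/-! ### Maps of class `C^n` between topological vector spaces -/

section ContDiffOn

variable {E F G : Type} [AddCommGroup E] [Module ℝ E] [TopologicalSpace E]
  [AddCommGroup F] [Module ℝ F] [TopologicalSpace F]
  [AddCommGroup G] [Module ℝ G] [TopologicalSpace G]

theorem frechetContDiffOn_zero {f : E → G} {U : Set E} :
    FrechetContDiffOn 0 f U ↔ ContinuousOn f U := by
  simp only [FrechetContDiffOn]

theorem frechetContDiffOn_succ {n : ℕ} {f : E → G} {U : Set E} :
    FrechetContDiffOn (n + 1) f U ↔ ContinuousOn f U ∧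
      ∃ f' : E × E → G, (∀ x ∈ U, ∀ h, HasDirDerivAt f (f' (x, h)) x h) ∧
        FrechetContDiffOn n f' (U ×ˢ univ) := by
  simp only [FrechetContDiffOn]

theorem FrechetContDiffOn.continuousOn {n : ℕ} {f : E → G} {U : Set E}
    (hf : FrechetContDiffOn n f U) : ContinuousOn f U := by
  cases n with
  | zero => exact frechetContDiffOn_zero.1 hf
  | succ n => exact (frechetContDiffOn_succ.1 hf).1

theorem FrechetSmoothOn.continuousOn {f : E → G} {U : Set E} (hf : FrechetSmoothOn f U) :
    ContinuousOn f U :=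
  (hf 0).continuousOn

theorem FrechetContDiffOn.mono {n : ℕ} {f : E → G} {U W : Set E}
    (hf : FrechetContDiffOn n f U) (hW : W ⊆ U) : FrechetContDiffOn n f W := by
  induction n generalizing E G with
  | zero => exact frechetContDiffOn_zero.2 ((frechetContDiffOn_zero.1 hf).mono hW)
  | succ n ih =>
    obtain ⟨h0, f', h1, h2⟩ := frechetContDiffOn_succ.1 hf
    exact frechetContDiffOn_succ.2 ⟨h0.mono hW, f', fun x hx => h1 x (hW hx),
      ih h2 (prod_mono hW Subset.rfl)⟩

theorem FrechetSmoothOn.mono {f : E → G} {U W : Set E}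
    (hf : FrechetSmoothOn f U) (hW : W ⊆ U) : FrechetSmoothOn f W :=
  fun n => (hf n).mono hW

theorem FrechetContDiffOn.of_succ {n : ℕ} {f : E → G} {U : Set E}
    (hf : FrechetContDiffOn (n + 1) f U) : FrechetContDiffOn n f U := by
  induction n generalizing E G with
  | zero => exact frechetContDiffOn_zero.2 hf.continuousOn
  | succ n ih =>
    obtain ⟨h0, f', h1, h2⟩ := frechetContDiffOn_succ.1 hf
    exact frechetContDiffOn_succ.2 ⟨h0, f', h1, ih h2⟩

theorem FrechetContDiffOn.congr [ContinuousAdd E] [ContinuousSMul ℝ E] {n : ℕ} {f g : E → G}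
    {U : Set E} (hf : FrechetContDiffOn n f U) (hU : IsOpen U) (hfg : EqOn f g U) :
    FrechetContDiffOn n g U := by
  cases n with
  | zero => exact frechetContDiffOn_zero.2 (hf.continuousOn.congr hfg.symm)
  | succ n =>
    obtain ⟨h0, f', h1, h2⟩ := frechetContDiffOn_succ.1 hf
    exact frechetContDiffOn_succ.2 ⟨h0.congr hfg.symm, f',
      fun x hx h => (h1 x hx h).congr hU hx hfg, h2⟩

theorem FrechetSmoothOn.congr [ContinuousAdd E] [ContinuousSMul ℝ E] {f g : E → G}
    {U : Set E} (hf : FrechetSmoothOn f U) (hU : IsOpen U) (hfg : EqOn f g U) :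
    FrechetSmoothOn g U :=
  fun n => (hf n).congr hU hfg

theorem FrechetContDiffOn.comp_clm {n : ℕ} {f : F → G} {U : Set F} (hf : FrechetContDiffOn n f U)
    (ℓ : E →L[ℝ] F) : FrechetContDiffOn n (fun x => f (ℓ x)) (ℓ ⁻¹' U) := by
  induction n generalizing E F G with
  | zero =>
    exact frechetContDiffOn_zero.2
      (hf.continuousOn.comp ℓ.continuous.continuousOn (mapsTo_preimage _ _))
  | succ n ih =>
    obtain ⟨h0, f', h1, h2⟩ := frechetContDiffOn_succ.1 hf
    refine frechetContDiffOn_succ.2 ⟨h0.comp ℓ.continuous.continuousOn (mapsTo_preimage _ _),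
      fun p => f' (ℓ p.1, ℓ p.2), fun x hx h => HasDirDerivAt.comp_clm ℓ (h1 _ hx _), ?_⟩
    refine (ih h2 (ℓ.prodMap ℓ)).mono ?_
    rintro ⟨x, h⟩ ⟨hx, -⟩
    exact ⟨hx, trivial⟩

theorem FrechetSmoothOn.comp_clm {f : F → G} {U : Set F} (hf : FrechetSmoothOn f U)
    (ℓ : E →L[ℝ] F) : FrechetSmoothOn (fun x => f (ℓ x)) (ℓ ⁻¹' U) :=
  fun n => (hf n).comp_clm ℓ

theorem FrechetContDiffOn.clm_comp {n : ℕ} {f : E → F} {U : Set E} (hf : FrechetContDiffOn n f U)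
    (ℓ : F →L[ℝ] G) : FrechetContDiffOn n (fun x => ℓ (f x)) U := by
  induction n generalizing E F G with
  | zero => exact frechetContDiffOn_zero.2 (ℓ.continuous.comp_continuousOn hf.continuousOn)
  | succ n ih =>
    obtain ⟨h0, f', h1, h2⟩ := frechetContDiffOn_succ.1 hf
    exact frechetContDiffOn_succ.2 ⟨ℓ.continuous.comp_continuousOn h0,
      fun p => ℓ (f' p), fun x hx h => HasDirDerivAt.clm_comp ℓ (h1 _ hx _), ih h2 ℓ⟩

theorem FrechetSmoothOn.clm_comp {f : E → F} {U : Set E} (hf : FrechetSmoothOn f U)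
    (ℓ : F →L[ℝ] G) : FrechetSmoothOn (fun x => ℓ (f x)) U :=
  fun n => (hf n).clm_comp ℓ

theorem FrechetContDiffOn.prodMk {n : ℕ} {f : E → F} {g : E → G} {U : Set E}
    (hf : FrechetContDiffOn n f U) (hg : FrechetContDiffOn n g U) :
    FrechetContDiffOn n (fun x => (f x, g x)) U := by
  induction n generalizing E F G with
  | zero => exact frechetContDiffOn_zero.2 (hf.continuousOn.prodMk hg.continuousOn)
  | succ n ih =>
    obtain ⟨h0, f', h1, h2⟩ := frechetContDiffOn_succ.1 hf
    obtain ⟨k0, g', k1, k2⟩ := frechetContDiffOn_succ.1 hg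
    exact frechetContDiffOn_succ.2 ⟨h0.prodMk k0, fun p => (f' p, g' p),
      fun x hx h => (h1 x hx h).prodMk (k1 x hx h), ih h2 k2⟩

theorem frechetSmoothOn_const (c : G) (U : Set E) : FrechetSmoothOn (fun _ : E => c) U := by
  intro n
  induction n generalizing E c with
  | zero => exact frechetContDiffOn_zero.2 continuousOn_const
  | succ n ih =>
    exact frechetContDiffOn_succ.2 ⟨continuousOn_const, fun _ => 0,
      fun x _ h => hasDirDerivAt_const c x h, ih _ _⟩

theorem frechetSmoothOn_clm (ℓ : E →L[ℝ] G) (U : Set E) : FrechetSmoothOn (fun x => ℓ x) U := by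
  intro n
  induction n generalizing E with
  | zero => exact frechetContDiffOn_zero.2 ℓ.continuous.continuousOn
  | succ n ih =>
    exact frechetContDiffOn_succ.2 ⟨ℓ.continuous.continuousOn,
      fun p => (ℓ.comp (ContinuousLinearMap.snd ℝ E E)) p,
      fun x _ h => HasDirDerivAt.clm_comp ℓ (hasDirDerivAt_id x h), ih _ _⟩

theorem frechetSmoothOn_id (U : Set E) : FrechetSmoothOn (fun x : E => x) U :=
  frechetSmoothOn_clm (ContinuousLinearMap.id ℝ E) U

theorem frechetSmoothOn_snd (U : Set (E × F)) : FrechetSmoothOn (fun x : E × F => x.2) U :=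
  frechetSmoothOn_clm (ContinuousLinearMap.snd ℝ E F) U

/-- A map into a closed subspace is of class `C^n` if it is so as a map into the ambient space. -/
theorem FrechetContDiffOn.codRestrict [ContinuousAdd E] [ContinuousSMul ℝ E] {n : ℕ}
    {P : Submodule ℝ G} (hP : IsClosed (P : Set G)) {f : E → P} {U : Set E} (hU : IsOpen U)
    (hf : FrechetContDiffOn n (fun x => (f x : G)) U) : FrechetContDiffOn n f U := by
  classical
  induction n generalizing E with
  | zero => exact frechetContDiffOn_zero.2 (IsInducing.subtypeVal.continuousOn_iff.2 hf.continuousOn)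
  | succ n ih =>
    obtain ⟨h0, f', h1, h2⟩ := frechetContDiffOn_succ.1 hf
    -- Difference quotients lie in $P$, and so do their limits since $P$ is closed. Off $U\times E$
    -- the map $f'$ is arbitrary, which is why $0$ is used there as a default.
    have hmem : ∀ p ∈ U ×ˢ (univ : Set E), f' p ∈ P := fun p hp =>
      hP.mem_of_tendsto (h1 p.1 hp.1 p.2) (Eventually.of_forall fun t =>
        P.smul_mem _ (P.sub_mem (f _).2 (f _).2))
    let g' : E × E → P := fun p => if hp : f' p ∈ P then ⟨f' p, hp⟩ else 0
    have hg' : ∀ p ∈ U ×ˢ (univ : Set E), f' p = g' p := fun p hp => by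
      simp only [g', dif_pos (hmem p hp)]
    refine frechetContDiffOn_succ.2 ⟨IsInducing.subtypeVal.continuousOn_iff.2 h0, g',
      fun x hx h => ?_, ih (hU.prod isOpen_univ) (h2.congr (hU.prod isOpen_univ) hg')⟩
    refine tendsto_subtype_rng.2 ?_
    rw [← hg' (x, h) ⟨hx, trivial⟩]
    exact h1 x hx h

theorem FrechetSmoothOn.codRestrict [ContinuousAdd E] [ContinuousSMul ℝ E]
    {P : Submodule ℝ G} (hP : IsClosed (P : Set G)) {f : E → P} {U : Set E} (hU : IsOpen U)
    (hf : FrechetSmoothOn (fun x => (f x : G)) U) : FrechetSmoothOn f U :=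
  fun n => (hf n).codRestrict hP hU

/-- Writing $g(x+th)=g(x)+t\,k_t$ with $k_t\to g'$ turns this into a derivative of $f$ along a
varying direction, which strictness covers. -/
theorem HasDirDerivAt.comp [IsTopologicalAddGroup F] [ContinuousSMul ℝ F]
    [IsTopologicalAddGroup G] [ContinuousSMul ℝ G] [LocallyConvexSpace ℝ G]
    {f : F → G} {f' : F × F → G} {U : Set F} (hU : IsOpen U)
    (hd : ∀ x ∈ U, ∀ h, HasDirDerivAt f (f' (x, h)) x h) (hc : ContinuousOn f' (U ×ˢ univ))
    {g : E → F} {g' : F} {x h : E} (hx : g x ∈ U) (hg : HasDirDerivAt g g' x h) :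
    HasDirDerivAt (fun y => f (g y)) (f' (g x, g')) x h := by
  have h0 : Tendsto (fun t : ℝ => t) (𝓝[≠] 0) (𝓝 0) := nhdsWithin_le_nhds
  refine (tendsto_slope_of_continuousOn hU hd hc hx tendsto_const_nhds hg h0
    self_mem_nhdsWithin).congr' ?_
  filter_upwards [self_mem_nhdsWithin] with t ht
  rw [smul_inv_smul₀ ht, add_sub_cancel]

/-- The chain rule for maps of class `C^n`. -/
theorem FrechetContDiffOn.comp [IsTopologicalAddGroup E] [ContinuousSMul ℝ E]
    [IsTopologicalAddGroup F] [ContinuousSMul ℝ F]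
    [IsTopologicalAddGroup G] [ContinuousSMul ℝ G] [LocallyConvexSpace ℝ G] {n : ℕ}
    {f : F → G} {U : Set F} {g : E → F} {W : Set E} (hf : FrechetContDiffOn n f U)
    (hg : FrechetContDiffOn n g W) (hU : IsOpen U) (hgW : MapsTo g W U) :
    FrechetContDiffOn n (fun x => f (g x)) W := by
  induction n generalizing E F G with
  | zero => exact frechetContDiffOn_zero.2 (hf.continuousOn.comp hg.continuousOn hgW)
  | succ n ih =>
    obtain ⟨h0, f', h1, h2⟩ := frechetContDiffOn_succ.1 hf
    obtain ⟨k0, g', k1, k2⟩ := frechetContDiffOn_succ.1 hg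
    refine frechetContDiffOn_succ.2 ⟨h0.comp k0 hgW, fun p => f' (g p.1, g' p),
      fun x hx h => HasDirDerivAt.comp hU h1 h2.continuousOn (hgW hx) (k1 x hx h), ?_⟩
    refine ih h2 (FrechetContDiffOn.prodMk ?_ k2) (hU.prod isOpen_univ)
      fun p hp => ⟨hgW hp.1, trivial⟩
    exact (hg.of_succ.comp_clm (ContinuousLinearMap.fst ℝ E E)).mono fun p hp => hp.1

theorem FrechetSmoothOn.comp [IsTopologicalAddGroup E] [ContinuousSMul ℝ E]
    [IsTopologicalAddGroup F] [ContinuousSMul ℝ F]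
    [IsTopologicalAddGroup G] [ContinuousSMul ℝ G] [LocallyConvexSpace ℝ G]
    {f : F → G} {U : Set F} {g : E → F} {W : Set E} (hf : FrechetSmoothOn f U)
    (hg : FrechetSmoothOn g W) (hU : IsOpen U) (hgW : MapsTo g W U) :
    FrechetSmoothOn (fun x => f (g x)) W :=
  fun n => (hf n).comp (hg n) hU hgW

/-- Continuous quadratic maps are smooth. -/
theorem frechetSmoothOn_quadratic [IsTopologicalAddGroup E] [IsTopologicalAddGroup G]
    [ContinuousSMul ℝ G] (b : E →ₗ[ℝ] E →ₗ[ℝ] G)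
    (hb : Continuous fun p : E × E => b p.1 p.2) (U : Set E) :
    FrechetSmoothOn (fun x => b x x) U := by
  intro n
  have hcont : ∀ {E : Type} [AddCommGroup E] [Module ℝ E] [TopologicalSpace E]
      (b : E →ₗ[ℝ] E →ₗ[ℝ] G), (Continuous fun p : E × E => b p.1 p.2) →
      Continuous fun x => b x x :=
    fun b hb => hb.comp (continuous_id.prodMk continuous_id)
  induction n generalizing E with
  | zero => exact frechetContDiffOn_zero.2 (hcont b hb).continuousOn
  | succ n ih =>
    -- The derivative $(x,h)\mapsto b(x,h)+b(h,x)$ is again the diagonal of a continuous bilinear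
    -- map, now on $E\times E$. This is what closes the induction.
    let b' : E × E →ₗ[ℝ] E × E →ₗ[ℝ] G :=
      (b.compl₁₂ (LinearMap.fst ℝ E E) (LinearMap.snd ℝ E E)) +
        (b.compl₁₂ (LinearMap.snd ℝ E E) (LinearMap.fst ℝ E E))
    have hb' : ∀ p q, b' p q = b p.1 q.2 + b p.2 q.1 := fun p q => rfl
    have hb'c : Continuous fun p : (E × E) × (E × E) => b' p.1 p.2 := by
      simp only [hb']
      exact (hb.comp (by fun_prop : Continuous fun p : (E × E) × (E × E) => (p.1.1, p.2.2))).add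
        (hb.comp (by fun_prop : Continuous fun p : (E × E) × (E × E) => (p.1.2, p.2.1)))
    refine frechetContDiffOn_succ.2 ⟨(hcont b hb).continuousOn, fun p => b' p p,
      fun x _ h => ?_, ih b' hb'c _⟩
    have h0 : Tendsto (fun t : ℝ => t) (𝓝[≠] 0) (𝓝 0) := nhdsWithin_le_nhds
    have h1 := (h0.smul_const (b h h)).const_add (b x h + b h x)
    rw [zero_smul, add_zero] at h1
    refine h1.congr' ?_
    filter_upwards [self_mem_nhdsWithin] with t ht
    have ht : t ≠ 0 := ht
    simp only [map_add, map_smul, LinearMap.add_apply, LinearMap.smul_apply]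
    rw [← inv_smul_smul₀ ht (b x h + b h x + t • b h h)]
    congr 1
    simp only [smul_add]
    abel

theorem FrechetSmoothOn.dirDeriv [T2Space G] {f : E → G} {U : Set E} (hU : IsOpen U)
    [IsTopologicalAddGroup E] [ContinuousSMul ℝ E] (hf : FrechetSmoothOn f U) :
    FrechetSmoothOn (fun p : E × E => dirDeriv f p.1 p.2) (U ×ˢ univ) := by
  intro n
  obtain ⟨h0, f', h1, h2⟩ := frechetContDiffOn_succ.1 (hf (n + 1))
  exact h2.congr (hU.prod isOpen_univ) fun p hp => ((h1 p.1 hp.1 p.2).dirDeriv_eq).symm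

theorem FrechetSmoothOn.hasDirDerivAt [T2Space G] {f : E → G} {U : Set E}
    (hf : FrechetSmoothOn f U) {x : E} (hx : x ∈ U) (h : E) :
    HasDirDerivAt f (_root_.dirDeriv f x h) x h := by
  obtain ⟨h0, f', h1, h2⟩ := frechetContDiffOn_succ.1 (hf 1)
  rw [(h1 x hx h).dirDeriv_eq]
  exact h1 x hx h

theorem FrechetSmoothOn.hasDirDerivAt_comp [T2Space G]
    [IsTopologicalAddGroup F] [ContinuousSMul ℝ F]
    [IsTopologicalAddGroup G] [ContinuousSMul ℝ G] [LocallyConvexSpace ℝ G]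
    {f : F → G} {U : Set F} (hU : IsOpen U) (hf : FrechetSmoothOn f U)
    {g : E → F} {g' : F} {x h : E} (hx : g x ∈ U) (hg : HasDirDerivAt g g' x h) :
    HasDirDerivAt (fun y => f (g y)) (_root_.dirDeriv f (g x) g') x h :=
  HasDirDerivAt.comp (f' := fun p => _root_.dirDeriv f p.1 p.2) hU (fun _ hx h => hf.hasDirDerivAt hx h)
    (hf.dirDeriv hU).continuousOn hx hg

/-- The derivative of a smooth map at a point, as a linear map. -/
def FrechetSmoothOn.derivLinear [T2Space G] [IsTopologicalAddGroup E] [ContinuousSMul ℝ E]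
    [IsTopologicalAddGroup G] [ContinuousSMul ℝ G] [LocallyConvexSpace ℝ G]
    {f : E → G} {U : Set E} (hU : IsOpen U) (hf : FrechetSmoothOn f U) {x : E} (hx : x ∈ U) :
    E →ₗ[ℝ] G where
  toFun h := _root_.dirDeriv f x h
  map_add' h k := HasDirDerivAt.add_dir (f' := fun p => _root_.dirDeriv f p.1 p.2) hU
    (fun _ hx h => hf.hasDirDerivAt hx h) (hf.dirDeriv hU).continuousOn hx h k
  map_smul' c h := ((hf.hasDirDerivAt hx h).smul_dir c).dirDeriv_eq

end ContDiffOn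

/-! ### Sums, products and inverses of smooth maps. -/

section SmoothAlgebra

variable {E : Type} [AddCommGroup E] [Module ℝ E] [TopologicalSpace E]

theorem FrechetContDiffOn.add {G : Type} [AddCommGroup G] [Module ℝ G] [TopologicalSpace G]
    [ContinuousAdd G] {n : ℕ} {f g : E → G} {U : Set E}
    (hf : FrechetContDiffOn n f U) (hg : FrechetContDiffOn n g U) :
    FrechetContDiffOn n (fun x => f x + g x) U :=
  (hf.prodMk hg).clm_comp (ContinuousLinearMap.fst ℝ G G + ContinuousLinearMap.snd ℝ G G)

theorem FrechetSmoothOn.add {G : Type} [AddCommGroup G] [Module ℝ G] [TopologicalSpace G]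
    [ContinuousAdd G] {f g : E → G} {U : Set E}
    (hf : FrechetSmoothOn f U) (hg : FrechetSmoothOn g U) :
    FrechetSmoothOn (fun x => f x + g x) U :=
  fun n => (hf n).add (hg n)

theorem FrechetContDiffOn.neg {G : Type} [AddCommGroup G] [Module ℝ G] [TopologicalSpace G]
    [IsTopologicalAddGroup G] {n : ℕ} {f : E → G} {U : Set E} (hf : FrechetContDiffOn n f U) :
    FrechetContDiffOn n (fun x => -f x) U :=
  hf.clm_comp (-ContinuousLinearMap.id ℝ G)

theorem FrechetSmoothOn.sub {G : Type} [AddCommGroup G] [Module ℝ G] [TopologicalSpace G]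
    [IsTopologicalAddGroup G] {f g : E → G} {U : Set E}
    (hf : FrechetSmoothOn f U) (hg : FrechetSmoothOn g U) :
    FrechetSmoothOn (fun x => f x - g x) U := by
  simp only [sub_eq_add_neg]
  exact hf.add fun n => (hg n).neg

variable [IsTopologicalAddGroup E] [ContinuousSMul ℝ E]
  {A : Type} [Ring A] [Algebra ℝ A] [TopologicalSpace A] [IsTopologicalRing A]
  [ContinuousSMul ℝ A] [LocallyConvexSpace ℝ A]

/-- Multiplication is the diagonal of the bilinear map $((a,b),(c,d))\mapsto ad$ on $A\times A$,
hence a continuous quadratic map. -/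
theorem FrechetContDiffOn.mul {n : ℕ} {f g : E → A} {U : Set E}
    (hf : FrechetContDiffOn n f U) (hg : FrechetContDiffOn n g U) :
    FrechetContDiffOn n (fun x => f x * g x) U := by
  have hb : Continuous fun p : (A × A) × (A × A) =>
      ((LinearMap.mul ℝ A).compl₁₂ (LinearMap.fst ℝ A A) (LinearMap.snd ℝ A A)) p.1 p.2 :=
    (by fun_prop : Continuous fun p : (A × A) × (A × A) => p.1.1 * p.2.2)
  exact ((frechetSmoothOn_quadratic _ hb univ n).comp (hf.prodMk hg) isOpen_univ
    (mapsTo_univ _ _) :)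

theorem FrechetSmoothOn.mul {f g : E → A} {U : Set E}
    (hf : FrechetSmoothOn f U) (hg : FrechetSmoothOn g U) :
    FrechetSmoothOn (fun x => f x * g x) U :=
  fun n => (hf n).mul (hg n)

/-- The derivative $-a^{-1}ha^{-1}$ is polynomial in $h$ and inversion itself, so class $C^n$
implies class $C^{n+1}$. -/
theorem frechetSmoothOn_ringInverse (hU : IsOpen {a : A | IsUnit a})
    (hi : ContinuousOn (Ring.inverse : A → A) {a | IsUnit a}) :
    FrechetSmoothOn (Ring.inverse : A → A) {a | IsUnit a} := by
  intro n
  induction n with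
  | zero => exact frechetContDiffOn_zero.2 hi
  | succ n ih =>
    refine frechetContDiffOn_succ.2 ⟨hi,
      fun p => -(Ring.inverse p.1 * p.2 * Ring.inverse p.1), fun x hx h => ?_, ?_⟩
    · exact (hasDirDerivAt_id x h).ringInverse hx hU (hi.continuousAt (hU.mem_nhds hx))
    · have h1 : FrechetContDiffOn n (fun p : A × A => Ring.inverse p.1) ({a | IsUnit a} ×ˢ univ) :=
        (ih.comp_clm (ContinuousLinearMap.fst ℝ A A)).mono fun p hp => hp.1
      exact ((h1.mul (frechetSmoothOn_snd _ n)).mul h1).neg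

end SmoothAlgebra

end

noncomputable section

namespace SmoothCurve

variable {L : ℝ} {E F A : Type} [NormedAddCommGroup E] [NormedSpace ℝ E]
  [NormedAddCommGroup F] [NormedSpace ℝ F] [NormedRing A] [NormedAlgebra ℝ A]

/-! ### Algebraic operations on smooth curves -/

theorem ext {f g : SmoothCurve L E} (h : ∀ s ∈ Icc 0 L, f s = g s) : f = g := by
  refine Subtype.ext (funext fun s => ?_)
  by_cases hs : s ∈ Icc 0 L
  · exact h s hs
  · exact (f.2.2 s hs).trans (g.2.2 s hs).symm

/-- The restriction to `[0, L]` of a function that is smooth there. -/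
def ofContDiffOn (f : ℝ → E) (hf : ContDiffOn ℝ ∞ f (Icc 0 L)) : SmoothCurve L E :=
  ⟨(Icc 0 L).indicator f, hf.congr fun _ hs => indicator_of_mem hs f,
    fun _ hs => indicator_of_notMem hs f⟩

theorem ofContDiffOn_apply {f : ℝ → E} (hf : ContDiffOn ℝ ∞ f (Icc 0 L)) {s : ℝ}
    (hs : s ∈ Icc 0 L) : ofContDiffOn f hf s = f s :=
  indicator_of_mem hs f

theorem contDiffOn (f : SmoothCurve L E) : ContDiffOn ℝ ∞ f (Icc 0 L) := f.2.1

@[simp] theorem add_apply (f g : SmoothCurve L E) (s : ℝ) : (f + g) s = f s + g s := rfl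
@[simp] theorem sub_apply (f g : SmoothCurve L E) (s : ℝ) : (f - g) s = f s - g s := rfl
@[simp] theorem neg_apply (f : SmoothCurve L E) (s : ℝ) : (-f) s = -f s := rfl
@[simp] theorem smul_apply (c : ℝ) (f : SmoothCurve L E) (s : ℝ) : (c • f) s = c • f s := rfl
@[simp] theorem zero_apply (s : ℝ) : (0 : SmoothCurve L E) s = 0 := rfl

/-- The constant curves. -/
def const (L : ℝ) (c : E) : SmoothCurve L E := ofContDiffOn (fun _ => c) contDiffOn_const

theorem const_apply (c : E) {s : ℝ} (hs : s ∈ Icc 0 L) : const L c s = c :=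
  ofContDiffOn_apply contDiffOn_const hs

instance : Mul (SmoothCurve L A) :=
  ⟨fun f g => ⟨fun s => f s * g s, f.2.1.mul g.2.1, fun s hs => by simp [f.2.2 s hs]⟩⟩

/-- The unit equals $1$ on $[0,L]$ and $0$ elsewhere, because curves are extended by zero;
evaluating it therefore requires a point of the interval. -/
instance : One (SmoothCurve L A) := ⟨const L 1⟩

@[simp] theorem mul_apply (f g : SmoothCurve L A) (s : ℝ) : (f * g) s = f s * g s := rfl

theorem one_apply {s : ℝ} (hs : s ∈ Icc 0 L) : (1 : SmoothCurve L A) s = 1 := const_apply 1 hs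

instance : Ring (SmoothCurve L A) :=
  { (inferInstance : AddCommGroup (SmoothCurve L A)) with
    mul := (· * ·)
    one := 1
    left_distrib := fun _ _ _ => ext fun _ _ => mul_add _ _ _
    right_distrib := fun _ _ _ => ext fun _ _ => add_mul _ _ _
    zero_mul := fun _ => ext fun _ _ => zero_mul _
    mul_zero := fun _ => ext fun _ _ => mul_zero _
    mul_assoc := fun _ _ _ => ext fun _ _ => mul_assoc _ _ _
    one_mul := fun f => ext fun s hs => by rw [mul_apply, one_apply hs, one_mul]
    mul_one := fun f => ext fun s hs => by rw [mul_apply, one_apply hs, mul_one] }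

instance {A : Type} [NormedCommRing A] [NormedAlgebra ℝ A] : CommRing (SmoothCurve L A) :=
  { (inferInstance : Ring (SmoothCurve L A)) with
    mul_comm := fun _ _ => ext fun _ _ => mul_comm _ _ }

instance : Algebra ℝ (SmoothCurve L A) :=
  Algebra.ofModule (fun _ _ _ => ext fun _ _ => smul_mul_assoc _ _ _)
    (fun _ _ _ => ext fun _ _ => mul_smul_comm _ _ _)

/-- The curve as an element of the Banach space of continuous maps on `[0, L]`. -/
def toC : SmoothCurve L E →ₗ[ℝ] C(Icc 0 L, E) where
  toFun f := ⟨fun s => f s, f.contDiffOn.continuousOn.domRestrict⟩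
  map_add' _ _ := rfl
  map_smul' _ _ := rfl

@[simp] theorem toC_apply (f : SmoothCurve L E) (s : Icc 0 L) : toC f s = f s := rfl

theorem toC_mul (f g : SmoothCurve L A) : toC (f * g) = toC f * toC g := rfl

theorem toC_one : toC (1 : SmoothCurve L A) = 1 :=
  ContinuousMap.ext fun s => one_apply s.2

theorem toC_injective : Function.Injective (toC : SmoothCurve L E → C(Icc 0 L, E)) :=
  fun _ _ h => ext fun s hs => DFunLike.congr_fun h ⟨s, hs⟩

/-- Composition with a continuous linear map. -/
def mapLinear (T : E →L[ℝ] F) : SmoothCurve L E →ₗ[ℝ] SmoothCurve L F where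
  toFun f := ⟨fun s => T (f s), T.contDiff.comp_contDiffOn f.2.1, fun s hs => by simp [f.2.2 s hs]⟩
  map_add' f g := ext fun s _ => T.map_add _ _
  map_smul' c f := ext fun s _ => T.map_smul _ _

/-! ### Differentiation and integration -/

variable [hL : Fact (0 < L)]

theorem mem_zero : (0 : ℝ) ∈ Icc 0 L := left_mem_Icc.2 hL.out.le

theorem mem_end : L ∈ Icc 0 L := right_mem_Icc.2 hL.out.le

/-- The derivative of a smooth curve. -/
def D : SmoothCurve L E →ₗ[ℝ] SmoothCurve L E where
  toFun f := ofContDiffOn (derivWithin f (Icc 0 L))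
    ((contDiffOn_infty_iff_derivWithin (uniqueDiffOn_Icc hL.out)).1 f.contDiffOn).2
  map_add' f g := ext fun s hs => by
    rw [add_apply]
    iterate 3 rw [ofContDiffOn_apply _ hs]
    exact derivWithin_add (f.contDiffOn.differentiableOn (by simp) s hs)
      (g.contDiffOn.differentiableOn (by simp) s hs)
  map_smul' c f := ext fun s hs => by
    rw [RingHom.id_apply, smul_apply]
    iterate 2 rw [ofContDiffOn_apply _ hs]
    exact derivWithin_const_smul c (f.contDiffOn.differentiableOn (by simp) s hs)

theorem D_apply (f : SmoothCurve L E) {s : ℝ} (hs : s ∈ Icc 0 L) :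
    D f s = derivWithin f (Icc 0 L) s :=
  ofContDiffOn_apply
    ((contDiffOn_infty_iff_derivWithin (uniqueDiffOn_Icc hL.out)).1 f.contDiffOn).2 hs

theorem hasDerivWithinAt (f : SmoothCurve L E) {s : ℝ} (hs : s ∈ Icc 0 L) :
    HasDerivWithinAt f (D f s) (Icc 0 L) s := by
  rw [D_apply f hs]
  exact (f.contDiffOn.differentiableOn (by simp) s hs).hasDerivWithinAt

theorem D_eq {f g : SmoothCurve L E}
    (h : ∀ s ∈ Icc 0 L, HasDerivWithinAt f (g s) (Icc 0 L) s) : D f = g :=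
  ext fun s hs => by
    rw [D_apply f hs, (h s hs).derivWithin (uniqueDiffOn_Icc hL.out s hs)]

theorem D_mul (f g : SmoothCurve L A) : D (f * g) = D f * g + f * D g :=
  D_eq fun _ hs => (f.hasDerivWithinAt hs).mul (g.hasDerivWithinAt hs)

theorem D_mapLinear (T : E →L[ℝ] F) (f : SmoothCurve L E) : D (mapLinear T f) = mapLinear T (D f) :=
  D_eq fun _ hs => (T.hasFDerivAt.hasFDerivWithinAt.comp_hasDerivWithinAt _
    (f.hasDerivWithinAt hs) (mapsTo_univ _ _) :)

theorem D_const (c : E) : D (const L c) = 0 :=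
  D_eq fun s hs => (hasDerivWithinAt_const s _ c).congr (fun _ ht => const_apply c ht)
    (const_apply c hs)

theorem D_one : D (1 : SmoothCurve L A) = 0 := D_const 1

theorem eq_const_of_D_eq_zero {f : SmoothCurve L E} (h : D f = 0) : f = const L (f 0) :=
  ext fun s hs => by
    rw [const_apply _ hs]
    refine constant_of_derivWithin_zero (f.contDiffOn.differentiableOn (by simp)) ?_ s hs
    intro t ht
    rw [← D_apply f (Ico_subset_Icc_self ht), h, zero_apply]

/-- Two curves with the same derivative and the same starting point are equal. -/
theorem eq_of_D_eq {f g : SmoothCurve L E} (h : D f = D g) (h0 : f 0 = g 0) : f = g := by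
  have h1 : D (f - g) = 0 := by rw [map_sub, h, sub_self]
  have h2 := eq_const_of_D_eq_zero h1
  rw [sub_apply, h0, sub_self] at h2
  refine sub_eq_zero.1 (h2.trans (ext fun s hs => ?_))
  rw [const_apply _ hs, zero_apply]

/-- This moves all topological questions to the Banach space of continuous curves, applied to the
iterates of `D`. -/
theorem seminorm_eq (k : ℕ) (f : SmoothCurve L E) : seminorm k f = ‖toC (D^[k] f)‖ := by
  have h1 : ∀ (k : ℕ) (f : SmoothCurve L E), ∀ s ∈ Icc 0 L,
      iteratedDerivWithin k f (Icc 0 L) s = (D^[k] f) s := by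
    intro k
    induction k with
    | zero => intro f s _; rw [iteratedDerivWithin_zero]; rfl
    | succ k ih =>
      intro f s hs
      rw [iteratedDerivWithin_succ', Function.iterate_succ_apply, ← ih (D f) s hs]
      exact iteratedDerivWithin_congr (fun t ht => (D_apply f ht).symm) hs
  rw [ContinuousMap.norm_eq_iSup_norm]
  exact iSup_congr fun s => by rw [h1 k f s s.2]; rfl

instance : IsTopologicalAddGroup (SmoothCurve L E) := withSeminorms.topologicalAddGroup
instance : ContinuousSMul ℝ (SmoothCurve L E) := withSeminorms.continuousSMul
instance : LocallyConvexSpace ℝ (SmoothCurve L E) := withSeminorms.toLocallyConvexSpace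

theorem tendsto_iff {ι : Type*} {l : Filter ι} {φ : ι → SmoothCurve L E} {a : SmoothCurve L E} :
    Tendsto φ l (𝓝 a) ↔ ∀ k, Tendsto (fun i => toC (D^[k] (φ i))) l (𝓝 (toC (D^[k] a))) := by
  rw [withSeminorms.tendsto_nhds]
  refine forall_congr' fun k => ?_
  rw [Metric.tendsto_nhds]
  refine forall₂_congr fun ε _ => eventually_congr (Eventually.of_forall fun i => ?_)
  rw [seminorm_eq, dist_eq_norm, ← map_sub]
  have : D^[k] (φ i - a) = D^[k] (φ i) - D^[k] a := by
    rw [← Module.End.pow_apply, map_sub, Module.End.pow_apply, Module.End.pow_apply]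
  rw [this]

theorem continuous_toC : Continuous (toC : SmoothCurve L E → C(Icc 0 L, E)) :=
  continuous_iff_continuousAt.2 fun _ => tendsto_iff.1 tendsto_id 0

theorem continuous_D : Continuous (D : SmoothCurve L E → SmoothCurve L E) :=
  continuous_iff_continuousAt.2 fun _ => tendsto_iff.2 fun k => tendsto_iff.1 tendsto_id (k + 1)

instance : T2Space (SmoothCurve L E) := T2Space.of_injective_continuous toC_injective continuous_toC

/-- The derivative as a continuous linear map. -/
def DL : SmoothCurve L E →L[ℝ] SmoothCurve L E := ⟨D, continuous_D⟩

theorem iterate_D_mapLinear (T : E →L[ℝ] F) (k : ℕ) (f : SmoothCurve L E) :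
    D^[k] (mapLinear T f) = mapLinear T (D^[k] f) := by
  induction k generalizing f with
  | zero => rfl
  | succ k ih => rw [Function.iterate_succ_apply, D_mapLinear, ih, Function.iterate_succ_apply]

/-- Composition with a continuous linear map, as a continuous linear map. -/
def map (T : E →L[ℝ] F) : SmoothCurve L E →L[ℝ] SmoothCurve L F :=
  ⟨mapLinear T, continuous_iff_continuousAt.2 fun a => tendsto_iff.2 fun k => by
    have h : ∀ f : SmoothCurve L E, toC (D^[k] (mapLinear T f)) =
        (⟨T, T.continuous⟩ : C(E, F)).comp (toC (D^[k] f)) := fun f => by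
      rw [iterate_D_mapLinear]; rfl
    have h1 := ((ContinuousMap.continuous_postcomp ⟨T, T.continuous⟩).tendsto _).comp
      (tendsto_iff.1 (tendsto_id (x := 𝓝 a)) k)
    exact (h a).symm ▸ h1.congr fun f => (h f).symm⟩

@[simp] theorem map_apply (T : E →L[ℝ] F) (f : SmoothCurve L E) (s : ℝ) :
    map T f s = T (f s) := rfl

theorem D_map (T : E →L[ℝ] F) (f : SmoothCurve L E) : D (map T f) = map T (D f) :=
  D_mapLinear T f

/-- Evaluation at a point, as a continuous linear map. -/
def evalL (s : ℝ) : SmoothCurve L E →L[ℝ] E where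
  toFun f := f s
  map_add' _ _ := rfl
  map_smul' _ _ := rfl
  cont := by
    by_cases hs : s ∈ Icc 0 L
    · exact (ContinuousEvalConst.continuous_eval_const (⟨s, hs⟩ : Icc 0 L)).comp continuous_toC
    · have : (fun f : SmoothCurve L E => f s) = fun _ => 0 := funext fun f => f.2.2 s hs
      exact this ▸ continuous_const

/-- Convergence of the derivatives of order at most `n`. -/
def TendstoUpTo {ι : Type*} (l : Filter ι) :
    ℕ → (ι → SmoothCurve L E) → SmoothCurve L E → Prop
  | 0, φ, a => Tendsto (fun i => toC (φ i)) l (𝓝 (toC a))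
  | n + 1, φ, a => Tendsto (fun i => toC (φ i)) l (𝓝 (toC a)) ∧
      TendstoUpTo l n (fun i => D (φ i)) (D a)

/-! ### Convergence up to finite order. -/

section TendstoUpTo

variable {ι : Type*} {l : Filter ι}

/-- The recursive form of convergence suits bootstrapping: when the derivative of an expression is a
product of quantities already controlled to order $n$, control to order $n+1$ follows. Products,
inverses and solutions of differential equations are all treated this way. -/
theorem tendsto_iff_tendstoUpTo {φ : ι → SmoothCurve L E} {a : SmoothCurve L E} :
    Tendsto φ l (𝓝 a) ↔ ∀ n, TendstoUpTo l n φ a := by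
  rw [tendsto_iff]
  constructor
  · intro h n
    induction n generalizing φ a with
    | zero => exact h 0
    | succ n ih => exact ⟨h 0, ih fun k => h (k + 1)⟩
  · intro h n
    have h' := h n
    clear h
    induction n generalizing φ a with
    | zero => exact h'
    | succ n ih => exact ih h'.2

theorem TendstoUpTo.of_succ {n : ℕ} {φ : ι → SmoothCurve L E} {a : SmoothCurve L E}
    (h : TendstoUpTo l (n + 1) φ a) : TendstoUpTo l n φ a := by
  induction n generalizing φ a with
  | zero => exact h.1
  | succ n ih => exact ⟨h.1, ih h.2⟩

theorem TendstoUpTo.add {n : ℕ} {φ ψ : ι → SmoothCurve L E} {a b : SmoothCurve L E}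
    (h : TendstoUpTo l n φ a) (k : TendstoUpTo l n ψ b) :
    TendstoUpTo l n (fun i => φ i + ψ i) (a + b) := by
  induction n generalizing φ ψ a b with
  | zero => exact Tendsto.add h k
  | succ n ih =>
    refine ⟨by simpa using Tendsto.add h.1 k.1, ?_⟩
    simpa using ih h.2 k.2

theorem TendstoUpTo.neg {n : ℕ} {φ : ι → SmoothCurve L E} {a : SmoothCurve L E}
    (h : TendstoUpTo l n φ a) : TendstoUpTo l n (fun i => -φ i) (-a) := by
  induction n generalizing φ a with
  | zero => exact Tendsto.neg h
  | succ n ih =>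
    refine ⟨by simpa using Tendsto.neg h.1, ?_⟩
    simpa using ih h.2

theorem TendstoUpTo.mul {n : ℕ} {φ ψ : ι → SmoothCurve L A} {a b : SmoothCurve L A}
    (h : TendstoUpTo l n φ a) (k : TendstoUpTo l n ψ b) :
    TendstoUpTo l n (fun i => φ i * ψ i) (a * b) := by
  induction n generalizing φ ψ a b with
  | zero => exact Tendsto.mul h k
  | succ n ih =>
    refine ⟨Tendsto.mul h.1 k.1, ?_⟩
    simp only [D_mul]
    exact (ih h.2 k.of_succ).add (ih h.of_succ k.2)

theorem TendstoUpTo.congr' {n : ℕ} {φ ψ : ι → SmoothCurve L E} {a : SmoothCurve L E}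
    (h : TendstoUpTo l n φ a) (hφψ : ∀ᶠ i in l, φ i = ψ i) : TendstoUpTo l n ψ a := by
  induction n generalizing φ ψ a with
  | zero => exact Tendsto.congr' (hφψ.mono fun i hi => by rw [hi]) h
  | succ n ih =>
    exact ⟨Tendsto.congr' (hφψ.mono fun i hi => by rw [hi]) h.1,
      ih h.2 (hφψ.mono fun i hi => by rw [hi])⟩

end TendstoUpTo

instance : ContinuousMul (SmoothCurve L A) :=
  ⟨continuous_iff_continuousAt.2 fun _ => tendsto_iff_tendstoUpTo.2 fun n =>
    (tendsto_iff_tendstoUpTo.1 continuousAt_fst n).mul (tendsto_iff_tendstoUpTo.1 continuousAt_snd n)⟩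

instance : IsTopologicalRing (SmoothCurve L A) where

/-! ### Inverses -/

theorem isUnit_iff {f : SmoothCurve L ℂ} : IsUnit f ↔ ∀ s ∈ Icc 0 L, f s ≠ 0 := by
  constructor
  · rintro h s hs h0
    have := congrArg (fun g : SmoothCurve L ℂ => g s) (Ring.mul_inverse_cancel f h)
    simp [h0, one_apply hs] at this
  · intro h
    refine IsUnit.of_mul_eq_one (ofContDiffOn (fun s => (f s)⁻¹) (f.contDiffOn.inv h)) ?_
    exact ext fun s hs => by
      rw [mul_apply, ofContDiffOn_apply _ hs, one_apply hs, mul_inv_cancel₀ (h s hs)]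

theorem ringInverse_apply {f : SmoothCurve L ℂ} (hf : IsUnit f) {s : ℝ} (hs : s ∈ Icc 0 L) :
    Ring.inverse f s = (f s)⁻¹ := by
  have := congrArg (fun g : SmoothCurve L ℂ => g s) (Ring.mul_inverse_cancel f hf)
  simp only [mul_apply, one_apply hs] at this
  exact eq_inv_of_mul_eq_one_right this

theorem isUnit_iff_isUnit_toC {f : SmoothCurve L ℂ} : IsUnit f ↔ IsUnit (toC f) := by
  rw [isUnit_iff]
  constructor
  · intro h
    refine ContinuousMap.isUnit_iff_forall_ne_zero _ |>.2 fun s => h s s.2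
  · intro h s hs
    exact ContinuousMap.isUnit_iff_forall_ne_zero _ |>.1 h ⟨s, hs⟩

/-- Invertibility means having no zero on $[0,L]$, a condition visible already in the Banach algebra
of continuous functions, where units are open. -/
theorem isOpen_isUnit : IsOpen {f : SmoothCurve L ℂ | IsUnit f} := by
  simp only [isUnit_iff_isUnit_toC]
  exact (Units.isOpen : IsOpen {x : C(Icc 0 L, ℂ) | IsUnit x}).preimage continuous_toC

theorem toC_ringInverse {f : SmoothCurve L ℂ} (hf : IsUnit f) :
    toC (Ring.inverse f) = Ring.inverse (toC f) := by
  refine ((isUnit_iff_isUnit_toC.1 hf).mul_left_cancel ?_ :)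
  rw [Ring.mul_inverse_cancel _ (isUnit_iff_isUnit_toC.1 hf), ← toC_mul,
    Ring.mul_inverse_cancel _ hf, toC_one]

theorem D_ringInverse {f : SmoothCurve L A} (hf : IsUnit f) :
    D (Ring.inverse f) = -(Ring.inverse f * D f * Ring.inverse f) := by
  have h := congrArg D (Ring.mul_inverse_cancel f hf)
  rw [D_mul, D_one] at h
  have h2 := congrArg (Ring.inverse f * ·) h
  simp only [mul_add, mul_zero, ← mul_assoc, Ring.inverse_mul_cancel f hf, one_mul] at h2
  exact eq_neg_of_add_eq_zero_right h2

/-- Uniform convergence comes from the Banach algebra $C([0,L])$, and $D(f^{-1})=-f^{-1}(Df)f^{-1}$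
then raises the order one step at a time. -/
theorem continuousOn_ringInverse :
    ContinuousOn (Ring.inverse : SmoothCurve L ℂ → SmoothCurve L ℂ) {f | IsUnit f} := by
  intro f hf
  have hmem : ∀ᶠ g in 𝓝[{f | IsUnit f}] f, IsUnit g := self_mem_nhdsWithin
  refine tendsto_iff_tendstoUpTo.2 fun n => ?_
  have hC : Tendsto (fun g => toC (Ring.inverse g)) (𝓝[{f | IsUnit f}] f)
      (𝓝 (toC (Ring.inverse f))) := by
    rw [toC_ringInverse hf]
    obtain ⟨u, hu⟩ := isUnit_iff_isUnit_toC.1 hf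
    have h1 := NormedRing.inverse_continuousAt u
    rw [hu] at h1
    refine (h1.tendsto.comp (continuous_toC.continuousAt.continuousWithinAt
      (s := {f | IsUnit f})).tendsto).congr' ?_
    filter_upwards [hmem] with g hg
    exact (toC_ringInverse hg).symm
  induction n with
  | zero => exact hC
  | succ n ih =>
    refine ⟨hC, ?_⟩
    have h1 : Tendsto (fun g : SmoothCurve L ℂ => D g) (𝓝[{f | IsUnit f}] f) (𝓝 (D f)) :=
      continuous_D.continuousAt.continuousWithinAt.tendsto
    have h2 := ((ih.mul (tendsto_iff_tendstoUpTo.1 h1 n)).mul ih).neg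
    rw [D_ringInverse hf]
    exact h2.congr' (hmem.mono fun g hg => (D_ringInverse hg).symm)

end SmoothCurve

end

/-! ### Invertibility of $1-T$ and dependence of the inverse on $T$. -/

noncomputable section

/-- The operator `x ↦ P (x b)` on a normed algebra. -/
def compRightMul {B : Type*} [NormedRing B] [NormedAlgebra ℝ B] (P : B →L[ℝ] B) (b : B) :
    B →L[ℝ] B :=
  P.comp ((ContinuousLinearMap.mul ℝ B).flip b)

theorem continuous_compRightMul {B : Type*} [NormedRing B] [NormedAlgebra ℝ B] (P : B →L[ℝ] B) :
    Continuous (compRightMul P) :=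
  continuous_const.clm_comp (ContinuousLinearMap.mul ℝ B).flip.continuous

theorem continuous_ringInverse_one_sub_apply {X C : Type*} [TopologicalSpace X]
    [NormedAddCommGroup C] [NormedSpace ℝ C] [CompleteSpace C] {T : X → C →L[ℝ] C}
    (hT : Continuous T) (hu : ∀ x, IsUnit (1 - T x)) (v : C) :
    Continuous fun x => Ring.inverse (1 - T x) v := by
  refine continuous_iff_continuousAt.2 fun x => ?_
  obtain ⟨u, hx⟩ := hu x
  have h1 := NormedRing.inverse_continuousAt u
  rw [hx] at h1
  have h2 : ContinuousAt (fun x => 1 - T x) x := continuousAt_const.sub hT.continuousAt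
  exact (ContinuousAt.comp (f := fun x => 1 - T x) h1 h2).clm_apply continuousAt_const

/-- Conjugation turns $1-t$ into $1-bta$, to which the Neumann series applies. A change of weight in
the norm is such a conjugation. -/
theorem isUnit_one_sub_of_norm_conj_lt_one {R : Type*} [NormedRing R] [CompleteSpace R]
    {a b t : R} (hab : a * b = 1) (hba : b * a = 1) (h : ‖b * t * a‖ < 1) : IsUnit (1 - t) := by
  have h2 : 1 - t = a * (1 - b * t * a) * b := by
    calc 1 - t = a * b - (a * b) * t * (a * b) := by rw [hab, one_mul, mul_one]
      _ = _ := by noncomm_ring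
  rw [h2]
  have ha : IsUnit a := ⟨⟨a, b, hab, hba⟩, rfl⟩
  exact (ha.mul (isUnit_one_sub_of_norm_lt_one h)).mul
    ⟨⟨b, a, hba, hab⟩, rfl⟩

namespace SmoothCurve

variable {L : ℝ} {E A : Type} [NormedAddCommGroup E] [NormedSpace ℝ E] [CompleteSpace E]
  [NormedRing A] [NormedAlgebra ℝ A] [CompleteSpace A] [hL : Fact (0 < L)]

/-! ### Primitives -/

/-- The extension of a continuous map on `[0, L]` by constants. -/
def extend (f : C(Icc 0 L, E)) : C(ℝ, E) := ContinuousMap.IccExtend hL.out.le f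

theorem extend_apply (f : C(Icc 0 L, E)) {s : ℝ} (hs : s ∈ Icc 0 L) : extend f s = f ⟨s, hs⟩ :=
  IccExtend_of_mem _ _ hs

theorem norm_extend_le (f : C(Icc 0 L, E)) (s : ℝ) : ‖extend f s‖ ≤ ‖f‖ :=
  f.norm_coe_le_norm _

/-- The primitive vanishing at `0` of a continuous map, as a bounded operator. -/
def primitive : C(Icc 0 L, E) →L[ℝ] C(Icc 0 L, E) :=
  LinearMap.mkContinuous
    { toFun := fun f => ⟨fun s => ∫ u in (0 : ℝ)..s, extend f u,
        (intervalIntegral.continuous_primitive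
          (fun _ _ => (extend f).continuous.intervalIntegrable _ _) 0).comp continuous_subtype_val⟩
      map_add' := fun f g => ContinuousMap.ext fun s =>
        intervalIntegral.integral_add ((extend f).continuous.intervalIntegrable _ _)
          ((extend g).continuous.intervalIntegrable _ _)
      map_smul' := fun c f => ContinuousMap.ext fun s => intervalIntegral.integral_smul c _ } L
    (fun f => by
      refine (ContinuousMap.norm_le _ (mul_nonneg hL.out.le (norm_nonneg f))).2 fun s => ?_
      refine (intervalIntegral.norm_integral_le_of_norm_le_const
        fun u _ => norm_extend_le f u).trans ?_
      rw [sub_zero, abs_of_nonneg s.2.1, mul_comm]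
      exact mul_le_mul_of_nonneg_right s.2.2 (norm_nonneg f))

theorem primitive_apply (f : C(Icc 0 L, E)) (s : Icc 0 L) :
    primitive f s = ∫ u in (0 : ℝ)..s, extend f u := rfl

theorem hasDerivAt_integral_extend (f : C(Icc 0 L, E)) (s : ℝ) :
    HasDerivAt (fun t => ∫ u in (0 : ℝ)..t, extend f u) (extend f s) s :=
  ((extend f).continuous.integral_hasStrictDerivAt 0 s).hasDerivAt

theorem hasDerivWithinAt_extend {f g : C(Icc 0 L, E)} {c : E}
    (h : ∀ s, f s = c + primitive g s) {s : ℝ} (hs : s ∈ Icc 0 L) :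
    HasDerivWithinAt (extend f) (extend g s) (Icc 0 L) s := by
  have h1 : ∀ t ∈ Icc 0 L, extend f t = c + ∫ u in (0 : ℝ)..t, extend g u := fun t ht => by
    rw [extend_apply f ht, h, primitive_apply]
  exact ((hasDerivAt_integral_extend g s).const_add c).hasDerivWithinAt.congr h1 (h1 s hs)

theorem contDiffOn_of_hasDerivWithinAt_succ {a : ℕ → ℝ → E}
    (h : ∀ k, ∀ s ∈ Icc 0 L, HasDerivWithinAt (a k) (a (k + 1) s) (Icc 0 L) s) (k : ℕ) :
    ContDiffOn ℝ ∞ (a k) (Icc 0 L) := by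
  have hu := uniqueDiffOn_Icc hL.out
  refine contDiffOn_infty.2 fun n => ?_
  induction n generalizing k with
  | zero => exact contDiffOn_zero.2 fun s hs => (h k s hs).continuousWithinAt
  | succ n ih =>
    rw [Nat.cast_succ]
    refine (contDiffOn_succ_iff_derivWithin hu).2
      ⟨fun s hs => (h k s hs).differentiableWithinAt, fun h => absurd h (by simp), ?_⟩
    exact (ih (k + 1)).congr fun s hs => (h k s hs).derivWithin (hu s hs)

/-- The primitive vanishing at `0` of a smooth curve. -/
def J (f : SmoothCurve L E) : SmoothCurve L E :=
  ofContDiffOn (fun t => ∫ u in (0 : ℝ)..t, extend (toC f) u) (by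
    refine (contDiffOn_infty_iff_derivWithin (uniqueDiffOn_Icc hL.out)).2 ⟨fun s _ =>
      (hasDerivAt_integral_extend _ s).differentiableAt.differentiableWithinAt, ?_⟩
    refine f.contDiffOn.congr fun s hs => ?_
    rw [(hasDerivAt_integral_extend _ s).hasDerivWithinAt.derivWithin
      (uniqueDiffOn_Icc hL.out s hs), extend_apply _ hs, toC_apply])

theorem toC_J (f : SmoothCurve L E) : toC (J f) = primitive (toC f) :=
  ContinuousMap.ext fun s => by rw [toC_apply, J, ofContDiffOn_apply _ s.2, primitive_apply]

theorem J_zero (f : SmoothCurve L E) : J f 0 = 0 :=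
  (ofContDiffOn_apply _ mem_zero).trans intervalIntegral.integral_same

theorem D_J (f : SmoothCurve L E) : D (J f) = f :=
  D_eq fun s hs => by
    have h := (hasDerivAt_integral_extend (toC f) s).hasDerivWithinAt (s := Icc 0 L)
    rw [extend_apply _ hs] at h
    exact h.congr (fun t ht => ofContDiffOn_apply _ ht) (ofContDiffOn_apply _ hs)

theorem J_apply_end (f : SmoothCurve L E) : J f L = ∫ s in (0 : ℝ)..L, f s := by
  refine (ofContDiffOn_apply _ mem_end).trans (intervalIntegral.integral_congr fun s hs => ?_)
  rw [uIcc_of_le hL.out.le] at hs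
  exact extend_apply _ hs

theorem toC_eq_const_add_primitive (f : SmoothCurve L E) (s : Icc 0 L) :
    toC f s = f 0 + primitive (toC (D f)) s := by
  have h : f = const L (f 0) + J (D f) :=
    eq_of_D_eq (by rw [map_add, D_const, zero_add, D_J])
      (by rw [add_apply, const_apply _ mem_zero, J_zero, add_zero])
  rw [← toC_J]
  conv_lhs => rw [h]
  rw [map_add, ContinuousMap.add_apply, toC_apply, const_apply _ s.2]

theorem eq_J {f g : SmoothCurve L E} (h : D f = g) (h0 : f 0 = 0) : f = J g :=
  eq_of_D_eq (by rw [h, D_J]) (by rw [h0, J_zero])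

/-- The primitive vanishing at `0`, as a continuous linear map. -/
def JL : SmoothCurve L E →L[ℝ] SmoothCurve L E where
  toFun := J
  map_add' f g := (eq_J (by rw [map_add, D_J, D_J]) (by rw [add_apply, J_zero, J_zero, add_zero])).symm
  map_smul' c f := (eq_J (by rw [RingHom.id_apply, map_smul, D_J])
    (by rw [RingHom.id_apply, smul_apply, J_zero, smul_zero])).symm
  cont := continuous_iff_continuousAt.2 fun f => tendsto_iff.2 fun k => by
    cases k with
    | zero =>
      simp only [Function.iterate_zero, id, toC_J]
      exact (primitive.continuous.comp continuous_toC).continuousAt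
    | succ k =>
      simp only [Function.iterate_succ_apply, D_J]
      exact tendsto_iff.1 tendsto_id k

@[simp] theorem JL_apply (f : SmoothCurve L E) : JL f = J f := rfl

/-! ### Completeness -/

/-- Each order of derivative converges uniformly to some $a_k$. Passing to the limit in the
fundamental theorem of calculus gives $a_k'=a_{k+1}$, so $a_0$ is smooth and is the limit. -/
theorem exists_tendsto_of_cauchy (u : ℕ → SmoothCurve L E)
    (hu : ∀ n, ∀ ε > 0, ∃ N, ∀ i ≥ N, ∀ j ≥ N, seminorm n (u i - u j) < ε) :
    ∃ a, Tendsto u atTop (𝓝 a) := by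
  have h1 : ∀ k, ∃ a : C(Icc 0 L, E), Tendsto (fun i => toC (D^[k] (u i))) atTop (𝓝 a) := by
    intro k
    refine cauchySeq_tendsto_of_complete (Metric.cauchySeq_iff.2 fun ε hε => ?_)
    obtain ⟨N, hN⟩ := hu k ε hε
    refine ⟨N, fun i hi j hj => ?_⟩
    have := hN i hi j hj
    rw [seminorm_eq, ← Module.End.pow_apply, map_sub, map_sub, Module.End.pow_apply,
      Module.End.pow_apply, ← dist_eq_norm] at this
    exact this
  choose a ha using h1
  have hev : ∀ k (s : Icc 0 L), Tendsto (fun i => (D^[k] (u i)) s) atTop (𝓝 (a k s)) :=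
    fun k s => ((ContinuousEvalConst.continuous_eval_const s).tendsto _).comp (ha k)
  have h2 : ∀ k s, a k s = a k ⟨0, mem_zero⟩ + primitive (a (k + 1)) s := by
    intro k s
    have h3 := (hev k ⟨0, mem_zero⟩).add (((ContinuousEvalConst.continuous_eval_const s).tendsto _).comp
      ((primitive.continuous.tendsto _).comp (ha (k + 1))))
    refine tendsto_nhds_unique (hev k s) (h3.congr fun i => ?_)
    simp only [Function.comp_apply, Function.iterate_succ_apply']
    exact (toC_eq_const_add_primitive (D^[k] (u i)) s).symm
  have h3 : ∀ k, ∀ s ∈ Icc 0 L, HasDerivWithinAt (extend (a k)) (extend (a (k + 1)) s) (Icc 0 L) s :=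
    fun k s hs => hasDerivWithinAt_extend (h2 k) hs
  have h4 := contDiffOn_of_hasDerivWithinAt_succ h3
  let b : ℕ → SmoothCurve L E := fun k => ofContDiffOn _ (h4 k)
  have h5 : ∀ k, D (b k) = b (k + 1) := fun k => D_eq fun s hs => by
    rw [ofContDiffOn_apply _ hs]
    exact (h3 k s hs).congr (fun t ht => ofContDiffOn_apply _ ht) (ofContDiffOn_apply _ hs)
  have h6 : ∀ k, D^[k] (b 0) = b k := by
    intro k
    induction k with
    | zero => rfl
    | succ k ih => rw [Function.iterate_succ_apply', ih, h5]
  refine ⟨b 0, tendsto_iff.2 fun k => ?_⟩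
  have h7 : toC (D^[k] (b 0)) = a k := ContinuousMap.ext fun s => by
    rw [h6, toC_apply, ofContDiffOn_apply _ s.2, extend_apply _ s.2]
  rw [h7]
  exact ha k

/-! ### Linear differential equations -/

/-- The Volterra operator `f ↦ ∫ f Λ`. -/
def volterra (Λ : C(Icc 0 L, A)) : C(Icc 0 L, A) →L[ℝ] C(Icc 0 L, A) :=
  compRightMul primitive Λ

theorem volterra_apply (Λ f : C(Icc 0 L, A)) : volterra Λ f = primitive (f * Λ) := rfl

/-- Conjugation by the weight $e^{rs}$ turns the operator into $f\mapsto e^{-rs}\int_0^s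
e^{ru}f\Lambda\,du$, whose norm is at most $\|\Lambda\|/r$. Hence solutions exist on all of $[0,L]$,
with no smallness assumption. -/
theorem isUnit_one_sub_volterra [NormOneClass A] (Λ : C(Icc 0 L, A)) :
    IsUnit (1 - volterra Λ) := by
  -- The factor $2$ makes the conjugated norm at most $1/2$; the summand $1$ keeps $r$ positive when
  -- $\Lambda=0$.
  set r : ℝ := 2 * (‖Λ‖ + 1) with hr
  have hr0 : 0 < r := by positivity
  let w : ℝ → C(Icc 0 L, A) := fun c => ⟨fun s => Real.exp (c * s) • (1 : A), by fun_prop⟩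
  have hw : ∀ c (f : C(Icc 0 L, A)) (s : Icc 0 L), (w c * f) s = Real.exp (c * s) • f s :=
    fun c f s => by simp [w]
  let M : ℝ → C(Icc 0 L, A) →L[ℝ] C(Icc 0 L, A) := fun c => ContinuousLinearMap.mul ℝ _ (w c)
  have hM : ∀ c (f : C(Icc 0 L, A)) (s : Icc 0 L), M c f s = Real.exp (c * s) • f s := hw
  have hMM : ∀ c, M c * M (-c) = 1 := fun c => by
    ext f s
    rw [mul_apply_eq_comp, hM, hM, smul_smul, ← Real.exp_add]
    simp
  have hnorm : ‖M (-r) * volterra Λ * M r‖ < 1 := by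
    refine (ContinuousLinearMap.opNorm_le_bound _ (by norm_num : (0 : ℝ) ≤ 1 / 2)
      fun f => ?_).trans_lt (by norm_num)
    refine (ContinuousMap.norm_le _ (by positivity)).2 fun s => ?_
    rw [mul_apply_eq_comp, mul_apply_eq_comp, hM, volterra_apply,
      primitive_apply, norm_smul, Real.norm_eq_abs, Real.abs_exp]
    have hle : ‖∫ u in (0 : ℝ)..s, extend (M r f * Λ) u‖ ≤
        ∫ u in (0 : ℝ)..s, ‖f‖ * ‖Λ‖ * Real.exp (r * u) := by
      refine intervalIntegral.norm_integral_le_of_norm_le s.2.1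
        (Eventually.of_forall fun u hu => ?_)
        ((by fun_prop : Continuous fun u => ‖f‖ * ‖Λ‖ * Real.exp (r * u)).intervalIntegrable _ _)
      have hu' : u ∈ Icc 0 L := ⟨hu.1.le, hu.2.trans s.2.2⟩
      rw [extend_apply _ hu', ContinuousMap.mul_apply, hM, smul_mul_assoc, norm_smul,
        Real.norm_eq_abs, Real.abs_exp, mul_comm]
      refine mul_le_mul_of_nonneg_right ((norm_mul_le _ _).trans ?_) (Real.exp_pos _).le
      exact mul_le_mul (f.norm_coe_le_norm _) (Λ.norm_coe_le_norm _) (norm_nonneg _) (norm_nonneg _)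
    have hint : ∫ u in (0 : ℝ)..s, ‖f‖ * ‖Λ‖ * Real.exp (r * u) =
        ‖f‖ * ‖Λ‖ * (r⁻¹ * (Real.exp (r * s) - 1)) := by
      rw [intervalIntegral.integral_const_mul,
        intervalIntegral.integral_comp_mul_left _ hr0.ne', integral_exp]
      simp
    rw [hint] at hle
    calc Real.exp (-r * s) * ‖∫ u in (0 : ℝ)..s, extend (M r f * Λ) u‖
        ≤ Real.exp (-r * s) * (‖f‖ * ‖Λ‖ * (r⁻¹ * Real.exp (r * s))) := by
          refine mul_le_mul_of_nonneg_left (hle.trans ?_) (Real.exp_pos _).le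
          gcongr
          linarith
      _ = (Real.exp (-r * s) * Real.exp (r * s)) * (‖Λ‖ * r⁻¹) * ‖f‖ := by ring
      _ = (‖Λ‖ * r⁻¹) * ‖f‖ := by rw [← Real.exp_add]; simp
      _ ≤ 1 / 2 * ‖f‖ := by
          refine mul_le_mul_of_nonneg_right ?_ (norm_nonneg f)
          rw [← div_eq_mul_inv, div_le_iff₀ hr0, hr]
          linarith
  have hMM' : M (-r) * M r = 1 := by simpa using hMM (-r)
  exact isUnit_one_sub_of_norm_conj_lt_one (R := C(Icc 0 L, A) →L[ℝ] C(Icc 0 L, A))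
    (hMM r) hMM' hnorm

/-- The continuous solution of `x = 1 + ∫ x Λ`. -/
def volterraSol (Λ : C(Icc 0 L, A)) : C(Icc 0 L, A) := Ring.inverse (1 - volterra Λ) 1

variable [NormOneClass A]

theorem continuous_volterra :
    Continuous (volterra : C(Icc 0 L, A) → C(Icc 0 L, A) →L[ℝ] C(Icc 0 L, A)) := by
  have h : Continuous (compRightMul (primitive : C(Icc 0 L, A) →L[ℝ] C(Icc 0 L, A))) := by
    exact continuous_compRightMul _
  exact h

theorem continuous_volterraSol :
    Continuous (volterraSol : C(Icc 0 L, A) → C(Icc 0 L, A)) := by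
  have h : Continuous fun Λ : C(Icc 0 L, A) => Ring.inverse (1 - volterra Λ) 1 := by
    exact continuous_ringInverse_one_sub_apply continuous_volterra isUnit_one_sub_volterra 1
  unfold volterraSol
  exact h

theorem volterraSol_apply (Λ : C(Icc 0 L, A)) (s : Icc 0 L) :
    volterraSol Λ s = 1 + primitive (volterraSol Λ * Λ) s := by
  have h := congrArg (fun T : C(Icc 0 L, A) →L[ℝ] C(Icc 0 L, A) => T 1 s)
    (Ring.mul_inverse_cancel _ (isUnit_one_sub_volterra Λ))
  simp only [mul_apply_eq_comp] at h
  exact sub_eq_iff_eq_add.1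
    (h : volterraSol Λ s - primitive (volterraSol Λ * Λ) s = 1)

theorem eq_volterraSol {Λ x : C(Icc 0 L, A)} (h : ∀ s, x s = 1 + primitive (x * Λ) s) :
    x = volterraSol Λ := by
  have h1 : (1 - volterra Λ) x = 1 := ContinuousMap.ext fun s =>
    (sub_eq_iff_eq_add.2 (h s) : x s - primitive (x * Λ) s = 1)
  rw [volterraSol, ← h1, ← mul_apply_eq_comp,
    Ring.inverse_mul_cancel _ (isUnit_one_sub_volterra Λ)]
  rfl

/-- The solution `X` of `X' = X Λ`, `X(0) = 1`. -/
def sol (Λ : SmoothCurve L A) : SmoothCurve L A :=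
  ofContDiffOn (extend (volterraSol (toC Λ))) (by
    have h : ∀ s ∈ Icc 0 L, HasDerivWithinAt (extend (volterraSol (toC Λ)))
        (extend (volterraSol (toC Λ)) s * Λ s) (Icc 0 L) s := fun s hs => by
      have := hasDerivWithinAt_extend (volterraSol_apply (toC Λ)) hs
      rwa [extend_apply _ hs, ContinuousMap.mul_apply, ← extend_apply _ hs] at this
    have hu := uniqueDiffOn_Icc hL.out
    -- The equation $X'=X\Lambda$ gives $X$ one more derivative than the product on its right has.
    refine contDiffOn_infty.2 fun n => ?_
    induction n with
    | zero => exact contDiffOn_zero.2 fun s hs => (h s hs).continuousWithinAt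
    | succ n ih =>
      rw [Nat.cast_succ]
      refine (contDiffOn_succ_iff_derivWithin hu).2
        ⟨fun s hs => (h s hs).differentiableWithinAt, fun h => absurd h (by simp), ?_⟩
      exact (ih.mul (contDiffOn_infty.1 Λ.contDiffOn n)).congr fun s hs =>
        (h s hs).derivWithin (hu s hs))

theorem toC_sol (Λ : SmoothCurve L A) : toC (sol Λ) = volterraSol (toC Λ) :=
  ContinuousMap.ext fun s => by rw [toC_apply, sol, ofContDiffOn_apply _ s.2, extend_apply _ s.2]

theorem D_sol (Λ : SmoothCurve L A) : D (sol Λ) = sol Λ * Λ := by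
  refine D_eq fun s hs => ?_
  have := hasDerivWithinAt_extend (volterraSol_apply (toC Λ)) hs
  rw [extend_apply _ hs, ContinuousMap.mul_apply, toC_apply, ← extend_apply _ hs] at this
  rw [mul_apply, show sol Λ s = _ from ofContDiffOn_apply _ hs]
  exact this.congr (fun t ht => ofContDiffOn_apply _ ht) (ofContDiffOn_apply _ hs)

theorem sol_zero (Λ : SmoothCurve L A) : sol Λ 0 = 1 := by
  have h := volterraSol_apply (toC Λ) ⟨0, mem_zero⟩
  rw [← toC_sol, toC_apply, primitive_apply, intervalIntegral.integral_same, add_zero] at h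
  exact h

theorem eq_sol {Λ X : SmoothCurve L A} (h : D X = X * Λ) (h0 : X 0 = 1) : X = sol Λ := by
  refine toC_injective ?_
  rw [toC_sol]
  refine eq_volterraSol fun s => ?_
  rw [toC_eq_const_add_primitive, h0, h, toC_mul]

/-- In the uniform norm this is continuity of operator inversion; $D X=X\Lambda$ propagates it to
all orders. -/
theorem continuous_sol : Continuous (sol : SmoothCurve L A → SmoothCurve L A) := by
  refine continuous_iff_continuousAt.2 fun Λ => tendsto_iff_tendstoUpTo.2 fun n => ?_
  have h0 : Tendsto (fun Λ : SmoothCurve L A => toC (sol Λ)) (𝓝 Λ) (𝓝 (toC (sol Λ))) := by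
    simp only [toC_sol]
    exact (continuous_volterraSol.comp continuous_toC).continuousAt
  induction n with
  | zero => exact h0
  | succ n ih =>
    refine ⟨h0, ?_⟩
    simp only [D_sol]
    exact ih.mul (tendsto_iff_tendstoUpTo.1 tendsto_id n)

end SmoothCurve

end

noncomputable section

namespace SmoothCurve

variable {L : ℝ} [hL : Fact (0 < L)]

/-! ### Dependence of the fundamental solution on the coefficient -/

section AntiInvolution

variable {A : Type} [NormedRing A] [NormedAlgebra ℝ A] [CompleteSpace A] [NormOneClass A]
  [IsDedekindFiniteMonoid A] {τ : A →L[ℝ] A}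

theorem mul_eq_one_comm_curve {X Y : SmoothCurve L A} (h : X * Y = 1) : Y * X = 1 :=
  ext fun s hs => by
    have := congrArg (fun Z : SmoothCurve L A => Z s) h
    simp only [mul_apply, one_apply hs] at this ⊢
    exact mul_eq_one_symm this

theorem eq_one_of_D_eq_zero {X : SmoothCurve L A} (h : D X = 0) (h0 : X 0 = 1) : X = 1 := by
  refine eq_of_D_eq (by rw [h, D_one]) ?_
  rw [h0, one_apply mem_zero]

/-- The inverse of the fundamental solution, in terms of an anti-involution of the algebra. -/
def solInv (τ : A →L[ℝ] A) (Λ : SmoothCurve L A) : SmoothCurve L A :=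
  map τ (sol (-map τ Λ))

/-- `τ` is an anti-involution of an algebra. -/
structure IsAntiInvolution (τ : A →L[ℝ] A) : Prop where
  map_mul : ∀ x y, τ (x * y) = τ y * τ x
  involutive : ∀ x, τ (τ x) = x

theorem solInv_zero (hτ : IsAntiInvolution τ) (Λ : SmoothCurve L A) : solInv τ Λ 0 = 1 := by
  rw [solInv, map_apply, sol_zero]
  -- Applied to $\tau(1)\cdot 1$, multiplicativity and involutivity yield $\tau(1)=1$, which is not
  -- among the axioms.
  have := hτ.map_mul (τ 1) 1
  rwa [mul_one, hτ.involutive, mul_one, eq_comm] at this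

theorem D_solInv (hτ : IsAntiInvolution τ) (Λ : SmoothCurve L A) : D (solInv τ Λ) = -(Λ * solInv τ Λ) := by
  rw [solInv, D_map, D_sol]
  refine ext fun s _ => ?_
  simp only [map_apply, mul_apply, neg_apply, hτ.map_mul, map_neg, hτ.involutive, neg_mul]

/-- The map $\tau$ reverses $Y'=-Y\tau(\Lambda)$ into $Z'=-\Lambda Z$, so the two terms in the
derivative of the product cancel. This expresses the inverse through `sol` and a linear map. -/
theorem sol_mul_solInv (hτ : IsAntiInvolution τ) (Λ : SmoothCurve L A) : sol Λ * solInv τ Λ = 1 := by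
  refine eq_one_of_D_eq_zero ?_ ?_
  · rw [D_mul, D_sol, D_solInv hτ, mul_neg, mul_assoc, add_neg_cancel]
  · rw [mul_apply, sol_zero, solInv_zero hτ, one_mul]

theorem solInv_mul_sol (hτ : IsAntiInvolution τ) (Λ : SmoothCurve L A) : solInv τ Λ * sol Λ = 1 :=
  mul_eq_one_comm_curve (sol_mul_solInv hτ Λ)

/-- Duhamel's formula: $X_2X_1^{-1}$ has derivative $X_2(\Lambda_2-\Lambda_1)X_1^{-1}$. Being exact,
it reduces differentiability of `sol` to its continuity. -/
theorem sol_sub_sol (hτ : IsAntiInvolution τ) (Λ₁ Λ₂ : SmoothCurve L A) :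
    sol Λ₂ - sol Λ₁ = J (sol Λ₂ * (Λ₂ - Λ₁) * solInv τ Λ₁) * sol Λ₁ := by
  have h : sol Λ₂ * solInv τ Λ₁ - 1 = J (sol Λ₂ * (Λ₂ - Λ₁) * solInv τ Λ₁) := by
    refine eq_J ?_ ?_
    · rw [map_sub, D_one, D_mul, D_sol, D_solInv hτ, mul_neg, mul_sub, sub_mul, sub_zero,
        sub_eq_add_neg, mul_assoc (sol Λ₂) Λ₁]
    · rw [sub_apply, mul_apply, sol_zero, one_apply mem_zero, solInv_zero hτ, one_mul,
        sub_self]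
  rw [← h, sub_mul, mul_assoc, solInv_mul_sol hτ, mul_one, one_mul]

theorem hasDirDerivAt_sol (hτ : IsAntiInvolution τ) (Λ h : SmoothCurve L A) :
    HasDirDerivAt sol (J (sol Λ * h * solInv τ Λ) * sol Λ) Λ h := by
  have h1 : Tendsto (fun t : ℝ => sol (Λ + t • h)) (𝓝[≠] 0) (𝓝 (sol Λ)) :=
    ((continuous_sol.tendsto Λ).comp (tendsto_line Λ h)).mono_left nhdsWithin_le_nhds
  have h3 := ((JL.continuous.tendsto _).comp
    ((h1.mul_const h).mul_const (solInv τ Λ))).mul_const (sol Λ)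
  refine h3.congr' ?_
  filter_upwards [self_mem_nhdsWithin] with t ht
  have ht : t ≠ 0 := ht
  rw [sol_sub_sol hτ, add_sub_cancel_left, mul_smul_comm, smul_mul_assoc, ← JL_apply,
    map_smul, smul_mul_assoc, inv_smul_smul₀ ht]
  rfl

/-- The derivative is built from `sol` at $\Lambda$ and at $-\tau\Lambda$ by products and continuous
linear maps, so its class is at least that of `sol`, and the induction runs. -/
theorem frechetSmoothOn_sol (hτ : IsAntiInvolution τ) : FrechetSmoothOn (sol : SmoothCurve L A → SmoothCurve L A) univ := by
  intro n
  induction n with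
  | zero => exact frechetContDiffOn_zero.2 continuous_sol.continuousOn
  | succ n ih =>
    refine frechetContDiffOn_succ.2 ⟨continuous_sol.continuousOn,
      fun p => JL (sol p.1 * p.2 * map τ (sol ((-map τ) p.1))) * sol p.1,
      fun Λ _ h => hasDirDerivAt_sol hτ Λ h, ?_⟩
    have h1 : FrechetContDiffOn n (fun p : SmoothCurve L A × SmoothCurve L A => sol p.1)
        (univ ×ˢ univ) :=
      (ih.comp_clm (ContinuousLinearMap.fst ℝ (SmoothCurve L A) (SmoothCurve L A))).mono
        fun _ _ => trivial
    have h2 : FrechetContDiffOn n (fun x : SmoothCurve L A => sol ((-map τ) x)) univ :=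
      ih.comp_clm (-map τ)
    have h3 : FrechetContDiffOn n (fun p : SmoothCurve L A × SmoothCurve L A =>
        sol ((-map τ) p.1)) (univ ×ˢ univ) :=
      (h2.comp_clm (ContinuousLinearMap.fst ℝ (SmoothCurve L A) (SmoothCurve L A))).mono
        fun _ _ => trivial
    exact (((h1.mul (frechetSmoothOn_snd _ n)).mul (h3.clm_comp (map τ))).clm_comp JL).mul h1

end AntiInvolution

/-! ### Smoothly closed curves -/

section Closed

variable {E : Type} [NormedAddCommGroup E] [NormedSpace ℝ E]

/-- `f` is the restriction to `[0, L]` of a smooth `L`-periodic curve. -/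
def IsClosedCurve (f : SmoothCurve L E) : Prop :=
  ∃ Q : ℝ → E, ContDiff ℝ ∞ Q ∧ Function.Periodic Q L ∧ ∀ s ∈ Icc 0 L, Q s = f s

theorem IsClosedCurve.apply_end {f : SmoothCurve L E} (hf : IsClosedCurve f) : f 0 = f L := by
  obtain ⟨Q, -, h2, h3⟩ := hf
  rw [← h3 0 mem_zero, ← h3 L mem_end, ← h2 0, zero_add]

theorem IsClosedCurve.D {f : SmoothCurve L E} (hf : IsClosedCurve f) : IsClosedCurve (D f) := by
  obtain ⟨Q, h1, h2, h3⟩ := hf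
  refine ⟨deriv Q, (contDiff_infty_iff_deriv.1 h1).2, fun t => ?_, fun s hs => ?_⟩
  · rw [← deriv_comp_add_const]
    exact congrArg (fun g => deriv g t) (funext h2)
  · have h4 := ((h1.differentiable (by simp) s).hasDerivAt.hasDerivWithinAt (s := Icc 0 L)).congr
      (fun t ht => (h3 t ht).symm) (h3 s hs).symm
    rw [D_apply f hs, h4.derivWithin (uniqueDiffOn_Icc hL.out s hs)]

/-- The periodic extension of a curve. -/
def periodize (f : SmoothCurve L E) (t : ℝ) : E := f (L * Int.fract (t / L))

theorem periodic_periodize (f : SmoothCurve L E) : Function.Periodic (periodize f) L := fun t => by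
  rw [periodize, periodize, add_div, div_self hL.out.ne', Int.fract_add_one]

theorem periodize_apply {f : SmoothCurve L E} (h : f 0 = f L) (n : ℤ) {t : ℝ}
    (ht : t ∈ Icc (n * L) (n * L + L)) : periodize f t = f (t - n * L) := by
  have hL0 := hL.out
  rw [periodize]
  rcases ht.2.lt_or_eq with hlt | heq
  · have h1 : Int.fract (t / L) = t / L - n := by
      refine Int.fract_eq_iff.2 ⟨?_, ?_, n, by ring⟩
      · rw [sub_nonneg, le_div_iff₀ hL0]; exact ht.1
      · rw [sub_lt_iff_lt_add, div_lt_iff₀ hL0]; linarith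
    rw [h1]
    field_simp
  -- At the right end of a period the fractional part jumps back to $0$; the matching of $f(0)$ and
  -- $f(L)$ compensates.
  · have h1 : Int.fract (t / L) = 0 := by
      have : t / L = ((n + 1 : ℤ) : ℝ) := by
        rw [heq]; push_cast; field_simp
      rw [this, Int.fract_intCast]
    rw [h1, mul_zero, heq, add_sub_cancel_left, h]

/-- On each closed period the extension is a translate of $f$. At multiples of $L$ the two one-sided
derivatives agree because $Df$ matches at the ends. -/
theorem hasDerivAt_periodize {f : SmoothCurve L E} (h : f 0 = f L) (h' : D f 0 = D f L) (t : ℝ) :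
    HasDerivAt (periodize f) (periodize (D f) t) t := by
  have hL0 := hL.out
  have key : ∀ n : ℤ, ∀ t ∈ Icc (n * L) (n * L + L),
      HasDerivWithinAt (periodize f) (periodize (D f) t) (Icc (n * L) (n * L + L)) t := by
    intro n t ht
    rw [periodize_apply h' n ht]
    have hmaps : MapsTo (fun u => u - n * L) (Icc (n * L) (n * L + L)) (Icc 0 L) := fun u hu =>
      ⟨sub_nonneg.2 hu.1, by linarith [hu.2]⟩
    have h1 := (f.hasDerivWithinAt (hmaps ht)).scomp t
      ((hasDerivAt_id t).sub_const (n * L)).hasDerivWithinAt hmaps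
    rw [one_smul] at h1
    exact h1.congr (fun u hu => periodize_apply h n hu) (periodize_apply h n ht)
  set n := ⌊t / L⌋
  have h1 : n * L ≤ t := by rw [← le_div_iff₀ hL0]; exact Int.floor_le _
  have h2 : t < n * L + L := by
    have := Int.lt_floor_add_one (t / L)
    rw [div_lt_iff₀ hL0] at this
    linarith
  rcases h1.lt_or_eq with hlt | heq
  · exact (key n t ⟨h1, h2.le⟩).hasDerivAt (Icc_mem_nhds hlt h2)
  · have h3 := (key (n - 1) t ⟨by push_cast; linarith, by push_cast; linarith⟩).union
      (key n t ⟨h1, h2.le⟩)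
    refine h3.hasDerivAt ?_
    push_cast
    rw [show ((n : ℝ) - 1) * L + L = n * L by ring, Icc_union_Icc_eq_Icc (by linarith) (by linarith)]
    exact Icc_mem_nhds (by linarith) h2

/-- Existence of a periodic extension becomes a countable family of continuous linear equations,
which makes the model space a closed subspace. -/
theorem isClosedCurve_iff {f : SmoothCurve L E} :
    IsClosedCurve f ↔ ∀ k, (D^[k] f) 0 = (D^[k] f) L := by
  constructor
  · intro h k
    have h1 : ∀ k, IsClosedCurve (SmoothCurve.D^[k] f) := by
      intro k
      induction k with
      | zero => exact h
      | succ k ih => rw [Function.iterate_succ_apply']; exact ih.D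
    exact (h1 k).apply_end
  · intro h
    have h1 : ∀ k t, HasDerivAt (periodize (D^[k] f)) (periodize (D^[k + 1] f) t) t := fun k t => by
      have h2 := h (k + 1)
      rw [Function.iterate_succ_apply'] at h2 ⊢
      exact hasDerivAt_periodize (h k) h2 t
    have h2 : ∀ n : ℕ, ∀ k, ContDiff ℝ n (periodize (D^[k] f)) := by
      intro n
      induction n with
      | zero =>
        exact fun k => by
          rw [Nat.cast_zero]
          exact contDiff_zero.2 (continuous_iff_continuousAt.2 fun t => (h1 k t).continuousAt)
      | succ n ih =>
        intro k
        rw [Nat.cast_succ]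
        refine contDiff_succ_iff_deriv.2 ⟨fun t => (h1 k t).differentiableAt,
          fun h => absurd h (by simp), ?_⟩
        rw [funext fun t => (h1 k t).deriv]
        exact ih (k + 1)
    refine ⟨periodize f, contDiff_infty.2 fun n => h2 n 0, periodic_periodize f, fun s hs => ?_⟩
    have := periodize_apply (h 0) 0 (t := s) (by simpa using hs)
    simpa using this

end Closed

/-! ### The model space -/

variable (L) in
/-- The smooth curves in `ℂ` that start at `0` and, if `c` holds, are smoothly closed. -/
def modelSpace (c : Prop) : Submodule ℝ (SmoothCurve L ℂ) where
  carrier := {f | f 0 = 0 ∧ (c → ∀ k, (D^[k] f) 0 = (D^[k] f) L)}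
  add_mem' := fun {f g} hf hg => ⟨by rw [add_apply, hf.1, hg.1, add_zero], fun hc k => by
    have h := hf.2 hc k
    have h' := hg.2 hc k
    rw [← Module.End.pow_apply] at h h' ⊢
    rw [map_add, add_apply, add_apply, h, h']⟩
  zero_mem' := ⟨rfl, fun _ k => by rw [← Module.End.pow_apply, map_zero]; rfl⟩
  smul_mem' := fun a f hf => ⟨by rw [smul_apply, hf.1, smul_zero], fun hc k => by
    have h := hf.2 hc k
    rw [← Module.End.pow_apply] at h ⊢
    rw [map_smul, smul_apply, smul_apply, h]⟩

theorem mem_modelSpace {c : Prop} {f : SmoothCurve L ℂ} :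
    f ∈ modelSpace L c ↔ f 0 = 0 ∧ (c → IsClosedCurve f) := by
  rw [isClosedCurve_iff]; rfl

theorem isClosed_modelSpace (c : Prop) : IsClosed (modelSpace L c : Set (SmoothCurve L ℂ)) := by
  have h1 : (modelSpace L c : Set (SmoothCurve L ℂ)) = {f | evalL 0 f = 0} ∩
      ⋂ (_ : c) (k : ℕ), {f | evalL 0 (D^[k] f) = evalL L (D^[k] f)} := by
    ext f
    simp only [mem_inter_iff, mem_iInter, mem_ofPred_eq]
    rfl
  rw [h1]
  refine (isClosed_eq (evalL 0).continuous continuous_const).inter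
    (isClosed_iInter fun _ => isClosed_iInter fun k => ?_)
  exact isClosed_eq ((evalL 0).continuous.comp (continuous_D.iterate k))
    ((evalL L).continuous.comp (continuous_D.iterate k))

theorem isFrechetSpace_submodule {E : Type} [NormedAddCommGroup E] [NormedSpace ℝ E]
    [CompleteSpace E] {P : Submodule ℝ (SmoothCurve L E)}
    (hP : IsClosed (P : Set (SmoothCurve L E))) : IsFrechetSpace P where
  t2 := inferInstance
  seminorms := by
    refine ⟨fun k => (seminorm k).comp P.subtype, P.subtype.withSeminorms_induced withSeminorms,
      fun u hu => ?_⟩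
    obtain ⟨a, ha⟩ := exists_tendsto_of_cauchy (fun i => (u i : SmoothCurve L E)) hu
    exact ⟨⟨a, hP.mem_of_tendsto ha (Eventually.of_forall fun i => (u i).2)⟩,
      tendsto_subtype_rng.2 ha⟩

end SmoothCurve

theorem IsFrechetSpace.isTopologicalAddGroup (V : Type) [AddCommGroup V] [Module ℝ V]
    [TopologicalSpace V] [IsFrechetSpace V] : IsTopologicalAddGroup V := by
  obtain ⟨p, hp, -⟩ := IsFrechetSpace.seminorms (V := V)
  exact hp.topologicalAddGroup

theorem IsFrechetSpace.continuousSMul (V : Type) [AddCommGroup V] [Module ℝ V]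
    [TopologicalSpace V] [IsFrechetSpace V] : ContinuousSMul ℝ V := by
  obtain ⟨p, hp, -⟩ := IsFrechetSpace.seminorms (V := V)
  exact hp.continuousSMul

end

noncomputable section

namespace SmoothCurve

variable {L : ℝ} [hL : Fact (0 < L)]

/-- Continuous linear maps between normed spaces. -/
abbrev NormedLin (E F : Type) [NormedAddCommGroup E] [NormedSpace ℝ E] [NormedAddCommGroup F]
    [NormedSpace ℝ F] : Type := E →L[ℝ] F

/-! ### Curves of matrices -/

/-- Conjugate transposition as a continuous real-linear map. -/
def conjTransposeL : NormedLin Mat2 Mat2 :=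
  LinearMap.toContinuousLinearMap
    { toFun := Matrix.conjTranspose
      map_add' := Matrix.conjTranspose_add
      map_smul' := fun c M => by
        ext i j; simp [Matrix.conjTranspose_apply] }

/-- Passage to the adjugate matrix as a continuous linear map. -/
def adjugateL : NormedLin Mat2 Mat2 :=
  LinearMap.toContinuousLinearMap
    { toFun := Matrix.adjugate
      map_add' := fun M N => by
        ext i j; fin_cases i <;> fin_cases j <;> simp [Matrix.adjugate_fin_two, add_comm]
      map_smul' := fun c M => by
        ext i j; fin_cases i <;> fin_cases j <;> simp [Matrix.adjugate_fin_two] }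

theorem adjugateL_apply (M : Mat2) : adjugateL M = M.adjugate := rfl

theorem conjTransposeL_mul (M N : Mat2) :
    conjTransposeL (M * N) = conjTransposeL N * conjTransposeL M := Matrix.conjTranspose_mul M N

theorem conjTransposeL_conjTransposeL (M : Mat2) : conjTransposeL (conjTransposeL M) = M :=
  Matrix.conjTranspose_conjTranspose M

theorem adjugateL_mul (M N : Mat2) : adjugateL (M * N) = adjugateL N * adjugateL M :=
  Matrix.adjugate_mul_distrib M N

/-- The pointwise conjugate transpose of a curve of matrices. -/
def adj (X : SmoothCurve L Mat2) : SmoothCurve L Mat2 := map conjTransposeL X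

theorem adj_apply (X : SmoothCurve L Mat2) (s : ℝ) : adj X s = (X s)ᴴ := rfl

theorem adj_mul (X Y : SmoothCurve L Mat2) : adj (X * Y) = adj Y * adj X :=
  ext fun _ _ => conjTransposeL_mul _ _

theorem D_adj (X : SmoothCurve L Mat2) : D (adj X) = adj (D X) := D_map _ _

theorem smooth_sol : FrechetSmoothOn (sol : SmoothCurve L Mat2 → SmoothCurve L Mat2) univ :=
  frechetSmoothOn_sol ⟨conjTransposeL_mul, conjTransposeL_conjTransposeL⟩

/-- For skew-Hermitian $\Lambda$ and $\tau$ the conjugate transpose, $-\tau\Lambda=\Lambda$, so the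
inverse of the solution is its adjoint. -/
theorem sol_mul_adj_sol {Λ : SmoothCurve L Mat2} (h : adj Λ = -Λ) : sol Λ * adj (sol Λ) = 1 := by
  have h1 := sol_mul_solInv ⟨conjTransposeL_mul, conjTransposeL_conjTransposeL⟩ Λ
  have h2 : -map conjTransposeL Λ = Λ := by
    rw [show map conjTransposeL Λ = -Λ from h, neg_neg]
  rwa [solInv, h2] at h1

theorem hasDirDerivAt_sol_adj {Λ : SmoothCurve L Mat2} (hΛ : adj Λ = -Λ) (h : SmoothCurve L Mat2) :
    HasDirDerivAt sol (J (sol Λ * h * adj (sol Λ)) * sol Λ) Λ h := by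
  have h1 := hasDirDerivAt_sol ⟨conjTransposeL_mul, conjTransposeL_conjTransposeL⟩ Λ h
  have h2 : -map conjTransposeL Λ = Λ := by
    rw [show map conjTransposeL Λ = -Λ from hΛ, neg_neg]
  rwa [solInv, h2] at h1

/-- The unitarity argument repeated with the adjugate: it is also an anti-involution and equals $-M$
on traceless $M$, so $X\operatorname{adj}(X)=\det X\cdot I$ is constant. -/
theorem det_sol {Λ : SmoothCurve L Mat2} (h : ∀ s ∈ Icc 0 L, (Λ s).trace = 0) {s : ℝ}
    (hs : s ∈ Icc 0 L) : (sol Λ s).det = 1 := by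
  have h1 : ∀ M : Mat2, M.trace = 0 → adjugateL M = -M := fun M hM => by
    rw [Matrix.trace_fin_two] at hM
    rw [adjugateL_apply, Matrix.adjugate_fin_two]
    ext i j
    fin_cases i <;> fin_cases j <;> simp
    · linear_combination hM
    · linear_combination hM
  have h2 : D (map adjugateL (sol Λ)) = -(Λ * map adjugateL (sol Λ)) := by
    rw [D_map, D_sol]
    refine ext fun t ht => ?_
    simp only [map_apply, mul_apply, neg_apply, adjugateL_mul, h1 _ (h t ht), neg_mul]
  have h3 : sol Λ * map adjugateL (sol Λ) = 1 := by
    refine eq_one_of_D_eq_zero ?_ ?_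
    · rw [D_mul, D_sol, h2, mul_neg, mul_assoc, add_neg_cancel]
    · rw [mul_apply, map_apply, sol_zero, adjugateL_apply, Matrix.adjugate_one, one_mul]
  have h4 := congrArg (fun Z : SmoothCurve L Mat2 => Z s) h3
  simp only [mul_apply, one_apply hs, map_apply, adjugateL_apply, Matrix.mul_adjugate] at h4
  simpa using congrFun (congrFun h4 0) 0

theorem mem_specialUnitaryGroup_sol {Λ : SmoothCurve L Mat2} (h1 : adj Λ = -Λ)
    (h2 : ∀ s ∈ Icc 0 L, (Λ s).trace = 0) {s : ℝ} (hs : s ∈ Icc 0 L) :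
    sol Λ s ∈ Matrix.specialUnitaryGroup (Fin 2) ℂ := by
  refine Matrix.mem_specialUnitaryGroup_iff.2 ⟨Matrix.mem_unitaryGroup_iff.2 ?_, det_sol h2 hs⟩
  have := congrArg (fun Z : SmoothCurve L Mat2 => Z s) (sol_mul_adj_sol h1)
  simp only [mul_apply, one_apply hs] at this
  exact this

end SmoothCurve

end

noncomputable section

open ComplexConjugate

/-! ### Matrices in `SU(2)` -/

/-- The matrix with rows `(a, -b̄)` and `(b, ā)`. -/
def suMatrix (a b : ℂ) : Mat2 := !![a, -conj b; b, conj a]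

theorem suMatrix_mem {a b : ℂ} (h : conj a * a + conj b * b = 1) :
    suMatrix a b ∈ Matrix.specialUnitaryGroup (Fin 2) ℂ := by
  refine Matrix.mem_specialUnitaryGroup_iff.2 ⟨Matrix.mem_unitaryGroup_iff.2 ?_, ?_⟩
  · rw [Matrix.star_eq_conjTranspose]
    ext i j
    fin_cases i <;> fin_cases j <;>
      simp [suMatrix, Matrix.mul_apply, Fin.sum_univ_two, Matrix.conjTranspose_apply]
    · linear_combination h
    · ring
    · ring
    · linear_combination h
  · rw [suMatrix, Matrix.det_fin_two_of]
    linear_combination h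

/-- The inverse in $SU(2)$ is both the adjugate and the conjugate transpose; comparing entries gives
the form. -/
theorem exists_eq_suMatrix {g : Mat2} (hg : g ∈ Matrix.specialUnitaryGroup (Fin 2) ℂ) :
    ∃ a b, conj a * a + conj b * b = 1 ∧ g = suMatrix a b := by
  obtain ⟨h1, h2⟩ := Matrix.mem_specialUnitaryGroup_iff.1 hg
  have h3 : g.adjugate = gᴴ := by
    have h4 := Matrix.mem_unitaryGroup_iff'.1 h1
    rw [Matrix.star_eq_conjTranspose] at h4
    calc g.adjugate = (gᴴ * g) * g.adjugate := by rw [h4, one_mul]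
      _ = gᴴ := by rw [mul_assoc, Matrix.mul_adjugate, h2, one_smul, mul_one]
  rw [Matrix.adjugate_fin_two] at h3
  have e1 : g 1 1 = conj (g 0 0) := by simpa using congrFun (congrFun h3 0) 0
  have e2 : g 0 1 = -conj (g 1 0) := by
    have : -g 0 1 = conj (g 1 0) := by simpa using congrFun (congrFun h3 0) 1
    rw [← this, neg_neg]
  refine ⟨g 0 0, g 1 0, ?_, ?_⟩
  · rw [Matrix.det_fin_two, e1, e2] at h2
    linear_combination h2
  · rw [suMatrix, ← e1, ← e2]
    exact Matrix.eta_fin_two g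

theorem conjTranspose_mul_self_of_mem {g : Mat2} (hg : g ∈ Matrix.specialUnitaryGroup (Fin 2) ℂ) :
    gᴴ * g = 1 :=
  Matrix.mem_unitaryGroup_iff'.1 (Matrix.mem_specialUnitaryGroup_iff.1 hg).1

theorem mul_conjTranspose_self_of_mem {g : Mat2} (hg : g ∈ Matrix.specialUnitaryGroup (Fin 2) ℂ) :
    g * gᴴ = 1 :=
  Matrix.mem_unitaryGroup_iff.1 (Matrix.mem_specialUnitaryGroup_iff.1 hg).1

theorem conjTranspose_mem {g : Mat2} (hg : g ∈ Matrix.specialUnitaryGroup (Fin 2) ℂ) :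
    gᴴ ∈ Matrix.specialUnitaryGroup (Fin 2) ℂ := by
  obtain ⟨h1, h2⟩ := Matrix.mem_specialUnitaryGroup_iff.1 hg
  refine Matrix.mem_specialUnitaryGroup_iff.2 ⟨Matrix.mem_unitaryGroup_iff.2 ?_, ?_⟩
  · rw [Matrix.star_eq_conjTranspose, Matrix.conjTranspose_conjTranspose]
    exact Matrix.mem_unitaryGroup_iff'.1 h1
  · rw [Matrix.det_conjTranspose, h2, star_one]

namespace SmoothCurve

/-- Complex conjugation as a continuous real-linear map. -/
def conjL : NormedLin ℂ ℂ := Complex.conjCLE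

theorem conjL_apply (w : ℂ) : conjL w = conj w := rfl

/-- The linear map `w ↦ diag(iw, -iw)`. -/
def diagL : NormedLin ℂ Mat2 :=
  LinearMap.toContinuousLinearMap
    { toFun := fun w => !![Complex.I * w, 0; 0, -(Complex.I * w)]
      map_add' := fun v w => by
        ext i j; fin_cases i <;> fin_cases j <;> simp [mul_add, add_comm]
      map_smul' := fun c w => by
        ext i j; fin_cases i <;> fin_cases j <;> simp <;> ring }

/-- The linear map sending `w` to the matrix with rows `(0, i w̄)` and `(i w, 0)`. -/
def offDiagL : NormedLin ℂ Mat2 :=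
  LinearMap.toContinuousLinearMap
    { toFun := fun w => !![0, Complex.I * conj w; Complex.I * w, 0]
      map_add' := fun v w => by
        ext i j; fin_cases i <;> fin_cases j <;> simp [mul_add]
      map_smul' := fun c w => by
        ext i j; fin_cases i <;> fin_cases j <;> simp <;> ring }

/-- The linear map `w ↦ suMatrix 0 w`. -/
def skewL : NormedLin ℂ Mat2 :=
  LinearMap.toContinuousLinearMap
    { toFun := suMatrix 0
      map_add' := fun v w => by
        ext i j; fin_cases i <;> fin_cases j <;> simp [suMatrix, add_comm]
      map_smul' := fun c w => by
        ext i j; fin_cases i <;> fin_cases j <;> simp [suMatrix] }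

/-- The entries of a matrix as continuous linear maps. -/
def entryL (i j : Fin 2) : NormedLin Mat2 ℂ :=
  LinearMap.toContinuousLinearMap
    { toFun := fun M => M i j
      map_add' := fun _ _ => rfl
      map_smul' := fun _ _ => rfl }

theorem diagL_apply (w : ℂ) : diagL w = !![Complex.I * w, 0; 0, -(Complex.I * w)] := rfl
theorem offDiagL_apply (w : ℂ) : offDiagL w = !![0, Complex.I * conj w; Complex.I * w, 0] := rfl
theorem skewL_apply (w : ℂ) : skewL w = suMatrix 0 w := rfl
theorem entryL_apply (i j : Fin 2) (M : Mat2) : entryL i j M = M i j := rfl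

theorem suMatrix_mul_pauliA1 {a b : ℂ} (h : conj a * a + conj b * b = 1) :
    suMatrix a b * pauliA1 * (suMatrix a b)ᴴ =
      diagL (conj a * a) + offDiagL (conj a * b) - pauliA1 := by
  rw [diagL_apply, offDiagL_apply]
  ext i j
  fin_cases i <;> fin_cases j <;>
    simp [suMatrix, pauliA1, Matrix.mul_apply, Fin.sum_univ_two, Matrix.conjTranspose_apply]
  · linear_combination (-Complex.I / 2) * h
  · ring
  · ring
  · linear_combination (Complex.I / 2) * h

theorem one_add_normSq_ne_zero (z : ℂ) : 1 + conj z * z ≠ 0 := by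
  rw [← Complex.normSq_eq_conj_mul_self]
  have h := Complex.normSq_nonneg z
  exact_mod_cast (by positivity : (1 + Complex.normSq z : ℝ) ≠ 0)

/-- The inverse of the stereographic projection from `-A₁`. -/
def stereoPoint (z : ℂ) : Mat2 :=
  diagL (1 + conj z * z)⁻¹ + offDiagL ((1 + conj z * z)⁻¹ * z) - pauliA1

/-- Since $1+|b/a|^2=|a|^{-2}$, the ratio $b/a$ recovers both $|a|^2$ and $\bar a b$, on which alone
the rotated $A_1$ depends. -/
theorem stereoPoint_div {a b : ℂ} (h : conj a * a + conj b * b = 1) (ha : a ≠ 0) :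
    stereoPoint (b / a) = suMatrix a b * pauliA1 * (suMatrix a b)ᴴ := by
  have hca : conj a ≠ 0 := (map_ne_zero _).2 ha
  have h1 : (1 + conj (b / a) * (b / a))⁻¹ = conj a * a := by
    rw [map_div₀]
    have : 1 + conj b / conj a * (b / a) = (conj a * a)⁻¹ := by
      field_simp
      linear_combination h
    rw [this, inv_inv]
  rw [stereoPoint, h1, suMatrix_mul_pauliA1 h]
  congr 3
  field_simp

theorem entry_of_suMatrix {a b : ℂ} (h : conj a * a + conj b * b = 1) :
    Complex.I / 2 + (suMatrix a b * pauliA1 * (suMatrix a b)ᴴ) 0 0 = Complex.I * (conj a * a) ∧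
      (suMatrix a b * pauliA1 * (suMatrix a b)ᴴ) 1 0 = Complex.I * (conj a * b) := by
  rw [suMatrix_mul_pauliA1 h, diagL_apply, offDiagL_apply, pauliA1]
  constructor
  · simp; ring
  · simp

/-- The two entries are $i\,\bar a b$ and $i|a|^2$, with quotient $b/a$; the hypothesis excludes
only the centre of projection $-A_1$. -/
theorem stereoPoint_of_mem {g : Mat2} (hg : g ∈ Matrix.specialUnitaryGroup (Fin 2) ℂ)
    (h0 : Complex.I / 2 + (g * pauliA1 * gᴴ) 0 0 ≠ 0) :
    stereoPoint ((g * pauliA1 * gᴴ) 1 0 * (Complex.I / 2 + (g * pauliA1 * gᴴ) 0 0)⁻¹) =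
      g * pauliA1 * gᴴ := by
  obtain ⟨a, b, h, rfl⟩ := exists_eq_suMatrix hg
  obtain ⟨e1, e2⟩ := entry_of_suMatrix h
  rw [e1] at h0
  have ha : a ≠ 0 := fun h => h0 (by simp [h])
  have hca : conj a ≠ 0 := (map_ne_zero _).2 ha
  rw [e1, e2, ← stereoPoint_div h ha]
  congr 1
  have := Complex.I_ne_zero
  field_simp

/-- A matrix in `SU(2)` that rotates `A₁` to `stereoPoint z`. -/
def stereoFrame (z : ℂ) : Mat2 := (√(1 + Complex.normSq z))⁻¹ • (1 + skewL z)

theorem stereoFrame_eq (z : ℂ) :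
    stereoFrame z = suMatrix ((√(1 + Complex.normSq z))⁻¹ : ℝ)
      (((√(1 + Complex.normSq z))⁻¹ : ℝ) * z) := by
  rw [stereoFrame, skewL_apply]
  ext i j
  fin_cases i <;> fin_cases j <;> simp [suMatrix]

theorem stereoFrame_norm (z : ℂ) :
    conj (((√(1 + Complex.normSq z))⁻¹ : ℝ) : ℂ) * ((√(1 + Complex.normSq z))⁻¹ : ℝ) +
      conj ((((√(1 + Complex.normSq z))⁻¹ : ℝ) : ℂ) * z) * (((√(1 + Complex.normSq z))⁻¹ : ℝ) * z)
      = 1 := by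
  have h0 : 0 < 1 + Complex.normSq z := by have := Complex.normSq_nonneg z; linarith
  have h : (√(1 + Complex.normSq z))⁻¹ * (√(1 + Complex.normSq z))⁻¹ * (1 + Complex.normSq z) = 1 := by
    rw [← mul_inv, Real.mul_self_sqrt h0.le, inv_mul_cancel₀ h0.ne']
  have h' := congrArg (fun x : ℝ => (x : ℂ)) h
  simp only [Complex.ofReal_mul, Complex.ofReal_add, Complex.ofReal_one,
    Complex.normSq_eq_conj_mul_self] at h'
  rw [map_mul, Complex.conj_ofReal]
  linear_combination h'

theorem stereoFrame_mem (z : ℂ) : stereoFrame z ∈ Matrix.specialUnitaryGroup (Fin 2) ℂ := by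
  rw [stereoFrame_eq]
  exact suMatrix_mem (stereoFrame_norm z)

theorem stereoFrame_conj (z : ℂ) : stereoFrame z * pauliA1 * (stereoFrame z)ᴴ = stereoPoint z := by
  have h0 : 0 < 1 + Complex.normSq z := by have := Complex.normSq_nonneg z; linarith
  have hne : (((√(1 + Complex.normSq z))⁻¹ : ℝ) : ℂ) ≠ 0 := by
    exact_mod_cast (inv_pos.2 (Real.sqrt_pos.2 h0)).ne'
  have h := stereoPoint_div (stereoFrame_norm z) hne
  rw [mul_div_cancel_left₀ _ hne] at h
  rw [stereoFrame_eq, h]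

theorem stereoFrame_zero : stereoFrame 0 = 1 := by
  rw [stereoFrame, map_zero]; simp

theorem contDiff_stereoFrame : ContDiff ℝ ∞ stereoFrame := by
  have h1 : ContDiff ℝ ∞ fun z : ℂ => 1 + Complex.normSq z := by
    simp only [Complex.normSq_apply]
    have hre : ContDiff ℝ ∞ fun z : ℂ => z.re := Complex.reCLM.contDiff
    have him : ContDiff ℝ ∞ fun z : ℂ => z.im := Complex.imCLM.contDiff
    exact contDiff_const.add ((hre.mul hre).add (him.mul him))
  have h0 : ∀ z : ℂ, 0 < 1 + Complex.normSq z := fun z => by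
    have := Complex.normSq_nonneg z; linarith
  have h2 : ContDiff ℝ ∞ fun z : ℂ => (√(1 + Complex.normSq z))⁻¹ :=
    (h1.sqrt fun z => (h0 z).ne').inv fun z => (Real.sqrt_pos.2 (h0 z)).ne'
  exact h2.smul (contDiff_const.add skewL.contDiff)

end SmoothCurve

end

noncomputable section

namespace SmoothCurve

open ComplexConjugate

variable {L : ℝ} [hL : Fact (0 < L)]

/-! ### Rotations of `A₁` along curves -/

theorem adj_mul_self {R : SmoothCurve L Mat2}
    (hR : ∀ s ∈ Icc 0 L, R s ∈ Matrix.specialUnitaryGroup (Fin 2) ℂ) : adj R * R = 1 :=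
  ext fun s hs => by
    rw [mul_apply, adj_apply, one_apply hs]
    exact conjTranspose_mul_self_of_mem (hR s hs)

theorem mul_adj_self {R : SmoothCurve L Mat2}
    (hR : ∀ s ∈ Icc 0 L, R s ∈ Matrix.specialUnitaryGroup (Fin 2) ℂ) : R * adj R = 1 :=
  ext fun s hs => by
    rw [mul_apply, adj_apply, one_apply hs]
    exact mul_conjTranspose_self_of_mem (hR s hs)

theorem conjTranspose_pauliA1 : pauliA1ᴴ = -pauliA1 := by
  ext i j
  fin_cases i <;> fin_cases j <;> simp [pauliA1, Matrix.conjTranspose_apply]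

theorem trace_pauliA1 : pauliA1.trace = 0 := by
  simp [pauliA1, Matrix.trace_fin_two]

theorem adj_eq_neg_of_rotation {Λ G : SmoothCurve L Mat2}
    (h : ∀ s ∈ Icc 0 L, Λ s = G s * pauliA1 * (G s)ᴴ) : adj Λ = -Λ :=
  ext fun s hs => by
    rw [adj_apply, neg_apply, h s hs, Matrix.conjTranspose_mul, Matrix.conjTranspose_mul,
      Matrix.conjTranspose_conjTranspose, conjTranspose_pauliA1, ← mul_assoc, mul_neg, neg_mul]

theorem trace_rotation {g : Mat2} (hg : g ∈ Matrix.specialUnitaryGroup (Fin 2) ℂ) :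
    (g * pauliA1 * gᴴ).trace = 0 := by
  rw [Matrix.trace_mul_comm, ← mul_assoc, conjTranspose_mul_self_of_mem hg, one_mul, trace_pauliA1]

theorem adj_mul_D_eq {X R : SmoothCurve L Mat2} (h : IsAnchoredDarboux X R) {s : ℝ}
    (hs : s ∈ Icc 0 L) : (adj X * D X) s = R s * pauliA1 * (R s)ᴴ := by
  have hd : D X s = X s * (R s * pauliA1 * (R s)ᴴ) := (D_apply X hs).trans (h.deriv_X s hs)
  rw [mul_apply, hd, adj_apply, ← mul_assoc,
    conjTranspose_mul_self_of_mem (h.X_mem s hs), one_mul]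

/-- The anchored curve determined by its logarithmic derivative. -/
theorem eq_sol_of_isAnchoredDarboux {X R : SmoothCurve L Mat2} (h : IsAnchoredDarboux X R) :
    X = sol (adj X * D X) :=
  eq_sol (by rw [← mul_assoc, mul_adj_self h.X_mem, one_mul]) h.X_zero

/-! ### Stereographic parametrization -/

/-- `(1 + |f|²)⁻¹`. -/
def conformalFactor (f : SmoothCurve L ℂ) : SmoothCurve L ℂ := Ring.inverse (1 + map conjL f * f)

theorem isUnit_one_add (f : SmoothCurve L ℂ) : IsUnit (1 + map conjL f * f) :=
  isUnit_iff.2 fun s hs => by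
    rw [add_apply, one_apply hs]
    exact one_add_normSq_ne_zero (f s)

theorem conformalFactor_apply (f : SmoothCurve L ℂ) {s : ℝ} (hs : s ∈ Icc 0 L) :
    conformalFactor f s = (1 + conj (f s) * f s)⁻¹ := by
  rw [conformalFactor, ringInverse_apply (isUnit_one_add f) hs, add_apply, one_apply hs]
  rfl

/-- The curve in the orbit of `A₁` with stereographic coordinate `f`. -/
def stereoCurve (f : SmoothCurve L ℂ) : SmoothCurve L Mat2 :=
  map diagL (conformalFactor f) + map offDiagL (conformalFactor f * f) - const L pauliA1

theorem stereoCurve_apply (f : SmoothCurve L ℂ) {s : ℝ} (hs : s ∈ Icc 0 L) :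
    stereoCurve f s = stereoPoint (f s) := by
  rw [stereoCurve, sub_apply, add_apply, map_apply, map_apply, mul_apply,
    conformalFactor_apply f hs, const_apply _ hs, stereoPoint]

/-- The logarithmic derivative with stereographic coordinate `f` relative to the frame `R`. -/
def logDeriv (R : SmoothCurve L Mat2) (f : SmoothCurve L ℂ) : SmoothCurve L Mat2 :=
  R * stereoCurve f * adj R

/-- The curve of frames that rotate `A₁` to `stereoCurve f`. -/
def frameCurve (f : SmoothCurve L ℂ) : SmoothCurve L Mat2 :=
  ofContDiffOn (fun s => stereoFrame (f s)) (contDiff_stereoFrame.comp_contDiffOn f.contDiffOn)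

theorem frameCurve_apply (f : SmoothCurve L ℂ) {s : ℝ} (hs : s ∈ Icc 0 L) :
    frameCurve f s = stereoFrame (f s) :=
  ofContDiffOn_apply _ hs

theorem logDeriv_apply (R : SmoothCurve L Mat2) (f : SmoothCurve L ℂ) {s : ℝ} (hs : s ∈ Icc 0 L) :
    logDeriv R f s = (R * frameCurve f) s * pauliA1 * ((R * frameCurve f) s)ᴴ := by
  rw [logDeriv, mul_apply, mul_apply, mul_apply, stereoCurve_apply f hs, ← stereoFrame_conj,
    frameCurve_apply f hs, adj_apply, Matrix.conjTranspose_mul]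
  simp only [mul_assoc]

/-- A smooth curve in `SU(2)` that starts at the identity and, if `c` holds, is smoothly closed. -/
structure IsFrame (c : Prop) (R : SmoothCurve L Mat2) : Prop where
  mem : ∀ s ∈ Icc 0 L, R s ∈ Matrix.specialUnitaryGroup (Fin 2) ℂ
  zero : R 0 = 1
  closed : c → IsSmoothlyClosed R

/-- The curve `X` with stereographic coordinate `f` relative to the frame `R`. -/
def ofCoord (R : SmoothCurve L Mat2) (f : SmoothCurve L ℂ) : SmoothCurve L Mat2 := sol (logDeriv R f)

/-- This makes the charts surjective onto the model space. The lift `stereoFrame` is applied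
pointwise and sends $0$ to the identity, so it respects both the anchoring and a periodic extension.
-/
theorem IsFrame.mul_frameCurve {c : Prop} {R : SmoothCurve L Mat2} (hR : IsFrame c R)
    {f : SmoothCurve L ℂ} (hf : f ∈ modelSpace L c) : IsFrame c (R * frameCurve f) where
  mem s hs := by
    rw [mul_apply, frameCurve_apply f hs]
    exact mul_mem (hR.mem s hs) (stereoFrame_mem _)
  zero := by
    rw [mul_apply, frameCurve_apply f mem_zero, hR.zero, (mem_modelSpace.1 hf).1, stereoFrame_zero,
      one_mul]
  closed hc := by
    obtain ⟨Q₁, h1, h2, h3⟩ := hR.closed hc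
    obtain ⟨Q₂, k1, k2, k3⟩ := (mem_modelSpace.1 hf).2 hc
    refine ⟨fun t => Q₁ t * stereoFrame (Q₂ t), h1.mul (contDiff_stereoFrame.comp k1),
      fun t => ?_, fun s hs => ?_⟩
    · simp only [h2 t, k2 t]
    · simp only [h3 s hs, k3 s hs]
      rw [mul_apply, frameCurve_apply f hs]

theorem adj_logDeriv (R : SmoothCurve L Mat2) (f : SmoothCurve L ℂ) :
    adj (logDeriv R f) = -logDeriv R f :=
  adj_eq_neg_of_rotation (G := R * frameCurve f) fun _ hs => logDeriv_apply R f hs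

theorem ofCoord_mem {c : Prop} {R : SmoothCurve L Mat2} (hR : IsFrame c R) (f : SmoothCurve L ℂ)
    {s : ℝ} (hs : s ∈ Icc 0 L) : ofCoord R f s ∈ Matrix.specialUnitaryGroup (Fin 2) ℂ := by
  refine mem_specialUnitaryGroup_sol (adj_logDeriv R f) (fun t ht => ?_) hs
  rw [logDeriv_apply R f ht]
  refine trace_rotation ?_
  rw [mul_apply, frameCurve_apply f ht]
  exact mul_mem (hR.mem t ht) (stereoFrame_mem _)

theorem isAnchoredDarboux_ofCoord {c : Prop} {R : SmoothCurve L Mat2} (hR : IsFrame c R)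
    {f : SmoothCurve L ℂ} (hf : f ∈ modelSpace L c) :
    IsAnchoredDarboux (ofCoord R f) (R * frameCurve f) where
  X_mem _ hs := ofCoord_mem hR f hs
  R_mem := (hR.mul_frameCurve hf).mem
  X_zero := sol_zero _
  R_zero := (hR.mul_frameCurve hf).zero
  deriv_X s hs := by
    have hd : D (ofCoord R f) s = ofCoord R f s * ((R * frameCurve f) s * pauliA1 *
        ((R * frameCurve f) s)ᴴ) := by
      rw [ofCoord, D_sol, mul_apply, logDeriv_apply R f hs]
    exact (D_apply _ hs).symm.trans hd

theorem adj_mul_D_ofCoord {c : Prop} {R : SmoothCurve L Mat2} (hR : IsFrame c R)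
    (f : SmoothCurve L ℂ) : adj (ofCoord R f) * D (ofCoord R f) = logDeriv R f := by
  rw [ofCoord, D_sol, ← mul_assoc, ← ofCoord, adj_mul_self fun _ hs => ofCoord_mem hR f hs, one_mul]

/-! ### The stereographic coordinate of a curve -/

/-- The logarithmic derivative of `X` in the frame `R`. -/
def rotated (R X : SmoothCurve L Mat2) : SmoothCurve L Mat2 := adj R * (adj X * D X) * R

/-- The denominator of the stereographic coordinate. -/
def denom (R X : SmoothCurve L Mat2) : SmoothCurve L ℂ :=
  const L (Complex.I / 2) + map (entryL 0 0) (rotated R X)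

/-- The stereographic coordinate of `X` relative to the frame `R`. -/
def coord (R X : SmoothCurve L Mat2) : SmoothCurve L ℂ :=
  map (entryL 1 0) (rotated R X) * Ring.inverse (denom R X)

/-- The open set on which the stereographic coordinate is defined. -/
def coordDomain (R : SmoothCurve L Mat2) : Set (SmoothCurve L Mat2) := {X | IsUnit (denom R X)}

theorem smooth_const_mul {E : Type} [AddCommGroup E] [Module ℝ E] [TopologicalSpace E]
    [IsTopologicalAddGroup E] [ContinuousSMul ℝ E] {g : E → SmoothCurve L Mat2} {U : Set E}
    (hg : FrechetSmoothOn g U) (R Q : SmoothCurve L Mat2) :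
    FrechetSmoothOn (fun x => R * g x * Q) U :=
  ((frechetSmoothOn_const R U).mul hg).mul (frechetSmoothOn_const Q U)

theorem smooth_rotated (R : SmoothCurve L Mat2) : FrechetSmoothOn (rotated R) univ := by
  have h1 : FrechetSmoothOn (fun X : SmoothCurve L Mat2 => adj X) univ :=
    frechetSmoothOn_clm (map conjTransposeL) univ
  have h2 : FrechetSmoothOn (fun X : SmoothCurve L Mat2 => D X) univ :=
    frechetSmoothOn_clm DL univ
  exact smooth_const_mul (h1.mul h2) (adj R) R

theorem smooth_denom (R : SmoothCurve L Mat2) : FrechetSmoothOn (denom R) univ :=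
  (frechetSmoothOn_const _ univ).add ((smooth_rotated R).clm_comp (map (entryL 0 0)))

theorem isOpen_coordDomain (R : SmoothCurve L Mat2) : IsOpen (coordDomain R) :=
  isOpen_isUnit.preimage (continuousOn_univ.1 (smooth_denom R).continuousOn)

theorem smooth_ringInverse :
    FrechetSmoothOn (Ring.inverse : SmoothCurve L ℂ → SmoothCurve L ℂ) {f | IsUnit f} :=
  frechetSmoothOn_ringInverse isOpen_isUnit continuousOn_ringInverse

theorem smooth_coord (R : SmoothCurve L Mat2) : FrechetSmoothOn (coord R) (coordDomain R) := by
  have h1 : FrechetSmoothOn (fun X => map (entryL 1 0) (rotated R X)) (coordDomain R) :=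
    ((smooth_rotated R).clm_comp (map (entryL 1 0))).mono (subset_univ _)
  have h2 : FrechetSmoothOn (fun X => Ring.inverse (denom R X)) (coordDomain R) :=
    smooth_ringInverse.comp ((smooth_denom R).mono (subset_univ _)) isOpen_isUnit fun _ hX => hX
  exact h1.mul h2

theorem smooth_conformalFactor :
    FrechetSmoothOn (conformalFactor : SmoothCurve L ℂ → SmoothCurve L ℂ) univ := by
  have h1 : FrechetSmoothOn (fun f : SmoothCurve L ℂ => 1 + map conjL f * f) univ :=
    (frechetSmoothOn_const 1 univ).add
      ((frechetSmoothOn_clm (map conjL) univ).mul (frechetSmoothOn_id univ))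
  exact smooth_ringInverse.comp h1 isOpen_isUnit fun f _ => isUnit_one_add f

theorem smooth_logDeriv (R : SmoothCurve L Mat2) : FrechetSmoothOn (logDeriv R) univ := by
  have h1 : FrechetSmoothOn (fun f : SmoothCurve L ℂ => conformalFactor f * f) univ :=
    smooth_conformalFactor.mul (frechetSmoothOn_id univ)
  have h2 : FrechetSmoothOn (stereoCurve : SmoothCurve L ℂ → SmoothCurve L Mat2) univ :=
    ((smooth_conformalFactor.clm_comp (map diagL)).add (h1.clm_comp (map offDiagL))).sub
      (frechetSmoothOn_const _ univ)
  exact smooth_const_mul h2 R (adj R)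

theorem smooth_ofCoord (R : SmoothCurve L Mat2) : FrechetSmoothOn (ofCoord R) univ :=
  smooth_sol.comp (smooth_logDeriv R) isOpen_univ (mapsTo_univ _ _)

theorem denom_apply (R X : SmoothCurve L Mat2) {s : ℝ} (hs : s ∈ Icc 0 L) :
    denom R X s = Complex.I / 2 + rotated R X s 0 0 := by
  rw [denom, add_apply, const_apply _ hs, map_apply, entryL_apply]

theorem rotated_apply {R R' X : SmoothCurve L Mat2} (h : IsAnchoredDarboux X R') {s : ℝ}
    (hs : s ∈ Icc 0 L) :
    rotated R X s = (adj R * R') s * pauliA1 * ((adj R * R') s)ᴴ := by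
  rw [rotated, mul_apply, mul_apply, adj_mul_D_eq h hs, mul_apply, adj_apply,
    Matrix.conjTranspose_mul, Matrix.conjTranspose_conjTranspose]
  simp only [mul_assoc]

theorem adj_mul_mem {R R' : SmoothCurve L Mat2} {s : ℝ}
    (h : R s ∈ Matrix.specialUnitaryGroup (Fin 2) ℂ)
    (h' : R' s ∈ Matrix.specialUnitaryGroup (Fin 2) ℂ) :
    (adj R * R') s ∈ Matrix.specialUnitaryGroup (Fin 2) ℂ :=
  mul_mem (conjTranspose_mem h) h'

theorem coord_apply {R X : SmoothCurve L Mat2} (hX : X ∈ coordDomain R) {s : ℝ} (hs : s ∈ Icc 0 L) :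
    coord R X s = rotated R X s 1 0 * (Complex.I / 2 + rotated R X s 0 0)⁻¹ := by
  rw [coord, mul_apply, ringInverse_apply hX hs, denom_apply R X hs, map_apply, entryL_apply]

theorem stereoCurve_coord {c : Prop} {R R' X : SmoothCurve L Mat2} (hR : IsFrame c R)
    (h : IsAnchoredDarboux X R') (hX : X ∈ coordDomain R) :
    stereoCurve (coord R X) = rotated R X :=
  ext fun s hs => by
    have h0 := isUnit_iff.1 hX s hs
    rw [denom_apply R X hs] at h0
    rw [stereoCurve_apply _ hs, coord_apply hX hs]
    rw [rotated_apply h hs] at h0 ⊢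
    exact stereoPoint_of_mem (adj_mul_mem (hR.mem s hs) (h.R_mem s hs)) h0

/-- The coordinate recovers $R^*\Lambda R$, hence $\Lambda$, and $X$ is the only anchored solution
of $X'=X\Lambda$. -/
theorem ofCoord_coord {c : Prop} {R R' X : SmoothCurve L Mat2} (hR : IsFrame c R)
    (h : IsAnchoredDarboux X R') (hX : X ∈ coordDomain R) : ofCoord R (coord R X) = X := by
  have h1 : logDeriv R (coord R X) = adj X * D X := by
    have h2 := mul_adj_self hR.mem
    rw [logDeriv, stereoCurve_coord hR h hX, rotated, ← mul_assoc, ← mul_assoc, h2, one_mul,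
      mul_assoc, h2, mul_one]
  rw [ofCoord, h1, ← eq_sol_of_isAnchoredDarboux h]

theorem rotated_ofCoord {c : Prop} {R : SmoothCurve L Mat2} (hR : IsFrame c R)
    (f : SmoothCurve L ℂ) : rotated R (ofCoord R f) = stereoCurve f := by
  have h2 := adj_mul_self hR.mem
  rw [rotated, adj_mul_D_ofCoord hR, logDeriv, ← mul_assoc, ← mul_assoc, h2, one_mul, mul_assoc, h2,
    mul_one]

theorem stereoPoint_entry (z : ℂ) :
    Complex.I / 2 + stereoPoint z 0 0 = Complex.I * (1 + conj z * z)⁻¹ ∧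
      stereoPoint z 1 0 = Complex.I * ((1 + conj z * z)⁻¹ * z) := by
  constructor
  · simp [stereoPoint, diagL_apply, offDiagL_apply, pauliA1]; ring
  · simp [stereoPoint, diagL_apply, offDiagL_apply, pauliA1]

theorem ofCoord_mem_coordDomain {c : Prop} {R : SmoothCurve L Mat2} (hR : IsFrame c R)
    (f : SmoothCurve L ℂ) : ofCoord R f ∈ coordDomain R :=
  isUnit_iff.2 fun s hs => by
    rw [denom_apply _ _ hs, rotated_ofCoord hR, stereoCurve_apply f hs, (stereoPoint_entry _).1]
    exact mul_ne_zero Complex.I_ne_zero (inv_ne_zero (one_add_normSq_ne_zero _))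

theorem coord_ofCoord {c : Prop} {R : SmoothCurve L Mat2} (hR : IsFrame c R)
    (f : SmoothCurve L ℂ) : coord R (ofCoord R f) = f :=
  ext fun s hs => by
    rw [coord_apply (ofCoord_mem_coordDomain hR f) hs, rotated_ofCoord hR, stereoCurve_apply f hs,
      (stereoPoint_entry _).1, (stereoPoint_entry _).2]
    have h1 := one_add_normSq_ne_zero (f s)
    have h2 := Complex.I_ne_zero
    field_simp

/-- In its own frame $X$ has constant rotated logarithmic derivative $A_1$, antipodal to the centre
of projection. Hence the charts cover. -/
theorem mem_coordDomain_self {X R : SmoothCurve L Mat2} (h : IsAnchoredDarboux X R) :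
    X ∈ coordDomain R :=
  isUnit_iff.2 fun s hs => by
    rw [denom_apply _ _ hs, rotated_apply h hs, adj_mul_self h.R_mem, one_apply hs]
    have h1 : Complex.I / 2 + ((1 : Mat2) * pauliA1 * (1 : Mat2)ᴴ) 0 0 = Complex.I := by
      simp [pauliA1]
      ring
    rw [h1]
    exact Complex.I_ne_zero

theorem coord_mem_modelSpace {c : Prop} {R R' X : SmoothCurve L Mat2} (hR : IsFrame c R)
    (h : IsAnchoredDarboux X R') (h' : c → IsSmoothlyClosed R') (hX : X ∈ coordDomain R) :
    coord R X ∈ modelSpace L c := by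
  refine mem_modelSpace.2 ⟨?_, fun hc => ?_⟩
  · rw [coord_apply hX mem_zero, rotated_apply h mem_zero, mul_apply, adj_apply, hR.zero, h.R_zero]
    simp [pauliA1]
  · obtain ⟨Q₁, h1, h2, h3⟩ := hR.closed hc
    obtain ⟨Q₂, k1, k2, k3⟩ := h' hc
    let G : ℝ → Mat2 := fun t => conjTransposeL (Q₁ t) * Q₂ t
    let N : ℝ → Mat2 := fun t => G t * pauliA1 * conjTransposeL (G t)
    have hG : ContDiff ℝ ∞ G := (conjTransposeL.contDiff.comp h1).mul k1
    have hN : ContDiff ℝ ∞ N := (hG.mul contDiff_const).mul (conjTransposeL.contDiff.comp hG)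
    have hGp : Function.Periodic G L := fun t => by simp only [G, h2 t, k2 t]
    have hNp : Function.Periodic N L := fun t => by simp only [N, hGp t]
    have hNs : ∀ s ∈ Icc 0 L, N s = rotated R X s := fun s hs => by
      rw [rotated_apply h hs]
      simp only [N, G, h3 s hs, k3 s hs]
      rfl
    -- Invertibility on $[0,L]$ is known; periodicity of $N$ carries it to the whole line, so the
    -- quotient is a smooth periodic extension.
    have hne : ∀ t, Complex.I / 2 + entryL 0 0 (N t) ≠ 0 := fun t => by
      obtain ⟨s, hs, hst⟩ := hNp.exists_mem_Ico₀ hL.out t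
      have hs' : s ∈ Icc 0 L := Ico_subset_Icc_self hs
      have h0 := isUnit_iff.1 hX s hs'
      rwa [denom_apply R X hs', ← hNs s hs', ← hst] at h0
    refine ⟨fun t => entryL 1 0 (N t) * (Complex.I / 2 + entryL 0 0 (N t))⁻¹,
      ((entryL 1 0).contDiff.comp hN).mul
        ((contDiff_const.add ((entryL 0 0).contDiff.comp hN)).inv hne),
      fun t => by simp only [hNp t], fun s hs => ?_⟩
    rw [coord_apply hX hs, ← hNs s hs]
    rfl

end SmoothCurve

end

noncomputable section

namespace SmoothCurve

variable {L : ℝ} [hL : Fact (0 < L)]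

/-! ### The manifold of horizontal curves -/

variable (L) in
/-- The curves `X` with an anchored Darboux pair `(X, R)`, where `R` is smoothly closed if `c`
holds. -/
def horiz (c : Prop) : Set (SmoothCurve L Mat2) :=
  {X | ∃ R, IsAnchoredDarboux X R ∧ (c → IsSmoothlyClosed R)}

theorem coord_mem {c : Prop} {R X : SmoothCurve L Mat2} (hR : IsFrame c R) (hX : X ∈ horiz L c)
    (h : X ∈ coordDomain R) : coord R X ∈ modelSpace L c := by
  obtain ⟨R', h1, h2⟩ := hX
  exact coord_mem_modelSpace hR h1 h2 h

theorem ofCoord_coord_of_mem {c : Prop} {R X : SmoothCurve L Mat2} (hR : IsFrame c R)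
    (hX : X ∈ horiz L c) (h : X ∈ coordDomain R) : ofCoord R (coord R X) = X := by
  obtain ⟨R', h1, -⟩ := hX
  exact ofCoord_coord hR h1 h

theorem ofCoord_mem_horiz {c : Prop} {R : SmoothCurve L Mat2} (hR : IsFrame c R)
    {f : SmoothCurve L ℂ} (hf : f ∈ modelSpace L c) : ofCoord R f ∈ horiz L c :=
  ⟨R * frameCurve f, isAnchoredDarboux_ofCoord hR hf, (hR.mul_frameCurve hf).closed⟩

theorem exists_frame {c : Prop} {X : SmoothCurve L Mat2} (hX : X ∈ horiz L c) :
    ∃ R, IsFrame c R ∧ X ∈ coordDomain R := by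
  obtain ⟨R, h1, h2⟩ := hX
  exact ⟨R, ⟨h1.R_mem, h1.R_zero, h2⟩, mem_coordDomain_self h1⟩

open Classical in
/-- The stereographic coordinate as a map into the model space. -/
def coordModel (c : Prop) (R X : SmoothCurve L Mat2) : modelSpace L c :=
  if h : coord R X ∈ modelSpace L c then ⟨coord R X, h⟩ else 0

theorem coe_coordModel {c : Prop} {R X : SmoothCurve L Mat2} (hR : IsFrame c R)
    (hX : X ∈ horiz L c) (h : X ∈ coordDomain R) : (coordModel c R X : SmoothCurve L ℂ) = coord R X := by
  rw [coordModel, dif_pos (coord_mem hR hX h)]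

/-- The coordinate is smooth on an open set of the ambient space, so coordinate changes and the
lifting property of the induced structure are both instances of this. -/
theorem smooth_coordModel {c : Prop} {R : SmoothCurve L Mat2} (hR : IsFrame c R)
    {G : Type} [AddCommGroup G] [Module ℝ G] [TopologicalSpace G] [IsTopologicalAddGroup G]
    [ContinuousSMul ℝ G] {W : Set G} (hW : IsOpen W) {g : G → SmoothCurve L Mat2}
    (hg : FrechetSmoothOn g W) (h : ∀ y ∈ W, g y ∈ horiz L c ∧ g y ∈ coordDomain R) :
    FrechetSmoothOn (fun y => coordModel c R (g y)) W := by
  refine FrechetSmoothOn.codRestrict (isClosed_modelSpace c) hW ?_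
  exact ((smooth_coord R).comp hg (isOpen_coordDomain R) fun y hy => (h y hy).2).congr hW
    fun y hy => (coe_coordModel hR (h y hy).1 (h y hy).2).symm

theorem smooth_ofCoord_model (c : Prop) (R : SmoothCurve L Mat2) :
    FrechetSmoothOn (fun f : modelSpace L c => ofCoord R f) univ :=
  (smooth_ofCoord R).comp_clm (modelSpace L c).subtypeL

/-- The stereographic chart of a frame. -/
def chart {c : Prop} (R : SmoothCurve L Mat2) (hR : IsFrame c R) :
    OpenPartialHomeomorph (horiz L c) (modelSpace L c) where
  toFun X := coordModel c R X
  invFun f := ⟨ofCoord R f, ofCoord_mem_horiz hR f.2⟩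
  source := {X | X.1 ∈ coordDomain R}
  target := univ
  map_source' _ _ := trivial
  map_target' f _ := ofCoord_mem_coordDomain hR f.1
  left_inv' X hX := Subtype.ext <|
    (congrArg (ofCoord R) (coe_coordModel hR X.2 hX)).trans (ofCoord_coord_of_mem hR X.2 hX)
  right_inv' f _ := Subtype.ext <| by
    rw [coe_coordModel hR (ofCoord_mem_horiz hR f.2) (ofCoord_mem_coordDomain hR f.1),
      coord_ofCoord hR]
  open_source := (isOpen_coordDomain R).preimage continuous_subtype_val
  open_target := isOpen_univ
  continuousOn_toFun := by
    refine IsInducing.subtypeVal.continuousOn_iff.2 ?_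
    refine ((smooth_coord R).continuousOn.comp continuous_subtype_val.continuousOn
      fun _ hX => hX).congr fun X hX => coe_coordModel hR X.2 hX
  continuousOn_invFun :=
    IsInducing.subtypeVal.continuousOn_iff.2 (smooth_ofCoord_model c R).continuousOn

instance (c : Prop) : ChartedSpace (modelSpace L c) (horiz L c) where
  atlas := {e | ∃ (R : SmoothCurve L Mat2) (hR : IsFrame c R), e = chart R hR}
  chartAt X := chart (exists_frame X.2).choose (exists_frame X.2).choose_spec.1
  mem_chart_source X := (exists_frame X.2).choose_spec.2
  chart_mem_atlas _ := ⟨_, _, rfl⟩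

theorem isFrechetSubmanifold_horiz (c : Prop) :
    IsFrechetSubmanifold (modelSpace L c) (horiz L c) where
  model := isFrechetSpace_submodule (isClosed_modelSpace c)
  t2 := inferInstance
  smooth_change := by
    rintro e ⟨R, hR, rfl⟩ e' ⟨R', hR', rfl⟩
    exact smooth_coordModel hR' ((chart R hR).symm.trans (chart R' hR')).open_source
      ((smooth_ofCoord_model c R).mono (subset_univ _))
      fun y hy => ⟨ofCoord_mem_horiz hR y.2, hy.2⟩
  smooth_inclusion := by
    rintro e ⟨R, hR, rfl⟩
    exact smooth_ofCoord_model c R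
  smooth_lift := by
    rintro e ⟨R, hR, rfl⟩ G _ _ _ _ W g hW hgW hg
    have := IsFrechetSpace.isTopologicalAddGroup G
    have := IsFrechetSpace.continuousSMul G
    exact smooth_coordModel hR hW hg fun y hy => ⟨(g y).2, hgW hy⟩

theorem horizDarboux_eq : horizDarboux L = horiz L False :=
  Set.ext fun _ => ⟨fun ⟨R, h⟩ => ⟨R, h, False.elim⟩, fun ⟨R, h, _⟩ => ⟨R, h⟩⟩

theorem horizPeriodicDarboux_eq : horizPeriodicDarboux L = horiz L True :=
  Set.ext fun _ => ⟨fun ⟨R, h, h'⟩ => ⟨R, h, fun _ => h'⟩, fun ⟨R, h, h'⟩ => ⟨R, h, h' trivial⟩⟩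

end SmoothCurve

end

noncomputable section

namespace SmoothCurve

open ComplexConjugate

variable {L : ℝ} [hL : Fact (0 < L)]

/-! ### The derivative of the parametrization -/

/-- The derivative of `conformalFactor` at `f` in the direction `h`. -/
def conformalFactorDeriv (f h : SmoothCurve L ℂ) : SmoothCurve L ℂ :=
  -(conformalFactor f * (map conjL h * f + map conjL f * h) * conformalFactor f)

theorem hasDirDerivAt_conformalFactor (f h : SmoothCurve L ℂ) :
    HasDirDerivAt conformalFactor (conformalFactorDeriv f h) f h := by
  have h1 : HasDirDerivAt (fun y : SmoothCurve L ℂ => map conjL y) (map conjL h) f h :=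
    (hasDirDerivAt_id f h).clm_comp (map conjL)
  have h2 := (hasDirDerivAt_const (1 : SmoothCurve L ℂ) f h).add
    (h1.mul (hasDirDerivAt_id f h))
  rw [zero_add] at h2
  have h3 := smooth_ringInverse.continuousOn.continuousAt (isOpen_isUnit.mem_nhds (isUnit_one_add f))
  exact h2.ringInverse (isUnit_one_add f) isOpen_isUnit h3

/-- The derivative of `stereoCurve` at `f` in the direction `h`. -/
def stereoDeriv (f h : SmoothCurve L ℂ) : SmoothCurve L Mat2 :=
  map diagL (conformalFactorDeriv f h) +
    map offDiagL (conformalFactorDeriv f h * f + conformalFactor f * h)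

theorem hasDirDerivAt_logDeriv (R : SmoothCurve L Mat2) (f h : SmoothCurve L ℂ) :
    HasDirDerivAt (logDeriv R) (R * stereoDeriv f h * adj R) f h := by
  have h1 := hasDirDerivAt_conformalFactor f h
  have h2 := ((h1.clm_comp (map diagL)).add
    ((h1.mul (hasDirDerivAt_id f h)).clm_comp (map offDiagL))).add
      (hasDirDerivAt_const (-const L pauliA1) f h)
  rw [add_zero] at h2
  have h3 := ((hasDirDerivAt_const R f h).mul h2).mul (hasDirDerivAt_const (adj R) f h)
  simp only [zero_mul, zero_add, mul_zero, add_zero] at h3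
  have h4 : logDeriv R = fun y => R * (map diagL (conformalFactor y) +
      map offDiagL (conformalFactor y * y) + -const L pauliA1) * adj R := by
    funext y
    rw [logDeriv, stereoCurve, sub_eq_add_neg]
  rw [h4]
  exact h3

/-- The derivative of `ofCoord R` at `f` in the direction `h`. -/
def ofCoordDeriv (R : SmoothCurve L Mat2) (f h : SmoothCurve L ℂ) : SmoothCurve L Mat2 :=
  J (ofCoord R f * (R * stereoDeriv f h * adj R) * adj (ofCoord R f)) * ofCoord R f

theorem hasDirDerivAt_ofCoord (R : SmoothCurve L Mat2) (f h : SmoothCurve L ℂ) :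
    HasDirDerivAt (ofCoord R) (ofCoordDeriv R f h) f h := by
  have h1 := smooth_sol.hasDirDerivAt_comp isOpen_univ (mem_univ _) (hasDirDerivAt_logDeriv R f h)
  rwa [(hasDirDerivAt_sol_adj (adj_logDeriv R f) _).dirDeriv_eq] at h1

theorem dirDeriv_ofCoord_model {c : Prop} (R : SmoothCurve L Mat2) (f h : modelSpace L c) :
    dirDeriv (fun y : modelSpace L c => ofCoord R y) f h = ofCoordDeriv R f h :=
  ((hasDirDerivAt_ofCoord R f h).comp_clm (modelSpace L c).subtypeL).dirDeriv_eq

/-! ### The symplectic form in stereographic coordinates -/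

/-- With $V=X^*J(XUX^*)X$ one finds $V'=U+V\Lambda-\Lambda V$. Under the convention $[A,B]=BA-AB$
the last two terms are $[\Lambda,V]$, so $V'-[\Lambda,V]=U$. -/
theorem darbouxU_eq {X Λ U : SmoothCurve L Mat2} (h1 : adj X * X = 1) (h2 : D X = X * Λ)
    (h3 : adj Λ = -Λ) {s : ℝ} (hs : s ∈ Icc 0 L) :
    darbouxU X (J (X * U * adj X) * X) s = U s := by
  have e1 : D (adj X * (J (X * U * adj X) * X)) =
      U + (adj X * (J (X * U * adj X) * X) * Λ - Λ * (adj X * (J (X * U * adj X) * X))) := by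
    rw [D_mul, D_mul, D_J, D_adj, h2, adj_mul, h3]
    have e2 : adj X * (X * U * adj X * X) = U := by
      rw [mul_assoc _ (adj X), h1, mul_one, ← mul_assoc, h1, one_mul]
    rw [mul_add, e2]
    noncomm_ring
  have e3 : darbouxLambda X s = Λ s := by
    have : adj X * D X = Λ := by rw [h2, ← mul_assoc, h1, one_mul]
    rw [← this, mul_apply, D_apply X hs]
    rfl
  have e4 : derivWithin (leftTranslate X (J (X * U * adj X) * X)) (Icc 0 L) s =
      D (adj X * (J (X * U * adj X) * X)) s :=
    (D_apply (adj X * (J (X * U * adj X) * X)) hs).symm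
  rw [darbouxU, e4, e1, e3]
  exact add_sub_cancel_right (U s) _

/-- Invariance under conjugation removes the frame, so the form has the same expression in all
charts. -/
theorem traceForm_conj {g : Mat2} (hg : g ∈ Matrix.specialUnitaryGroup (Fin 2) ℂ) (A B C : Mat2) :
    traceForm (g * A * gᴴ) (su2Bracket (g * B * gᴴ) (g * C * gᴴ)) =
      traceForm A (su2Bracket B C) := by
  have h : gᴴ * g = 1 := conjTranspose_mul_self_of_mem hg
  have h1 : ∀ P Q : Mat2, g * P * gᴴ * (g * Q * gᴴ) = g * (P * Q) * gᴴ := fun P Q => by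
    rw [mul_assoc (g * P), ← mul_assoc gᴴ, ← mul_assoc gᴴ, h, one_mul]
    simp only [mul_assoc]
  have h2 : ∀ P : Mat2, (g * P * gᴴ).trace = P.trace := fun P => by
    rw [Matrix.trace_mul_comm, ← mul_assoc, h, one_mul]
  rw [su2Bracket, h1, h1, ← sub_mul, ← mul_sub, traceForm, h1, h2, traceForm, su2Bracket]

/-- The trace is a multiple of the determinant with rows $(a,b',b)$, $(u,v',v)$, $(x,y',y)$. Primed
letters later become conjugates; keeping them independent makes this a polynomial identity. -/
theorem trace_triple (a b b' x y y' u v v' : ℂ) :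
    (!![Complex.I * a, Complex.I * b'; Complex.I * b, -(Complex.I * a)] *
      (!![Complex.I * u, Complex.I * v'; Complex.I * v, -(Complex.I * u)] *
        !![Complex.I * x, Complex.I * y'; Complex.I * y, -(Complex.I * x)] -
      !![Complex.I * x, Complex.I * y'; Complex.I * y, -(Complex.I * x)] *
        !![Complex.I * u, Complex.I * v'; Complex.I * v, -(Complex.I * u)]) : Mat2).trace =
    -2 * Complex.I * (a * (v' * y - y' * v) + b' * (v * x - u * y) + b * (u * y' - v' * x)) := by
  have hI : Complex.I ^ 3 = -Complex.I := by rw [pow_succ, Complex.I_sq]; ring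
  simp [Matrix.trace_fin_two]
  ring_nf
  rw [hI]
  ring

theorem conj_conformal (z : ℂ) : conj (1 + conj z * z)⁻¹ = (1 + conj z * z)⁻¹ := by
  rw [map_inv₀, map_add, map_mul, map_one, Complex.conj_conj, mul_comm]

/-- The triple product of a point of the sphere with two tangent vectors there is a multiple of the
area form, and the right side is that form in stereographic coordinates. The arguments of the
bracket are the images of $h$ and $k$ under the derivative of `stereoPoint`. -/
theorem traceForm_stereoPoint (z h k : ℂ) :
    traceForm (stereoPoint z)
      (su2Bracket
        (diagL (-((1 + conj z * z)⁻¹ * (conj h * z + conj z * h) * (1 + conj z * z)⁻¹)) +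
          offDiagL (-((1 + conj z * z)⁻¹ * (conj h * z + conj z * h) * (1 + conj z * z)⁻¹) * z +
            (1 + conj z * z)⁻¹ * h))
        (diagL (-((1 + conj z * z)⁻¹ * (conj k * z + conj z * k) * (1 + conj z * z)⁻¹)) +
          offDiagL (-((1 + conj z * z)⁻¹ * (conj k * z + conj z * k) * (1 + conj z * z)⁻¹) * z +
            (1 + conj z * z)⁻¹ * k))) =
      4 * (conj h * k * ((1 + conj z * z)⁻¹ * (1 + conj z * z)⁻¹)).im := by
  have hn := one_add_normSq_ne_zero z
  have hq := conj_conformal z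
  have hA : ∀ a b : ℂ, diagL a + offDiagL b =
      !![Complex.I * a, Complex.I * conj b; Complex.I * b, -(Complex.I * a)] := fun a b => by
    rw [diagL_apply, offDiagL_apply]
    ext i j
    fin_cases i <;> fin_cases j <;> simp
  have hP : stereoPoint z = !![Complex.I * ((1 + conj z * z)⁻¹ - 1 / 2),
      Complex.I * ((1 + conj z * z)⁻¹ * conj z); Complex.I * ((1 + conj z * z)⁻¹ * z),
      -(Complex.I * ((1 + conj z * z)⁻¹ - 1 / 2))] := by
    rw [stereoPoint, hA, map_mul, hq, pauliA1]
    ext i j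
    fin_cases i <;> fin_cases j <;> simp <;> ring
  -- Replacing the imaginary part by $w-\bar w$ leaves a rational identity in $z,h,k$ and their
  -- conjugates.
  have him : ∀ w : ℂ, (4 * (w.im : ℂ)) = -2 * Complex.I * (w - conj w) := fun w => by
    rw [Complex.sub_conj]
    push_cast
    linear_combination (4 * (w.im : ℂ)) * Complex.I_sq
  rw [hP, hA, hA, su2Bracket, traceForm, trace_triple]
  have key : ∀ w : ℂ, w = 4 * ((conj h * k * ((1 + conj z * z)⁻¹ * (1 + conj z * z)⁻¹)).im : ℂ) →
      w.re = 4 * (conj h * k * ((1 + conj z * z)⁻¹ * (1 + conj z * z)⁻¹)).im := fun w hw => by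
    rw [hw]
    norm_cast
  refine key _ ?_
  rw [him]
  simp only [map_add, map_mul, map_neg, hq, Complex.conj_conj]
  field_simp
  ring

end SmoothCurve

end

/-! ### The integrated area form, tangent spaces, and the symplectic properties. -/

noncomputable section

namespace SmoothCurve

open ComplexConjugate

variable {L : ℝ} [hL : Fact (0 < L)]

/-- The linear functional `F ↦ -4 ∫ Im F`. -/
def areaL : SmoothCurve L ℂ →L[ℝ] ℝ :=
  (-4 : ℝ) • (evalL L).comp (JL.comp (map Complex.imCLM))

theorem areaL_apply (F : SmoothCurve L ℂ) : areaL F = -4 * ∫ s in (0 : ℝ)..L, (F s).im :=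
  congrArg (-4 * ·) (J_apply_end (map Complex.imCLM F))

theorem areaL_eq_zero {F : SmoothCurve L ℂ} (h : ∀ s ∈ Icc 0 L, (F s).im = 0) : areaL F = 0 := by
  have h1 : map Complex.imCLM F = 0 := ext h
  change -4 * J (map Complex.imCLM F) L = 0
  rw [J_apply_end, h1]
  simp

/-- The integrand of the symplectic form in stereographic coordinates. -/
def areaDensity (f h k : SmoothCurve L ℂ) : SmoothCurve L ℂ :=
  map conjL h * k * (conformalFactor f * conformalFactor f)

theorem areaDensity_apply (f h k : SmoothCurve L ℂ) {s : ℝ} (hs : s ∈ Icc 0 L) :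
    areaDensity f h k s =
      conj (h s) * k s * ((1 + conj (f s) * f s)⁻¹ * (1 + conj (f s) * f s)⁻¹) := by
  rw [areaDensity, mul_apply, mul_apply, mul_apply, conformalFactor_apply f hs]
  rfl

/-- The symplectic form in stereographic coordinates. -/
def areaForm (f h k : SmoothCurve L ℂ) : ℝ := areaL (areaDensity f h k)

theorem areaForm_add_left (f h h' k : SmoothCurve L ℂ) :
    areaForm f (h + h') k = areaForm f h k + areaForm f h' k := by
  rw [areaForm, areaDensity, map_add, add_mul, add_mul, map_add]
  rfl

theorem areaForm_smul_left (f : SmoothCurve L ℂ) (a : ℝ) (h k : SmoothCurve L ℂ) :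
    areaForm f (a • h) k = a * areaForm f h k := by
  rw [areaForm, areaDensity, map_smul, smul_mul_assoc, smul_mul_assoc, map_smul]
  rfl

theorem conformal_eq_ofReal (z : ℂ) :
    (1 + conj z * z)⁻¹ = (((1 + Complex.normSq z)⁻¹ : ℝ) : ℂ) := by
  rw [← Complex.normSq_eq_conj_mul_self]
  push_cast
  rfl

theorem areaForm_skew (f h k : SmoothCurve L ℂ) : areaForm f h k = -areaForm f k h := by
  rw [eq_neg_iff_add_eq_zero, areaForm, areaForm, ← map_add]
  refine areaL_eq_zero fun s hs => ?_
  rw [add_apply, areaDensity_apply f h k hs, areaDensity_apply f k h hs, conformal_eq_ofReal]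
  simp
  ring

/-- Since $\operatorname{Im}(\bar h\cdot ih)=|h|^2$, the integrand is continuous and non-negative,
and positive wherever $h\ne0$. -/
theorem eq_zero_of_areaForm {f h : SmoothCurve L ℂ}
    (h0 : areaForm f h (map (Complex.I • ContinuousLinearMap.id ℝ ℂ) h) = 0) : h = 0 := by
  rw [areaForm, areaL_apply] at h0
  have h1 : ∀ s ∈ Icc 0 L, (areaDensity f h (map (Complex.I • ContinuousLinearMap.id ℝ ℂ) h) s).im =
      Complex.normSq (h s) * ((1 + Complex.normSq (f s))⁻¹ * (1 + Complex.normSq (f s))⁻¹) := by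
    intro s hs
    rw [areaDensity_apply _ _ _ hs, conformal_eq_ofReal, map_apply]
    simp [Complex.normSq_apply]
  have h2 : ∀ s, 0 < (1 + Complex.normSq (f s))⁻¹ * (1 + Complex.normSq (f s))⁻¹ := fun s => by
    have := Complex.normSq_nonneg (f s)
    positivity
  refine ext fun s hs => ?_
  by_contra hne
  have h3 := intervalIntegral.integral_pos hL.out
    (map Complex.imCLM (areaDensity f h
      (map (Complex.I • ContinuousLinearMap.id ℝ ℂ) h))).contDiffOn.continuousOn
    (fun t ht => (mul_nonneg (Complex.normSq_nonneg _) (h2 t).le).trans_eq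
      (h1 t (Ioc_subset_Icc_self ht)).symm)
    ⟨s, hs, (mul_pos (Complex.normSq_pos.2 hne) (h2 s)).trans_eq (h1 s hs).symm⟩
  have h4 : (0 : ℝ) < ∫ t in (0 : ℝ)..L, (areaDensity f h
    (map (Complex.I • ContinuousLinearMap.id ℝ ℂ) h) t).im := h3
  linarith

theorem map_mem_modelSpace {c : Prop} (T : NormedLin ℂ ℂ) {h : SmoothCurve L ℂ}
    (hh : h ∈ modelSpace L c) : map T h ∈ modelSpace L c := by
  obtain ⟨h1, h2⟩ := mem_modelSpace.1 hh
  refine mem_modelSpace.2 ⟨by rw [map_apply, h1, map_zero], fun hc => ?_⟩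
  obtain ⟨Q, k1, k2, k3⟩ := h2 hc
  exact ⟨fun t => T (Q t), T.contDiff.comp k1, fun t => congrArg T (k2 t),
    fun s hs => congrArg T (k3 s hs)⟩

/-- Here $\Lambda$ and the two $U_i$ are the conjugates by $R$ of the point on the sphere and of its
two variations, so the integrand is the area form at each $s$. -/
theorem darbouxForm_ofCoord {c : Prop} {R : SmoothCurve L Mat2} (hR : IsFrame c R)
    (f h k : SmoothCurve L ℂ) :
    darbouxForm (ofCoord R f) (ofCoordDeriv R f h) (ofCoordDeriv R f k) = areaForm f h k := by
  have h1 : adj (ofCoord R f) * ofCoord R f = 1 := adj_mul_self fun _ hs => ofCoord_mem hR f hs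
  have h2 : D (ofCoord R f) = ofCoord R f * logDeriv R f := D_sol _
  have hU : ∀ k, ∀ s ∈ Icc 0 L, darbouxU (ofCoord R f) (ofCoordDeriv R f k) s =
      R s * stereoDeriv f k s * (R s)ᴴ := fun k s hs =>
    darbouxU_eq h1 h2 (adj_logDeriv R f) hs
  have hΛ : ∀ s ∈ Icc 0 L, darbouxLambda (ofCoord R f) s = R s * stereoCurve f s * (R s)ᴴ := by
    intro s hs
    have e1 : darbouxLambda (ofCoord R f) s = (adj (ofCoord R f) * D (ofCoord R f)) s := by
      rw [mul_apply, D_apply _ hs]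
      rfl
    rw [e1, adj_mul_D_ofCoord hR]
    rfl
  -- The right side is left to unification: the rewriting ends in the pointwise expression occurring
  -- in `traceForm_stereoPoint`.
  have hD : ∀ k, ∀ s ∈ Icc 0 L, stereoDeriv f k s = _ := fun k s hs => by
    rw [stereoDeriv, conformalFactorDeriv, add_apply, map_apply, map_apply, add_apply, mul_apply,
      neg_apply, mul_apply, mul_apply, mul_apply, add_apply, mul_apply, mul_apply, map_apply,
      map_apply, conformalFactor_apply f hs, conjL_apply, conjL_apply]
  rw [areaForm, areaL_apply, darbouxForm, neg_mul, ← intervalIntegral.integral_const_mul]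
  refine congrArg Neg.neg (intervalIntegral.integral_congr fun s hs => ?_)
  rw [uIcc_of_le hL.out.le] at hs
  rw [hU h s hs, hU k s hs, hΛ s hs, traceForm_conj (hR.mem s hs), stereoCurve_apply f hs,
    hD h s hs, hD k s hs, areaDensity_apply f h k hs, traceForm_stereoPoint]

theorem chartForm_chart {c : Prop} {R : SmoothCurve L Mat2} (hR : IsFrame c R)
    (f h k : modelSpace L c) : chartForm darbouxForm (chart R hR) f h k = areaForm f.1 h.1 k.1 := by
  have e := dirDeriv_ofCoord_model (c := c) R f
  rw [← darbouxForm_ofCoord hR, ← e h, ← e k]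
  rfl

/-! ### Tangent vectors -/

theorem ofCoordDeriv_add (R : SmoothCurve L Mat2) (f h k : SmoothCurve L ℂ) :
    ofCoordDeriv R f (h + k) = ofCoordDeriv R f h + ofCoordDeriv R f k := by
  have := ((smooth_ofCoord R).derivLinear isOpen_univ (mem_univ f)).map_add h k
  simpa only [FrechetSmoothOn.derivLinear, LinearMap.coe_mk, AddHom.coe_mk,
    (hasDirDerivAt_ofCoord R f _).dirDeriv_eq] using this

theorem ofCoordDeriv_smul (R : SmoothCurve L Mat2) (f : SmoothCurve L ℂ) (a : ℝ)
    (h : SmoothCurve L ℂ) : ofCoordDeriv R f (a • h) = a • ofCoordDeriv R f h :=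
  (hasDirDerivAt_ofCoord R f _).unique ((hasDirDerivAt_ofCoord R f h).smul_dir a)

/-- The derivative of the parametrization as a linear map on the model space. -/
def tangentMap (c : Prop) (R : SmoothCurve L Mat2) (f : SmoothCurve L ℂ) :
    modelSpace L c →ₗ[ℝ] SmoothCurve L Mat2 where
  toFun h := ofCoordDeriv R f h
  map_add' h k := ofCoordDeriv_add R f h k
  map_smul' a h := ofCoordDeriv_smul R f a h

/-- A curve in the set agrees near $t=0$ with the image of its coordinate, and the chain rule
applies. Conversely the line $f+th$ stays in the model space, which is the whole target of the
chart. -/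
theorem tangentVectors_horiz {c : Prop} {R : SmoothCurve L Mat2} (hR : IsFrame c R)
    {f : SmoothCurve L ℂ} (hf : f ∈ modelSpace L c) :
    tangentVectors (horiz L c) (ofCoord R f) = LinearMap.range (tangentMap c R f) := by
  ext v
  constructor
  · rintro ⟨σ, hσ, hmem, h0, hv⟩
    have hW : IsOpen (σ ⁻¹' coordDomain R) :=
      (isOpen_coordDomain R).preimage (continuousOn_univ.1 hσ.continuousOn)
    have h0W : (0 : ℝ) ∈ σ ⁻¹' coordDomain R := by
      rw [mem_preimage, h0]
      exact ofCoord_mem_coordDomain hR f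
    have h1 : FrechetSmoothOn (fun t => coordModel c R (σ t)) (σ ⁻¹' coordDomain R) :=
      smooth_coordModel hR hW (hσ.mono (subset_univ _)) fun t ht => ⟨hmem t, ht⟩
    have h2 := (h1.hasDirDerivAt h0W 1).clm_comp (modelSpace L c).subtypeL
    have h3 := (smooth_ofCoord R).hasDirDerivAt_comp isOpen_univ (mem_univ _) h2
    have h4 : HasDirDerivAt σ _ 0 1 := h3.congr hW h0W fun t ht =>
      (congrArg (ofCoord R) (coe_coordModel hR (hmem t) ht)).trans
        (ofCoord_coord_of_mem hR (hmem t) ht)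
    rw [hv.unique h4, (hasDirDerivAt_ofCoord R _ _).dirDeriv_eq]
    have h5 : (coordModel c R (σ 0) : SmoothCurve L ℂ) = f := by
      rw [coe_coordModel hR (hmem 0) h0W, h0, coord_ofCoord hR]
    refine ⟨_, congrArg (ofCoordDeriv R · _) h5.symm⟩
  · rintro ⟨h, rfl⟩
    have h1 : FrechetSmoothOn (fun t : ℝ => f + t • (h : SmoothCurve L ℂ)) univ :=
      (frechetSmoothOn_const f univ).add (frechetSmoothOn_clm
        ((ContinuousLinearMap.id ℝ ℝ).smulRight (h : SmoothCurve L ℂ)) univ)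
    have h2 : HasDirDerivAt (fun t : ℝ => f + t • (h : SmoothCurve L ℂ)) h 0 1 := by
      have := (hasDirDerivAt_const f (0 : ℝ) 1).add ((hasDirDerivAt_id (0 : ℝ) 1).clm_comp
        ((ContinuousLinearMap.id ℝ ℝ).smulRight (h : SmoothCurve L ℂ)))
      simpa using this
    refine ⟨fun t => ofCoord R (f + t • (h : SmoothCurve L ℂ)),
      (smooth_ofCoord R).comp h1 isOpen_univ (mapsTo_univ _ _),
      fun t => ofCoord_mem_horiz hR (add_mem hf (Submodule.smul_mem _ _ h.2)), by simp, ?_⟩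
    have h3 := (smooth_ofCoord R).hasDirDerivAt_comp isOpen_univ (mem_univ _) h2
    rw [(hasDirDerivAt_ofCoord R _ _).dirDeriv_eq] at h3
    simp only [zero_smul, add_zero] at h3
    exact h3

/-! ### Smoothness and closedness of the form -/

theorem smooth_areaForm (c : Prop) :
    FrechetSmoothOn (fun p : modelSpace L c × modelSpace L c × modelSpace L c =>
      areaForm p.1.1 p.2.1.1 p.2.2.1) univ := by
  let V := modelSpace L c
  have h1 : FrechetSmoothOn (fun p : V × V × V => (p.1 : SmoothCurve L ℂ)) univ :=
    frechetSmoothOn_clm (V.subtypeL.comp (ContinuousLinearMap.fst ℝ V (V × V))) univ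
  have h2 : FrechetSmoothOn (fun p : V × V × V => map conjL (p.2.1 : SmoothCurve L ℂ)) univ :=
    frechetSmoothOn_clm ((map conjL).comp (V.subtypeL.comp ((ContinuousLinearMap.fst ℝ V V).comp
      (ContinuousLinearMap.snd ℝ V (V × V))))) univ
  have h3 : FrechetSmoothOn (fun p : V × V × V => (p.2.2 : SmoothCurve L ℂ)) univ :=
    frechetSmoothOn_clm (V.subtypeL.comp ((ContinuousLinearMap.snd ℝ V V).comp
      (ContinuousLinearMap.snd ℝ V (V × V)))) univ
  have h4 : FrechetSmoothOn (fun p : V × V × V => conformalFactor (p.1 : SmoothCurve L ℂ)) univ :=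
    smooth_conformalFactor.comp h1 isOpen_univ (mapsTo_univ _ _)
  exact ((h2.mul h3).mul (h4.mul h4)).clm_comp areaL

theorem dirDeriv_areaForm {c : Prop} {ξ η : modelSpace L c → modelSpace L c}
    {ξ' η' x v : modelSpace L c} (hξ : HasDirDerivAt ξ ξ' x v) (hη : HasDirDerivAt η η' x v) :
    dirDeriv (fun y => areaForm y.1 (ξ y).1 (η y).1) x v =
      areaL ((map conjL ξ'.1 * (η x).1 + map conjL (ξ x).1 * η'.1) *
          (conformalFactor x.1 * conformalFactor x.1) +
        map conjL (ξ x).1 * (η x).1 * (conformalFactorDeriv x.1 v.1 * conformalFactor x.1 +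
          conformalFactor x.1 * conformalFactorDeriv x.1 v.1)) := by
  have h1 : HasDirDerivAt (fun y => map conjL (ξ y).1) (map conjL ξ'.1) x v :=
    hξ.clm_comp ((map conjL).comp (modelSpace L c).subtypeL)
  have h2 : HasDirDerivAt (fun y => (η y).1) η'.1 x v := hη.clm_comp (modelSpace L c).subtypeL
  have h3 : HasDirDerivAt (fun y : modelSpace L c => conformalFactor y.1)
      (conformalFactorDeriv x.1 v.1) x v :=
    (hasDirDerivAt_conformalFactor x.1 v.1).comp_clm (modelSpace L c).subtypeL
  exact (((h1.mul h2).mul (h3.mul h3)).clm_comp areaL).dirDeriv_eq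

/-- Derivatives of the vector fields cancel against the brackets. What remains comes from the factor
$(1+|f|^2)^{-2}$ and vanishes at each $s$ because $\operatorname{Im}(\bar
v_2v_3)v_1-\operatorname{Im}(\bar v_1v_3)v_2+\operatorname{Im}(\bar v_1v_2)v_3=0$ for vectors of the
plane. -/
theorem extDeriv_areaForm {c : Prop} {W : Set (modelSpace L c)}
    {ξ₁ ξ₂ ξ₃ : modelSpace L c → modelSpace L c} (h₁ : FrechetSmoothOn ξ₁ W)
    (h₂ : FrechetSmoothOn ξ₂ W) (h₃ : FrechetSmoothOn ξ₃ W) {x : modelSpace L c} (hx : x ∈ W) :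
    extDerivTwoForm (fun f h k : modelSpace L c => areaForm f.1 h.1 k.1) ξ₁ ξ₂ ξ₃ x = 0 := by
  rw [extDerivTwoForm, dirDeriv_areaForm (h₂.hasDirDerivAt hx _) (h₃.hasDirDerivAt hx _),
    dirDeriv_areaForm (h₁.hasDirDerivAt hx _) (h₃.hasDirDerivAt hx _),
    dirDeriv_areaForm (h₁.hasDirDerivAt hx _) (h₂.hasDirDerivAt hx _)]
  simp only [frechetLieBracket, areaForm, ← map_add, ← map_sub, AddSubgroupClass.coe_sub]
  refine areaL_eq_zero fun s hs => ?_
  simp only [add_apply, sub_apply, mul_apply, areaDensity_apply _ _ _ hs, conformalFactorDeriv,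
    neg_apply, map_apply, conjL_apply, conformalFactor_apply _ hs, conformal_eq_ofReal]
  -- With the derivative of this factor already expanded, only its being real matters.
  generalize (1 + Complex.normSq (x.1 s))⁻¹ = r
  simp only [Complex.add_im, Complex.sub_im, Complex.mul_im, Complex.add_re, Complex.sub_re,
    Complex.mul_re, Complex.neg_im, Complex.neg_re, Complex.conj_re, Complex.conj_im,
    Complex.ofReal_re, Complex.ofReal_im, map_sub]
  ring

theorem isSymplecticForm_horiz (c : Prop) :
    IsSymplecticForm (modelSpace L c) (horiz L c) darbouxForm := by
  have key : ∀ X ∈ horiz L c, ∃ R f, IsFrame c R ∧ X = ofCoord R f ∧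
      tangentVectors (horiz L c) X = LinearMap.range (tangentMap c R f) := by
    intro X hX
    obtain ⟨R, hR, h⟩ := exists_frame hX
    have h1 := ofCoord_coord_of_mem hR hX h
    have h2 := tangentVectors_horiz hR (coord_mem hR hX h)
    rw [h1] at h2
    exact ⟨R, coord R X, hR, h1.symm, h2⟩
  have hform : ∀ (e : OpenPartialHomeomorph (horiz L c) (modelSpace L c)),
      e ∈ atlas (modelSpace L c) (horiz L c) → chartForm darbouxForm e =
        fun f h k : modelSpace L c => areaForm f.1 h.1 k.1 := by
    rintro e ⟨R, hR, rfl⟩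
    funext f h k
    exact chartForm_chart hR f h k
  constructor
  · intro X hX
    obtain ⟨R, f, -, -, hT⟩ := key X hX
    exact ⟨_, hT.symm⟩
  · intro X hX u hu v hv w hw
    obtain ⟨R, f, hR, rfl, hT⟩ := key X hX
    rw [hT] at hu hv hw
    obtain ⟨h, rfl⟩ := hu
    obtain ⟨k, rfl⟩ := hv
    obtain ⟨l, rfl⟩ := hw
    rw [← map_add]
    simp only [tangentMap, LinearMap.coe_mk, AddHom.coe_mk, darbouxForm_ofCoord hR]
    exact areaForm_add_left f h.1 k.1 l.1
  · intro X hX a u hu w hw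
    obtain ⟨R, f, hR, rfl, hT⟩ := key X hX
    rw [hT] at hu hw
    obtain ⟨h, rfl⟩ := hu
    obtain ⟨l, rfl⟩ := hw
    rw [← map_smul]
    simp only [tangentMap, LinearMap.coe_mk, AddHom.coe_mk, darbouxForm_ofCoord hR]
    exact areaForm_smul_left f a h.1 l.1
  · intro X hX u hu w hw
    obtain ⟨R, f, hR, rfl, hT⟩ := key X hX
    rw [hT] at hu hw
    obtain ⟨h, rfl⟩ := hu
    obtain ⟨l, rfl⟩ := hw
    simp only [tangentMap, LinearMap.coe_mk, AddHom.coe_mk, darbouxForm_ofCoord hR]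
    exact areaForm_skew f h.1 l.1
  · intro e he
    rw [hform e he]
    exact (smooth_areaForm c).mono (subset_univ _)
  · intro X hX u hu huw
    obtain ⟨R, f, hR, rfl, hT⟩ := key X hX
    rw [hT] at hu huw
    obtain ⟨h, rfl⟩ := hu
    -- The test vector is the image of $ih$, which lies in the model space since multiplication by
    -- $i$ acts pointwise.
    have h1 := huw _ ⟨⟨_, map_mem_modelSpace (Complex.I • ContinuousLinearMap.id ℝ ℂ) h.2⟩, rfl⟩
    simp only [tangentMap, LinearMap.coe_mk, AddHom.coe_mk, darbouxForm_ofCoord hR] at h1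
    rw [show h = 0 from Subtype.ext (eq_zero_of_areaForm h1), map_zero]
  · intro e he W _ _ ξ₁ ξ₂ ξ₃ h₁ h₂ h₃ x hx
    rw [hform e he]
    exact extDeriv_areaForm h₁ h₂ h₃ hx

theorem isSymplecticFrechetManifold_horiz (c : Prop) :
    IsSymplecticFrechetManifold (horiz L c) darbouxForm :=
  ⟨modelSpace L c, inferInstance, inferInstance, inferInstance, inferInstance,
    isFrechetSubmanifold_horiz c, isSymplecticForm_horiz c⟩

end SmoothCurve

end

theorem mainTheorem1 (L : ℝ) [Fact (0 < L)] :
    IsSymplecticFrechetManifold (horizDarboux L) darbouxForm ∧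
      IsSymplecticFrechetManifold (horizPeriodicDarboux L) darbouxForm := by
  rw [SmoothCurve.horizDarboux_eq, SmoothCurve.horizPeriodicDarboux_eq]
  exact ⟨SmoothCurve.isSymplecticFrechetManifold_horiz False,
    SmoothCurve.isSymplecticFrechetManifold_horiz True⟩
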